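/- **Theorem 3.1.** *Notation.* Let $d,r$ be non-negative integers, $\mathbb Z_+=\{0,1,2,\dots\}$, and let $\|\cdot\|$ denote the supremum norm of a real function on $\mathbb R^d\times\mathbb Z_+^r$. For such a function $F(x,y)$, $\partial_jF$ is the $j$-th partial derivative in $x$, $\partial_{jk}F=\partial_j(\partial_kF)$, $\partial_{jk\ell}F=\partial_j(\partial_{k}(\partial_\ell F))$, $\Delta_kF(x,y)=F(x,y+e_k)-F(x,y)$ with $e_k$ the $k$-th unit vector of $\mathbb Z_+^r$, and $\Delta_{jk}F=\Delta_j(\Delta_kF)$. Let $\mathcal C_3$ be the set of $C^3$ functions $g:\mathbb R^d\to\mathbb R$ that are bounded together with all partial derivatives of order at most $3$, have Lipschitz constant at most $1$ with respect to the Euclidean norm, and have all partial derivatives of orders $2$ and $3$ bounded by $1$ in absolute value. Let $\mathcal H_3$ be the set of $h:\mathbb R^d\times\mathbb Z_+^r\to\mathbb R$ with $\|h\|\le 1$ and $h(\cdot,y)\in\mathcal C_3$ for every $y\in\mathbb Z_+^r$. *Setting.* Let $(I_\alpha)_{\alpha\in\Gamma}$ be a finite family of $0$–$1$ valued random variables,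 and for each $\alpha\in\Gamma$ let $(J_{\beta\alpha})_{\beta\in\Gamma}$ be $0$–$1$ valued random variables on the same probability space such that $$\mathcal L\big((J_{\beta\alpha})_{\beta\in\Gamma}\,\big|\,I_\alpha=1\big)=\mathcal L\big((I_\beta)_{\beta\in\Gamma}\big)$$ (no condition if $\mathbb P(I_\alpha=1)=0$). Let $\Gamma=\Gamma_1\uplus\Gamma_2$, $\Gamma_1=\biguplus_{j=1}^d\Gamma_{1j}$, $\Gamma_2=\biguplus_{j=1}^r\Gamma_{2j}$ be a partition and $s_1,\dots,s_d>0$ constants. Put $p_\alpha=\mathbb E I_\alpha$, $$W_{1j}=\frac1{s_j}\sum_{\alpha\in\Gamma_{1j}}(I_\alpha-p_\alpha),\qquad W_{2j}=\sum_{\alpha\in\Gamma_{2j}}I_\alpha,$$ $W_1=(W_{11},\dots,W_{1d})$, $W_2=(W_{21},\dots,W_{2r})$, $\Sigma=\operatorname{Cov}(W_1)$ and $\lambda_j=\mathbb EW_{2j}$, and assume $\lambda_j>0$ for all $j$. Let $Z\sim\mathcal N_d(0,\Sigma)$ and $N\sim\prod_{j=1}^r\mathrm{Po}(\lambda_j)$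 be independent. For $h\in\mathcal H_3$ and $u\in[0,1]$ put $$S_uh(x,z)=\mathbb E\,h(\sqrt{1-u}\,x+\sqrt u\,Z,z),\qquad T_uh(x,y)=\sum_{z\in\mathbb Z_+^r}S_uh(x,z)\,p_u(y,z),$$ $$p_u(y,z)=\prod_{j=1}^r\ \sum_{k=0}^{\min(y_j,z_j)}\binom{y_j}{k}(1-u)^ku^{y_j-k}(\lambda_ju)^{z_j-k}\frac{e^{-\lambda_ju}}{(z_j-k)!},$$ $$f_h(x,y)=-\int_0^1\frac{1}{2(1-u)}\big[T_uh(x,y)-\mathbb E h(Z,N)\big]\,du .$$ *Conclusion.* For each $h\in\mathcal H_3$, the function $f_h$ is well defined (the series and the integral converge absolutely), it is $C^3$ in $x$, all supremum norms below are finite, and $$\begin{aligned} \big|\mathbb E h(W_1,W_2)-\mathbb E h(Z,N)\big| \le{}&\sum_{j,k=1}^d\frac{\|\partial_{jk}f_h\|}{s_js_k}\sqrt{\operatorname{Var}\Big(\mathbb E\Big[\sum_{\alpha\in\Gamma_{1j}}I_\alpha\sum_{\beta\in\Gamma_{1k}}(I_\beta-J_{\beta\alpha})\,\Big|\,W_1,W_2\Big]\Big)}\\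 &+\frac12\sum_{j,k,\ell=1}^d\frac{\|\partial_{jk\ell}f_h\|}{s_js_ks_\ell}\sum_{\alpha\in\Gamma_{1j}}\mathbb E\Big|I_\alpha\sum_{\beta\in\Gamma_{1k}}(I_\beta-J_{\beta\alpha})\sum_{\gamma\in\Gamma_{1\ell}}(I_\gamma-J_{\gamma\alpha})\Big|\\ &+\sum_{j=1}^d\sum_{k=1}^r\frac{\|\Delta_k(\partial_jf_h)\|}{s_j}\sum_{\alpha\in\Gamma_{1j}}\mathbb E\Big|I_\alpha\sum_{\beta\in\Gamma_{2k}}(I_\beta-J_{\beta\alpha})\Big|\\ &+2\sum_{k=1}^r\sum_{j=1}^d\frac{\|\Delta_k(\partial_jf_h)\|}{s_j}\sum_{\alpha\in\Gamma_{2k}}\mathbb E\Big|I_\alpha\sum_{\beta\in\Gamma_{1j}}(I_\beta-J_{\beta\alpha})\Big|\\ &+2\max_{1\le j,k\le r}\|\Delta_{jk}f_h\|\Big(\sum_{\alpha\in\Gamma_2}p_\alpha^2+\sum_{\alpha\in\Gamma_2}\sum_{\beta\in\Gamma_2\setminus\{\alpha\}}\mathbb E\big[I_\alpha|I_\beta-J_{\beta\alpha}|\big]\Big),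 \end{aligned}$$ where the maximum is read as $0$ if $r=0$. -/

import Mathlib

open MeasureTheory ProbabilityTheory

noncomputable section

namespace NormalPoisson

/-- Euclidean space `ℝ^d` (with the Euclidean norm). -/
abbrev E (d : ℕ) := EuclideanSpace ℝ (Fin d)

/-- The lattice `ℤ_+^r`. -/
abbrev L (r : ℕ) := Fin r → ℕ

/-! ### Partial derivatives, partial differences, supremum norm -/

/-- The partial derivative `∂_j g` of a function on `ℝ^d`. -/
def pderiv {d : ℕ} (j : Fin d) (g : E d → ℝ) (x : E d) : ℝ :=
  lineDeriv ℝ g x (EuclideanSpace.single j 1)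

/-- The partial derivative `∂_j F` in the first argument of a function on `ℝ^d × ℤ_+^r`. -/
def dX {d r : ℕ} (j : Fin d) (F : E d → L r → ℝ) : E d → L r → ℝ :=
  fun x y => pderiv j (fun x' => F x' y) x

/-- The partial difference `Δ_k F (x, y) = F (x, y + e_k) - F (x, y)`. -/
def dY {d r : ℕ} (k : Fin r) (F : E d → L r → ℝ) : E d → L r → ℝ :=
  fun x y => F x (y + Pi.single k 1) - F x y

/-- Boundedness of a function on `ℝ^d × ℤ_+^r`, i.e. finiteness of its supremum norm. -/
def IsBdd {d r : ℕ} (F : E d → L r → ℝ) : Prop :=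
  ∃ C : ℝ, ∀ x y, |F x y| ≤ C

/-- The supremum norm of a (bounded) function on `ℝ^d × ℤ_+^r`. -/
def supNorm {d r : ℕ} (F : E d → L r → ℝ) : ℝ :=
  ⨆ p : E d × L r, |F p.1 p.2|

/-! ### The test functions -/

/-- The class `C_3`: `g` is `C^3`, `g` and all its partial derivatives up to order three are
bounded, the Lipschitz seminorm of `g` is at most one, and all partial derivatives of orders two
and three are bounded by one. (Boundedness of the first partial derivatives is implied by the
Lipschitz condition; the order of differentiation is immaterial for a `C^3` function.) -/
structure MemC3 {d : ℕ} (g : E d → ℝ) : Prop where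
  contDiff : ContDiff ℝ 3 g
  bounded : ∃ C : ℝ, ∀ x, |g x| ≤ C
  lipschitz : LipschitzWith 1 g
  second : ∀ (j k : Fin d) (x : E d), |pderiv j (pderiv k g) x| ≤ 1
  third : ∀ (j k l : Fin d) (x : E d), |pderiv j (pderiv k (pderiv l g)) x| ≤ 1

/-- The class `H_3` of test functions on `ℝ^d × ℤ_+^r`. -/
structure MemH3 {d r : ℕ} (h : E d → L r → ℝ) : Prop where
  bound : ∀ x y, |h x y| ≤ 1
  section_mem : ∀ y, MemC3 (fun x => h x y)

/-! ### The limit law and the function `f_h` -/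

/-- The centred normal distribution on `ℝ^d` with (possibly singular) covariance matrix `S`. -/
def normalLaw {d : ℕ} (S : Matrix (Fin d) (Fin d) ℝ) : Measure (E d) :=
  multivariateGaussian 0 S

/-- The product of Poisson distributions with means `lam j`. -/
def poissonLaw {r : ℕ} (lam : Fin r → ℝ) : Measure (L r) :=
  Measure.pi fun j => poissonMeasure (lam j).toNNReal

/-- `E h(Z, N)` for independent `Z ∼ N(0, S)` and `N ∼ Po(lam)`. -/
def limitMean {d r : ℕ} (S : Matrix (Fin d) (Fin d) ℝ) (lam : Fin r → ℝ)
    (h : E d → L r → ℝ) : ℝ :=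
  ∫ p, h p.1 p.2 ∂((normalLaw S).prod (poissonLaw lam))

/-- The Slepian interpolation `S_s h (x, y) = E h(√(1-s) x + √s Z, y)`, `Z ∼ N(0, S)`. -/
def slepian {d r : ℕ} (S : Matrix (Fin d) (Fin d) ℝ) (s : ℝ)
    (h : E d → L r → ℝ) (x : E d) (y : L r) : ℝ :=
  ∫ z, h (Real.sqrt (1 - s) • x + Real.sqrt s • z) y ∂(normalLaw S)

/-- The transition probability `p_s(y, z)`. -/
def transProb {r : ℕ} (lam : Fin r → ℝ) (s : ℝ) (y z : L r) : ℝ :=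
  ∏ j, ∑ k ∈ Finset.range (min (y j) (z j) + 1),
    ((y j).choose k : ℝ) * (1 - s) ^ k * s ^ (y j - k) * (lam j * s) ^ (z j - k)
      * (Real.exp (-(lam j * s)) / ((z j - k).factorial : ℝ))

/-- The interpolation operator `T_s h (x, y) = ∑_z S_s h (x, z) p_s(y, z)`. -/
def interp {d r : ℕ} (S : Matrix (Fin d) (Fin d) ℝ) (lam : Fin r → ℝ) (s : ℝ)
    (h : E d → L r → ℝ) (x : E d) (y : L r) : ℝ :=
  ∑' z : L r, slepian S s h x z * transProb lam s y z

/-- The integrand `(T_s h (x, y) - E h(Z, N)) / (2 (1 - s))`. -/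
def integrand {d r : ℕ} (S : Matrix (Fin d) (Fin d) ℝ) (lam : Fin r → ℝ)
    (h : E d → L r → ℝ) (x : E d) (y : L r) (s : ℝ) : ℝ :=
  1 / (2 * (1 - s)) * (interp S lam s h x y - limitMean S lam h)

/-- The function
`f_h (x, y) = - ∫_0^1 (T_s h (x, y) - E h(Z, N)) / (2 (1 - s)) ds`. -/
def steinSol {d r : ℕ} (S : Matrix (Fin d) (Fin d) ℝ) (lam : Fin r → ℝ)
    (h : E d → L r → ℝ) (x : E d) (y : L r) : ℝ :=
  -∫ s in (0 : ℝ)..1, integrand S lam h x y s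

/-- `f_h` is well defined (its defining series and integral converge absolutely), it is `C^3` in
`x`, and the derivatives and differences whose supremum norms enter the bound are bounded. -/
structure SteinSolRegular {d r : ℕ} (S : Matrix (Fin d) (Fin d) ℝ) (lam : Fin r → ℝ)
    (h : E d → L r → ℝ) : Prop where
  summable : ∀ s ∈ Set.Icc (0 : ℝ) 1, ∀ x y,
    Summable fun z : L r => slepian S s h x z * transProb lam s y z
  integrable : ∀ x y, IntervalIntegrable (integrand S lam h x y) volume 0 1
  contDiff : ∀ y, ContDiff ℝ 3 fun x => steinSol S lam h x y
  bdd_second : ∀ j k, IsBdd (dX j (dX k (steinSol S lam h)))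
  bdd_third : ∀ j k l, IsBdd (dX j (dX k (dX l (steinSol S lam h))))
  bdd_cross : ∀ k j, IsBdd (dY k (dX j (steinSol S lam h)))
  bdd_diff : ∀ j k, IsBdd (dY j (dY k (steinSol S lam h)))

/-! ### Sums of indicators

A partition of the index set `Γ` into blocks `Γ_{11}, …, Γ_{1d}, Γ_{21}, …, Γ_{2r}` is given by the
map `t : Γ → Fin d ⊕ Fin r` sending an index to (the label of) its block. -/

section Sums

variable {Ω Γ : Type*} [MeasurableSpace Ω] [Fintype Γ] {d r : ℕ}

/-- The block `Γ_{1j}`. -/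
def block1 (t : Γ → Fin d ⊕ Fin r) (j : Fin d) : Finset Γ :=
  Finset.univ.filter fun α => t α = Sum.inl j

/-- The block `Γ_{2j}`. -/
def block2 (t : Γ → Fin d ⊕ Fin r) (j : Fin r) : Finset Γ :=
  Finset.univ.filter fun α => t α = Sum.inr j

/-- `Γ_2`, the union of the blocks `Γ_{2j}`. -/
def union2 (t : Γ → Fin d ⊕ Fin r) : Finset Γ :=
  Finset.univ.filter fun α => ∃ j, t α = Sum.inr j

/-- `p_α = E I_α`. -/
def prob (μ : Measure Ω) (I : Γ → Ω → ℕ) (α : Γ) : ℝ :=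
  ∫ ω, (I α ω : ℝ) ∂μ

/-- `W_1`, with coordinates `W_{1j} = s_j⁻¹ ∑_{α ∈ Γ_{1j}} (I_α - p_α)`. -/
def W1 (μ : Measure Ω) (I : Γ → Ω → ℕ) (t : Γ → Fin d ⊕ Fin r) (s : Fin d → ℝ) (ω : Ω) : E d :=
  WithLp.toLp 2 fun j => 1 / s j * ∑ α ∈ block1 t j, ((I α ω : ℝ) - prob μ I α)

/-- `W_2`, with coordinates `W_{2j} = ∑_{α ∈ Γ_{2j}} I_α`. -/
def W2 (I : Γ → Ω → ℕ) (t : Γ → Fin d ⊕ Fin r) (ω : Ω) : L r :=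
  fun j => ∑ α ∈ block2 t j, I α ω

/-- The covariance matrix of `W_1`. -/
def covW1 (μ : Measure Ω) (I : Γ → Ω → ℕ) (t : Γ → Fin d ⊕ Fin r) (s : Fin d → ℝ) :
    Matrix (Fin d) (Fin d) ℝ :=
  Matrix.of fun j k => covariance (fun ω => W1 μ I t s ω j) (fun ω => W1 μ I t s ω k) μ

/-- `λ_j = E W_{2j}`. -/
def meanW2 (μ : Measure Ω) (I : Γ → Ω → ℕ) (t : Γ → Fin d ⊕ Fin r) (j : Fin r) : ℝ :=
  ∫ ω, (W2 I t ω j : ℝ) ∂μ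

/-- The σ-algebra generated by `(W_1, W_2)`. -/
abbrev sigmaW (μ : Measure Ω) (I : Γ → Ω → ℕ) (t : Γ → Fin d ⊕ Fin r) (s : Fin d → ℝ) :
    MeasurableSpace Ω :=
  MeasurableSpace.comap (fun ω => (W1 μ I t s ω, W2 I t ω)) inferInstance

/-- The difference `I_β - J_{βα}`, a real random variable; `J β α` stands for `J_{βα}`. -/
def diffIJ (I : Γ → Ω → ℕ) (J : Γ → Γ → Ω → ℕ) (α β : Γ) (ω : Ω) : ℝ :=
  (I β ω : ℝ) - (J β α ω : ℝ)

/-- The coupling condition: for each `α`, the conditional law of `(J_{βα})_β` given `I_α = 1` is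
the law of `(I_β)_β`. When `I_α = 1` has probability zero, the value at `1` of a regular
conditional distribution given `I_α` is arbitrary, so that there is no condition. -/
def IsCoupling (μ : Measure Ω) (I : Γ → Ω → ℕ) (J : Γ → Γ → Ω → ℕ) : Prop :=
  ∀ α, μ {ω | I α ω = 1} ≠ 0 →
    (cond μ {ω | I α ω = 1}).map (fun ω β => J β α ω) = μ.map (fun ω β => I β ω)

end Sums

end NormalPoisson

end

noncomputable section

namespace NormalPoisson

/-! ### Differential calculus with partial derivatives -/

/-! The proof is Stein's method with a solution built by interpolation. `T_u` runs from the identity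
(`interp_zero`) to the limit expectation (`interp_one`). In the continuous variable it is a Gaussian
smoothing. In the discrete one, each of the `y_j` initial particles survives with probability `1 -
u`, and an independent Poisson number with mean `λ_j u` is added. Gaussian integration by parts, the
Kolmogorov equation for the transition probabilities and summation by parts on the lattice express
the time derivative of `T_u h` through `T_u` applied to derivatives and differences of `h`
(`hasDerivAt_interp_time`).

The commutation rules are `∂_j T_u = √(1-u) T_u ∂_j` (`hasFDerivAt_interp`) and `Δ_k T_u = (1-u) T_u
Δ_k` (`dY_interp`). The weight `1/(2(1-u))` in `f_h` is chosen for them: `∂_jk f_h` and `Δ_k f_h`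
become `-1/2` times the plain time integrals of `T_u ∂_jk h` and `T_u Δ_k h`. Integrating the time
derivative over `[0,1]` therefore gives the Stein equation (`stein_equation`) `∑ Σ_jk ∂_jk f - ∑ x_j
∂_j f + 2 ∑ (λ_k Δ_k f(x,y) - y_k Δ_k f(x,y-e_k)) = h - E h(Z,N)`. The defining integral converges
because `T_u h - E h(Z,N) = O(√(1-u))` for fixed `(x,y)`.

Evaluating this equation at `(W_1, W_2)` and taking expectations leaves two parts, both treated with
the coupling identity `p_α E G(I) = E I_α G(J_{·α})` (`integral_coupling`). In the normal part, `E
W_{1j} ∂_j f(W)` becomes a sum of `E I_α (∂_j f(W) - ∂_j f(W^α))`, where `W^α` is computed from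
`J_{·α}`. Its linear term is centred by the covariance matrix, giving the conditional variance; the
remainder gives third derivatives and mixed terms (`abs_integral_normal_part_le`). In the Poisson
part, `Δ_k f` at `W^α` is compared with its value at `W` with the point `α` removed
(`abs_integral_poisson_part_le`). -/

/-- The linear form on `ℝ^d` with given coefficients. -/
def gradCLM (d : ℕ) : (Fin d → ℝ) →L[ℝ] (E d →L[ℝ] ℝ) :=
  ∑ j, (ContinuousLinearMap.proj (R := ℝ) (φ := fun _ : Fin d => ℝ) j).smulRight
    (EuclideanSpace.proj j : E d →L[ℝ] ℝ)

lemma gradCLM_apply {d : ℕ} (v : Fin d → ℝ) (w : E d) : gradCLM d v w = ∑ j, v j * w j := by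
  simp [gradCLM]

lemma gradCLM_single {d : ℕ} (v : Fin d → ℝ) (j : Fin d) :
    gradCLM d v (EuclideanSpace.single j 1) = v j := by
  simp [gradCLM_apply]

lemma abs_apply_le_norm {d : ℕ} (w : E d) (j : Fin d) : |w j| ≤ ‖w‖ := by
  simpa using PiLp.norm_apply_le w j

lemma norm_gradCLM_le {d : ℕ} (v : Fin d → ℝ) : ‖gradCLM d v‖ ≤ ∑ j, |v j| := by
  refine ContinuousLinearMap.opNorm_le_bound _ (by positivity) fun w => ?_
  rw [gradCLM_apply, Real.norm_eq_abs, Finset.sum_mul]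
  refine (Finset.abs_sum_le_sum_abs _ _).trans (Finset.sum_le_sum fun j _ => ?_)
  rw [abs_mul]
  gcongr
  exact abs_apply_le_norm w j

lemma eq_gradCLM {d : ℕ} (l : E d →L[ℝ] ℝ) :
    l = gradCLM d fun j => l (EuclideanSpace.single j 1) := by
  ext w
  rw [gradCLM_apply]
  conv_lhs => rw [← (EuclideanSpace.basisFun (Fin d) ℝ).sum_repr w]
  simp [mul_comm]

lemma pderiv_of_hasFDerivAt {d : ℕ} {g : E d → ℝ} {l : E d →L[ℝ] ℝ} {x : E d}
    (hg : HasFDerivAt g l x) (j : Fin d) : pderiv j g x = l (EuclideanSpace.single j 1) :=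
  (hg.hasLineDerivAt _).lineDeriv

lemma pderiv_of_gradCLM {d : ℕ} {g : E d → ℝ} {v : Fin d → ℝ} {x : E d}
    (hg : HasFDerivAt g (gradCLM d v) x) (j : Fin d) : pderiv j g x = v j := by
  rw [pderiv_of_hasFDerivAt hg, gradCLM_single]

lemma hasFDerivAt_gradCLM {d : ℕ} {g : E d → ℝ} {x : E d} (hg : DifferentiableAt ℝ g x) :
    HasFDerivAt g (gradCLM d fun j => pderiv j g x) x := by
  have h := hg.hasFDerivAt
  simp_rw [pderiv_of_hasFDerivAt h, ← eq_gradCLM]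
  exact h

lemma pderiv_eq_fderiv {d : ℕ} {g : E d → ℝ} (hg : Differentiable ℝ g) (j : Fin d) :
    pderiv j g = fun x => fderiv ℝ g x (EuclideanSpace.single j 1) := by
  ext x
  exact pderiv_of_hasFDerivAt (hg x).hasFDerivAt j

lemma contDiff_pderiv {d : ℕ} {g : E d → ℝ} {n : ℕ} (hg : ContDiff ℝ (n + 1 : ℕ) g) (j : Fin d) :
    ContDiff ℝ n (pderiv j g) := by
  rw [pderiv_eq_fderiv (hg.differentiable (by simp))]
  exact (hg.fderiv_right (m := n) (by simp)).clm_apply contDiff_const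

/-- Working with gradient coefficients allows smoothness of a time integral to be obtained by
induction on the order, one explicit gradient at a time. -/
lemma contDiff_succ_of_hasFDerivAt {d : ℕ} {g : E d → ℝ} {v : E d → Fin d → ℝ} {n : ℕ}
    (hg : ∀ x, HasFDerivAt g (gradCLM d (v x)) x) (hv : ∀ j, ContDiff ℝ n fun x => v x j) :
    ContDiff ℝ (n + 1 : ℕ) g := by
  rw [Nat.cast_add, Nat.cast_one, contDiff_succ_iff_hasFDerivAt]
  refine ⟨fun x => gradCLM d (v x), ?_, hg⟩
  exact (gradCLM d).contDiff.comp (contDiff_pi.2 hv)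

lemma pderiv_comm {d : ℕ} {g : E d → ℝ} (hg : ContDiff ℝ 2 g) (j k : Fin d) :
    pderiv j (pderiv k g) = pderiv k (pderiv j g) := by
  have h1 : Differentiable ℝ g := hg.differentiable (by simp)
  have h2 : Differentiable ℝ (fderiv ℝ g) :=
    (hg.fderiv_right (m := 1) (by norm_num)).differentiable (by simp)
  have key : ∀ (v w x : E d), fderiv ℝ (fun x => fderiv ℝ g x v) x w
      = fderiv ℝ (fderiv ℝ g) x w v := by
    intro v w x
    have := ((h2 x).hasFDerivAt.clm_apply (hasFDerivAt_const v x)).fderiv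
    simp [this]
  have h3 : ∀ k, Differentiable ℝ (pderiv k g) := fun k => by
    rw [pderiv_eq_fderiv h1]
    exact fun x => (h2 x).clm_apply (differentiableAt_const _)
  rw [pderiv_eq_fderiv (h3 k), pderiv_eq_fderiv (h3 j), pderiv_eq_fderiv h1, pderiv_eq_fderiv h1]
  ext x
  rw [key, key]
  exact (hg.contDiffAt.isSymmSndFDerivAt (by simp)) _ _

lemma hasDerivAt_line {d : ℕ} {g : E d → ℝ} (hg : Differentiable ℝ g) (x v : E d) (τ : ℝ) :
    HasDerivAt (fun τ : ℝ => g (x + τ • v)) (∑ j, pderiv j g (x + τ • v) * v j) τ := by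
  have h1 := hasFDerivAt_gradCLM (hg (x + τ • v))
  have h2 : HasDerivAt (fun τ : ℝ => x + τ • v) v τ := by
    simpa using ((hasDerivAt_id τ).smul_const v).const_add x
  have := h1.comp_hasDerivAt τ h2
  rwa [gradCLM_apply] at this

/-- Mean value bound with coordinatewise bounds on the gradient. -/
lemma abs_sub_le_of_pderiv {d : ℕ} {g : E d → ℝ} (hg : Differentiable ℝ g) {M : Fin d → ℝ}
    (hM : ∀ j x, |pderiv j g x| ≤ M j) (x x' : E d) :
    |g x' - g x| ≤ ∑ j, M j * |x' j - x j| := by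
  have h := (convex_univ (𝕜 := ℝ) (E := ℝ)).norm_image_sub_le_of_norm_hasDerivWithin_le
    (f := fun τ : ℝ => g (x + τ • (x' - x))) (C := ∑ j, M j * |x' j - x j|)
    (fun τ _ => (hasDerivAt_line hg x (x' - x) τ).hasDerivWithinAt) (fun τ _ => ?_)
    (Set.mem_univ 0) (Set.mem_univ 1)
  · simpa using h
  · refine (Finset.abs_sum_le_sum_abs _ _).trans (Finset.sum_le_sum fun j _ => ?_)
    rw [abs_mul]
    exact mul_le_mul_of_nonneg_right (hM _ _) (abs_nonneg _)

/-- First order Taylor expansion with coordinatewise bounds on the second derivatives. -/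
lemma abs_taylor_le {d : ℕ} {g : E d → ℝ} (hg : ContDiff ℝ 2 g) {M : Fin d → Fin d → ℝ}
    (hM : ∀ k l x, |pderiv l (pderiv k g) x| ≤ M k l) (x x' : E d) :
    |g x' - g x - ∑ k, pderiv k g x * (x' k - x k)|
      ≤ 1 / 2 * ∑ k, ∑ l, M k l * (|x' k - x k| * |x' l - x l|) := by
  have h1 : Differentiable ℝ g := hg.differentiable (by simp)
  have h2 : ∀ k, Differentiable ℝ (pderiv k g) := fun k =>
    (contDiff_pderiv (n := 1) hg k).differentiable (by simp)
  set C := ∑ k, ∑ l, M k l * (|x' k - x k| * |x' l - x l|) with hC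
  set φ : ℝ → ℝ := fun τ => g (x + τ • (x' - x)) - τ * ∑ k, pderiv k g x * (x' k - x k) with hφ
  have hd : ∀ τ, HasDerivAt φ
      (∑ k, (pderiv k g (x + τ • (x' - x)) - pderiv k g x) * (x' k - x k)) τ := by
    intro τ
    have := (hasDerivAt_line h1 x (x' - x) τ).sub
      ((hasDerivAt_id τ).mul_const (∑ k, pderiv k g x * (x' k - x k)))
    exact this.congr_deriv (by simp [sub_mul])
  have hb : ∀ τ ∈ Set.Ico (0 : ℝ) 1,
      ‖∑ k, (pderiv k g (x + τ • (x' - x)) - pderiv k g x) * (x' k - x k)‖ ≤ C * τ := by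
    intro τ hτ
    rw [hC, Finset.sum_mul]
    refine (Finset.abs_sum_le_sum_abs _ _).trans (Finset.sum_le_sum fun k _ => ?_)
    rw [abs_mul]
    have := abs_sub_le_of_pderiv (h2 k) (M := M k) (fun l x => hM k l x) x (x + τ • (x' - x))
    refine (mul_le_mul_of_nonneg_right this (abs_nonneg _)).trans (le_of_eq ?_)
    rw [Finset.sum_mul, Finset.sum_mul]
    refine Finset.sum_congr rfl fun l _ => ?_
    simp [abs_mul, abs_of_nonneg hτ.1]
    ring
  -- `φ` is `g` along the segment minus its linear part, so its derivative is at most `C τ`;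
  -- comparison with `C τ ^ 2 / 2` produces the factor `1/2`.
  have := image_norm_le_of_norm_deriv_right_le_deriv_boundary (a := 0) (b := 1)
    (f := fun τ => φ τ - φ 0) (B := fun τ => C * τ ^ 2 / 2) (B' := fun τ => C * τ)
    (fun τ _ => ((hd τ).sub_const _).continuousAt.continuousWithinAt)
    (fun τ _ => ((hd τ).sub_const _).hasDerivWithinAt) (by simp)
    (fun τ => by
      exact (((hasDerivAt_pow 2 τ).const_mul C).div_const 2).congr_deriv (by simp; ring)) hb
    (Set.right_mem_Icc.2 zero_le_one)
  simp only [hφ, Real.norm_eq_abs] at this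
  simp only [one_smul, zero_smul, zero_mul, one_mul, add_zero, sub_zero, add_sub_cancel] at this
  refine (le_of_eq ?_).trans (this.trans (le_of_eq (by ring)))
  congr 1; ring

/-! ### Bounded smooth functions on `ℝ^d × ℤ_+^r` -/

/-- Functions with continuous sections that are bounded together with their partial derivatives in
the first argument up to order `n`. -/
def BddSmooth {d r : ℕ} : ℕ → (E d → L r → ℝ) → Prop
  | 0, F => (∀ y, Continuous fun x => F x y) ∧ IsBdd F
  | n + 1, F => (∀ y, ContDiff ℝ 1 fun x => F x y) ∧ IsBdd F ∧ ∀ j, BddSmooth n (dX j F)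

section

variable {d r : ℕ} {F : E d → L r → ℝ}

lemma BddSmooth.continuous {n : ℕ} (h : BddSmooth n F) (y : L r) :
    Continuous fun x => F x y := by
  cases n with
  | zero => exact h.1 y
  | succ n => exact (h.1 y).continuous

lemma BddSmooth.isBdd {n : ℕ} (h : BddSmooth n F) : IsBdd F := by
  cases n with
  | zero => exact h.2
  | succ n => exact h.2.1

lemma BddSmooth.zero {n : ℕ} (h : BddSmooth n F) : BddSmooth 0 F := ⟨h.continuous, h.isBdd⟩

lemma IsBdd.exists_nonneg (h : IsBdd F) : ∃ C, 0 ≤ C ∧ ∀ x y, |F x y| ≤ C := by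
  obtain ⟨C, hC⟩ := h
  exact ⟨|C|, abs_nonneg _, fun x y => (hC x y).trans (le_abs_self C)⟩

lemma IsBdd.dY (h : IsBdd F) (k : Fin r) : IsBdd (dY k F) := by
  obtain ⟨C, hC⟩ := h
  refine ⟨C + C, fun x y => ?_⟩
  exact (abs_sub _ _).trans (add_le_add (hC _ _) (hC _ _))

lemma BddSmooth.dY_zero {n : ℕ} (h : BddSmooth n F) (k : Fin r) : BddSmooth 0 (dY k F) :=
  ⟨fun _ => (h.continuous _).sub (h.continuous _), h.isBdd.dY k⟩

lemma abs_le_supNorm (h : IsBdd F) (x : E d) (y : L r) : |F x y| ≤ supNorm F := by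
  obtain ⟨C, hC⟩ := h
  exact le_ciSup (f := fun p : E d × L r => |F p.1 p.2|)
    ⟨C, by rintro _ ⟨p, rfl⟩; exact hC _ _⟩ (x, y)

/-- First derivatives are controlled by the Lipschitz constant through the operator norm of
`fderiv`; the other bounds are part of the definition of the class. All bounds are uniform in `y`.
-/
lemma MemH3.bddSmooth {h : E d → L r → ℝ} (hh : MemH3 h) : BddSmooth 3 h := by
  have hc : ∀ y, ContDiff ℝ (2 + 1 : ℕ) fun x => h x y := fun y => (hh.section_mem y).contDiff
  have h1 : ∀ j y, ContDiff ℝ (1 + 1 : ℕ) fun x => dX j h x y := fun j y =>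
    contDiff_pderiv (hc y) j
  have h2 : ∀ k j y, ContDiff ℝ (0 + 1 : ℕ) fun x => dX k (dX j h) x y := fun k j y =>
    contDiff_pderiv (h1 j y) k
  have h3 : ∀ l k j y, ContDiff ℝ (0 : ℕ) fun x => dX l (dX k (dX j h)) x y := fun l k j y =>
    contDiff_pderiv (h2 k j y) l
  refine ⟨fun y => (hc y).of_le (by norm_num), ⟨1, hh.bound⟩, fun j => ?_⟩
  refine ⟨fun y => (h1 j y).of_le (by norm_num), ⟨1, fun x y => ?_⟩, fun k => ?_⟩
  · have hd : Differentiable ℝ fun x => h x y := (hc y).differentiable (by simp)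
    have := norm_fderiv_le_of_lipschitz ℝ (x₀ := x) (hh.section_mem y).lipschitz
    simp only [dX, pderiv_eq_fderiv hd]
    refine ((fderiv ℝ (fun x => h x y) x).le_opNorm _).trans ?_
    simpa using this
  refine ⟨fun y => (h2 k j y).of_le (by norm_num), ⟨1, fun x y => ?_⟩, fun l => ?_⟩
  · exact (hh.section_mem y).second k j x
  · exact ⟨fun y => (h3 l k j y).continuous, ⟨1, fun x y => (hh.section_mem y).third l k j x⟩⟩

end

/-! ### Gaussian integration by parts -/

lemma integrable_id_gaussianReal : Integrable (fun t : ℝ => t) (gaussianReal 0 1) :=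
  IsGaussian.integrable_fun_id

lemma hasDerivAt_gaussianPDFReal (x : ℝ) :
    HasDerivAt (gaussianPDFReal 0 1) (-x * gaussianPDFReal 0 1 x) x := by
  have h : HasDerivAt (fun x : ℝ => -(x - 0) ^ 2 / (2 * 1)) (-x) x := by
    have := ((((hasDerivAt_id x).sub_const 0).pow 2).neg).div_const (2 * 1)
    exact this.congr_deriv (by simp; ring)
  have := (h.exp).const_mul (Real.sqrt (2 * Real.pi * (1 : NNReal)))⁻¹
  refine (this.congr_deriv ?_).congr_of_eventuallyEq ?_
  · simp [gaussianPDFReal]; ring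
  · exact Filter.Eventually.of_forall fun t => by simp [gaussianPDFReal]

/-- Stein's identity on the line: the Gaussian density has derivative `-t` times itself, so this is
integration by parts. Boundedness of `ψ` and `ψ'` makes every product integrable. -/
lemma integral_mul_gaussianReal {ψ ψ' : ℝ → ℝ} {C : ℝ} (hψ : ∀ t, HasDerivAt ψ (ψ' t) t)
    (hψ' : Continuous ψ') (hC : ∀ t, |ψ t| ≤ C) (hC' : ∀ t, |ψ' t| ≤ C) :
    ∫ t, t * ψ t ∂(gaussianReal 0 1) = ∫ t, ψ' t ∂(gaussianReal 0 1) := by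
  have hc : Continuous ψ := continuous_iff_continuousAt.2 fun t => (hψ t).continuousAt
  have hpdf := integrable_gaussianPDFReal 0 1
  have hi : Integrable fun t : ℝ => t * gaussianPDFReal 0 1 t := by
    have := integrable_id_gaussianReal
    rw [gaussianReal_of_var_ne_zero _ one_ne_zero,
      integrable_withDensity_iff_integrable_smul' (measurable_gaussianPDF 0 1)
        (by simp [gaussianPDF_lt_top])] at this
    simpa [toReal_gaussianPDF, mul_comm] using this
  have key := integral_mul_deriv_eq_deriv_mul_of_integrable (u := ψ) (v := gaussianPDFReal 0 1)
    (u' := ψ') (v' := fun t => -t * gaussianPDFReal 0 1 t) (fun t _ => hψ t)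
    (fun t _ => hasDerivAt_gaussianPDFReal t)
    ((hi.neg.bdd_mul (c := C) hc.aestronglyMeasurable
      (Filter.Eventually.of_forall hC)).congr (Filter.Eventually.of_forall fun t => by simp))
    (hpdf.bdd_mul (c := C) hψ'.aestronglyMeasurable (Filter.Eventually.of_forall hC'))
    (hpdf.bdd_mul (c := C) hc.aestronglyMeasurable (Filter.Eventually.of_forall hC))
  rw [integral_gaussianReal_eq_integral_smul one_ne_zero,
    integral_gaussianReal_eq_integral_smul one_ne_zero]
  have e1 : ∫ t, gaussianPDFReal 0 1 t • (t * ψ t)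
      = -∫ t, ψ t * (-t * gaussianPDFReal 0 1 t) := by
    rw [← integral_neg]
    congr 1; ext t; simp; ring
  rw [e1, key, neg_neg]
  congr 1; ext t; simp; ring

lemma integrable_coord_stdGaussian {d : ℕ} (i : Fin d) :
    Integrable (fun z : E d => z i) (stdGaussian (E d)) :=
  (EuclideanSpace.proj i : E d →L[ℝ] ℝ).integrable_comp IsGaussian.integrable_fun_id

/-- The standard Gaussian is the product of its `i`-th marginal and the rest; Fubini reduces the
claim to the one-dimensional identity on lines parallel to the `i`-th axis. -/
lemma integral_coord_mul_stdGaussian {d : ℕ} {ψ : E d → ℝ} (hψ : ContDiff ℝ 1 ψ) {C : ℝ}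
    (hC : ∀ z, |ψ z| ≤ C) (i : Fin d) (hC' : ∀ z, |pderiv i ψ z| ≤ C) :
    ∫ z, z i * ψ z ∂(stdGaussian (E d)) = ∫ z, pderiv i ψ z ∂(stdGaussian (E d)) := by
  have hdiff : Differentiable ℝ ψ := hψ.differentiable (by simp)
  have hpc : Continuous (pderiv i ψ) :=
    (contDiff_pderiv (n := 0) hψ i).continuous
  have hint1 : Integrable (fun z : E d => z i * ψ z) (stdGaussian (E d)) := by
    simpa [mul_comm] using (integrable_coord_stdGaussian i).bdd_mul (c := C)
      hψ.continuous.aestronglyMeasurable (Filter.Eventually.of_forall hC)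
  have hint2 : Integrable (pderiv i ψ) (stdGaussian (E d)) :=
    Integrable.of_bound hpc.aestronglyMeasurable C (Filter.Eventually.of_forall hC')
  cases d with
  | zero => exact i.elim0
  | succ n =>
    set ι : ℝ × (Fin n → ℝ) → E (n + 1) := fun p =>
      WithLp.toLp 2 ((MeasurableEquiv.piFinSuccAbove (fun _ => ℝ) i).symm p) with hι
    have hmp : MeasurePreserving ι
        ((gaussianReal 0 1).prod (Measure.pi fun _ : Fin n => gaussianReal 0 1))
        (stdGaussian (E (n + 1))) := by
      refine MeasurePreserving.comp (μb := Measure.pi fun _ => gaussianReal 0 1)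
        ⟨by fun_prop, map_pi_eq_stdGaussian⟩ ?_
      exact (measurePreserving_piFinSuccAbove
        (fun _ : Fin (n + 1) => gaussianReal 0 1) i).symm
    have hins : ∀ t w, ι (t, w) = WithLp.toLp 2 (i.insertNth t w) := fun _ _ => rfl
    have hline : ∀ t w, ι (t, w) = ι (0, w) + t • EuclideanSpace.single i 1 := by
      intro t w
      ext j
      refine Fin.succAboveCases i ?_ (fun j => ?_) j <;> simp [hins]
    have hcoord : ∀ t w, ι (t, w) i = t := by
      intro t w
      simp [hins]
    have hsing : ∀ j : Fin (n + 1), (EuclideanSpace.single i (1 : ℝ) : E (n + 1)) j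
        = if j = i then 1 else 0 := by
      intro j; simp
    have hder : ∀ w t, HasDerivAt (fun t => ψ (ι (t, w))) (pderiv i ψ (ι (t, w))) t := by
      intro w t
      have := hasDerivAt_line hdiff (ι (0, w)) (EuclideanSpace.single i 1) t
      simp only [← hline, hsing] at this
      simpa using this
    have hcw : ∀ w, Continuous fun t => pderiv i ψ (ι (t, w)) := by
      intro w
      refine hpc.comp ?_
      have : (fun t => ι (t, w)) = fun t => ι (0, w) + t • EuclideanSpace.single i 1 :=
        funext fun t => hline t w
      rw [this]
      fun_prop
    rw [← hmp.map_eq] at hint1 hint2 ⊢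
    rw [integral_map hmp.measurable.aemeasurable hint1.aestronglyMeasurable,
      integral_map hmp.measurable.aemeasurable hint2.aestronglyMeasurable]
    have i1 := integral_prod_symm _ (hint1.comp_measurable hmp.measurable)
    have i2 := integral_prod_symm _ (hint2.comp_measurable hmp.measurable)
    simp only [Function.comp_apply] at i1 i2
    rw [i1, i2]
    congr 1; ext w
    simp only [hcoord]
    exact integral_mul_gaussianReal (hder w) (hcw w) (fun t => hC _) (fun t => hC' _)

section

variable {d r : ℕ} {S : Matrix (Fin d) (Fin d) ℝ}

instance : IsProbabilityMeasure (normalLaw S) := by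
  unfold normalLaw; infer_instance

lemma integrable_coord_normalLaw (i : Fin d) :
    Integrable (fun z : E d => z i) (normalLaw S) := by
  unfold normalLaw
  exact (EuclideanSpace.proj i : E d →L[ℝ] ℝ).integrable_comp IsGaussian.integrable_fun_id

open scoped MatrixOrder in
-- A singular `S` has no density, so `N(0, S)` is taken as the image of the standard Gaussian under
-- the symmetric root `R`. One factor `R` comes from the coordinate, the other from the chain rule,
-- and `R * R = S`.
lemma integral_coord_mul_normalLaw (hS : S.PosSemidef) {φ : E d → ℝ} (hφ : ContDiff ℝ 1 φ) {C : ℝ}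
    (hC : ∀ z, |φ z| ≤ C) (hC' : ∀ k z, |pderiv k φ z| ≤ C) (j : Fin d) :
    ∫ z, z j * φ z ∂(normalLaw S) = ∑ k, S j k * ∫ z, pderiv k φ z ∂(normalLaw S) := by
  set R := CFC.sqrt S with hR
  set A : E d →L[ℝ] E d := Matrix.toEuclideanCLM (𝕜 := ℝ) R with hA
  have hRR : R * R = S := CFC.sqrt_mul_sqrt_self _ hS.nonneg
  have hsymm : ∀ i k, R i k = R k i := by
    intro i k
    have : R.IsHermitian := (CFC.sqrt_nonneg S).isSelfAdjoint
    simpa using this.apply k i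
  have hmap : normalLaw S = (stdGaussian (E d)).map A := by
    simp [normalLaw, multivariateGaussian, hA, hR]
  have hpc : ∀ k, Continuous (pderiv k φ) := fun k =>
    (contDiff_pderiv (n := 0) hφ k).continuous
  have hcoord : ∀ z : E d, ∀ j, A z j = ∑ i, R j i * z i := by
    intro z j
    simp [hA, Matrix.mulVec, dotProduct]
  have hAs : ∀ i k, A (EuclideanSpace.single i 1) k = R k i := by
    intro i k
    simp [hcoord]
  have hφd : Differentiable ℝ φ := hφ.differentiable (by simp)
  have hpd : ∀ i z, pderiv i (φ ∘ A) z = ∑ k, pderiv k φ (A z) * R k i := by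
    intro i z
    have := (hasFDerivAt_gradCLM (hφd (A z))).comp z A.hasFDerivAt
    rw [pderiv_of_hasFDerivAt this, ContinuousLinearMap.comp_apply, gradCLM_apply]
    simp [hAs]
  have hCA : ∀ z, |(φ ∘ A) z| ≤ C := fun z => hC _
  have hb : ∀ i z, |pderiv i (φ ∘ A) z| ≤ ∑ k, C * |R k i| := by
    intro i z
    rw [hpd]
    refine (Finset.abs_sum_le_sum_abs _ _).trans (Finset.sum_le_sum fun k _ => ?_)
    rw [abs_mul]
    exact mul_le_mul_of_nonneg_right (hC' _ _) (abs_nonneg _)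
  have hstd : ∀ i, ∫ z, z i * φ (A z) ∂(stdGaussian (E d))
      = ∑ k, R k i * ∫ z, pderiv k φ (A z) ∂(stdGaussian (E d)) := by
    intro i
    have := integral_coord_mul_stdGaussian (ψ := φ ∘ A) (C := max C (∑ k, C * |R k i|))
      (hφ.comp A.contDiff) (fun z => (hCA z).trans (le_max_left _ _)) i
      (fun z => (hb i z).trans (le_max_right _ _))
    simp only [Function.comp_apply] at this
    rw [this]
    simp_rw [hpd]
    rw [integral_finsetSum]
    · simp_rw [integral_mul_const, mul_comm]
    · intro k _
      refine Integrable.mul_const ?_ _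
      exact Integrable.of_bound ((hpc k).comp A.continuous).aestronglyMeasurable C
        (Filter.Eventually.of_forall fun z => hC' k _)
  have hA_meas : AEMeasurable A (stdGaussian (E d)) := A.continuous.measurable.aemeasurable
  rw [hmap, integral_map hA_meas (by
    have := hφ.continuous
    exact (by fun_prop : Continuous fun z : E d => z j * φ z).aestronglyMeasurable)]
  simp_rw [integral_map hA_meas (hpc _).aestronglyMeasurable, hcoord, Finset.sum_mul]
  rw [integral_finsetSum]
  · simp_rw [mul_assoc, integral_const_mul, hstd, Finset.mul_sum]
    rw [Finset.sum_comm]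
    refine Finset.sum_congr rfl fun k _ => ?_
    rw [← hRR, Matrix.mul_apply, Finset.sum_mul]
    refine Finset.sum_congr rfl fun i _ => ?_
    rw [hsymm i k]; ring
  · intro i _
    simp_rw [mul_assoc]
    refine Integrable.const_mul ?_ _
    simpa [mul_comm] using (integrable_coord_stdGaussian i).bdd_mul (c := C)
      (hφ.continuous.comp A.continuous).aestronglyMeasurable
      (Filter.Eventually.of_forall fun z => hC _)

/-! ### The Slepian interpolation -/

variable {F : E d → L r → ℝ}

lemma abs_slepian_le {C : ℝ} (hC : ∀ x y, |F x y| ≤ C) (u : ℝ) (x : E d) (y : L r) :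
    |slepian S u F x y| ≤ C := by
  have := norm_integral_le_of_norm_le_const (μ := normalLaw S)
    (f := fun z => F (Real.sqrt (1 - u) • x + Real.sqrt u • z) y)
    (Filter.Eventually.of_forall fun z => hC _ _)
  simpa [slepian] using this

lemma continuous_slepian (hF : BddSmooth 0 F) (y : L r) :
    Continuous fun p : ℝ × E d => slepian S p.1 F p.2 y := by
  obtain ⟨hc, C, hC⟩ := hF
  unfold slepian
  refine continuous_of_dominated (bound := fun _ => C) (fun p => ?_)
    (fun p => Filter.Eventually.of_forall fun z => hC _ _) (integrable_const _)
    (Filter.Eventually.of_forall fun z => ?_)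
  · exact ((hc y).comp (by fun_prop)).aestronglyMeasurable
  · exact (hc y).comp (by fun_prop)

lemma integrable_slepian (hF : BddSmooth 0 F) (u : ℝ) (x : E d) (y : L r) :
    Integrable (fun z => F (Real.sqrt (1 - u) • x + Real.sqrt u • z) y) (normalLaw S) := by
  obtain ⟨hc, C, hC⟩ := hF
  exact Integrable.of_bound ((hc y).comp (by fun_prop)).aestronglyMeasurable C
    (Filter.Eventually.of_forall fun z => hC _ _)

lemma hasFDerivAt_slepian (hF : BddSmooth 1 F) (u : ℝ) (x : E d) (y : L r) :
    HasFDerivAt (fun x => slepian S u F x y)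
      (gradCLM d fun j => Real.sqrt (1 - u) * slepian S u (dX j F) x y) x := by
  have h0 : ∀ j, BddSmooth 0 (dX j F) := hF.2.2
  choose C hC0 hC using fun j => (h0 j).isBdd.exists_nonneg
  have hdiff : Differentiable ℝ fun x => F x y := (hF.1 y).differentiable (by simp)
  have hcd : Continuous fun z : E d => fun j => dX j F z y :=
    continuous_pi fun j => (h0 j).continuous y
  have := hasFDerivAt_integral_of_dominated_of_fderiv_le (μ := normalLaw S) (x₀ := x)
    (F := fun x z => F (Real.sqrt (1 - u) • x + Real.sqrt u • z) y)
    (F' := fun x z => gradCLM d fun j =>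
      Real.sqrt (1 - u) * dX j F (Real.sqrt (1 - u) • x + Real.sqrt u • z) y)
    (bound := fun _ => ∑ j, Real.sqrt (1 - u) * C j) Filter.univ_mem
    (Filter.Eventually.of_forall fun x' => (integrable_slepian hF.zero u x' y).aestronglyMeasurable)
    (integrable_slepian hF.zero u x y) ?_ ?_ (integrable_const _) ?_
  · refine this.congr_fderiv ?_
    rw [ContinuousLinearMap.integral_comp_comm]
    · congr 1
      ext j
      rw [eval_integral]
      · simp [slepian, integral_const_mul]
      · exact fun j => (integrable_slepian (h0 j) u x y).const_mul _
    · exact Integrable.of_eval fun j => (integrable_slepian (h0 j) u x y).const_mul _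
  · refine ((gradCLM d).continuous.comp ?_).aestronglyMeasurable
    exact continuous_pi fun j => ((h0 j).continuous y |>.comp (by fun_prop)).const_mul _
  · refine Filter.Eventually.of_forall fun z x' _ => (norm_gradCLM_le _).trans ?_
    refine Finset.sum_le_sum fun j _ => ?_
    rw [abs_mul, abs_of_nonneg (Real.sqrt_nonneg _)]
    exact mul_le_mul_of_nonneg_left (hC j _ _) (Real.sqrt_nonneg _)
  · refine Filter.Eventually.of_forall fun z x' _ => ?_
    have h1 := hasFDerivAt_gradCLM (hdiff (Real.sqrt (1 - u) • x' + Real.sqrt u • z))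
    have h2 : HasFDerivAt (fun x' : E d => Real.sqrt (1 - u) • x' + Real.sqrt u • z)
        (Real.sqrt (1 - u) • ContinuousLinearMap.id ℝ (E d)) x' :=
      (Real.sqrt (1 - u) • ContinuousLinearMap.id ℝ (E d)).hasFDerivAt.add_const _
    refine (h1.comp x' h2).congr_fderiv ?_
    ext w
    simp [gradCLM_apply, dX, Finset.mul_sum, mul_assoc]

/-- Plain differentiation under the expectation; the explicit `z j` is removed afterwards by
Gaussian integration by parts. -/
lemma hasDerivAt_slepian_time_aux (hF : BddSmooth 1 F) {u : ℝ} (hu : u ∈ Set.Ioo (0 : ℝ) 1)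
    (x : E d) (y : L r) :
    HasDerivAt (fun u => slepian S u F x y)
      (∫ z, ∑ j, dX j F (Real.sqrt (1 - u) • x + Real.sqrt u • z) y *
        (z j / (2 * Real.sqrt u) - x j / (2 * Real.sqrt (1 - u))) ∂(normalLaw S)) u := by
  have h0 : ∀ j, BddSmooth 0 (dX j F) := hF.2.2
  choose C hC0 hC using fun j => (h0 j).isBdd.exists_nonneg
  have hdiff : Differentiable ℝ fun x => F x y := (hF.1 y).differentiable (by simp)
  have hs1 : 0 < Real.sqrt (u / 2) := Real.sqrt_pos.2 (by linarith [hu.1])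
  have hs2 : 0 < Real.sqrt ((1 - u) / 2) := Real.sqrt_pos.2 (by linarith [hu.2])
  refine (hasDerivAt_integral_of_dominated_loc_of_deriv_le (μ := normalLaw S) (x₀ := u)
    -- On this neighbourhood `√v` and `√(1 - v)` stay away from zero, so the derivative is dominated
    -- by an affine function of the `|z j|`.
    (s := Set.Ioo (u / 2) ((1 + u) / 2))
    (F := fun u z => F (Real.sqrt (1 - u) • x + Real.sqrt u • z) y)
    (F' := fun u z => ∑ j, dX j F (Real.sqrt (1 - u) • x + Real.sqrt u • z) y *
        (z j / (2 * Real.sqrt u) - x j / (2 * Real.sqrt (1 - u))))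
    (bound := fun z => ∑ j, C j *
      (|z j| / (2 * Real.sqrt (u / 2)) + |x j| / (2 * Real.sqrt ((1 - u) / 2))))
    (Ioo_mem_nhds (by linarith [hu.1]) (by linarith [hu.2]))
    (Filter.Eventually.of_forall fun u' => (integrable_slepian hF.zero u' x y).aestronglyMeasurable)
    (integrable_slepian hF.zero u x y) ?_ ?_ ?_ ?_).2
  · refine Continuous.aestronglyMeasurable ?_
    refine continuous_finsetSum _ fun j _ => ?_
    exact ((h0 j).continuous y |>.comp (by fun_prop)).mul (by fun_prop)
  · refine Filter.Eventually.of_forall fun z v hv => ?_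
    refine (Finset.abs_sum_le_sum_abs _ _).trans (Finset.sum_le_sum fun j _ => ?_)
    rw [abs_mul]
    refine mul_le_mul (hC j _ _) ((abs_sub _ _).trans ?_) (abs_nonneg _) (hC0 j)
    rw [abs_div, abs_div, abs_of_nonneg (by positivity : 0 ≤ 2 * Real.sqrt v),
      abs_of_nonneg (by positivity : 0 ≤ 2 * Real.sqrt (1 - v))]
    have e1 : Real.sqrt (u / 2) ≤ Real.sqrt v := Real.sqrt_le_sqrt hv.1.le
    have e2 : Real.sqrt ((1 - u) / 2) ≤ Real.sqrt (1 - v) :=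
      Real.sqrt_le_sqrt (by linarith [hv.2])
    gcongr
  · refine integrable_finsetSum _ fun j _ => Integrable.const_mul ?_ _
    exact ((integrable_coord_normalLaw j).abs.div_const _).add (integrable_const _)
  · refine Filter.Eventually.of_forall fun z v hv => ?_
    have hv0 : 0 < v := by linarith [hv.1, hu.1]
    have hv1 : 0 < 1 - v := by linarith [hv.2, hu.2]
    have h1 := hasFDerivAt_gradCLM (hdiff (Real.sqrt (1 - v) • x + Real.sqrt v • z))
    have h2 : HasDerivAt (fun v : ℝ => Real.sqrt (1 - v) • x + Real.sqrt v • z)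
        ((-1 / (2 * Real.sqrt (1 - v))) • x + (1 / (2 * Real.sqrt v)) • z) v :=
      ((((hasDerivAt_id v).const_sub 1).sqrt hv1.ne').smul_const x).add
        (((hasDerivAt_id v).sqrt hv0.ne').smul_const z)
    refine (h1.comp_hasDerivAt v h2).congr_deriv ?_
    rw [gradCLM_apply]
    refine Finset.sum_congr rfl fun j _ => ?_
    simp only [dX, PiLp.add_apply, PiLp.smul_apply, smul_eq_mul]
    ring

lemma pderiv_affine {g : E d → ℝ} (hg : Differentiable ℝ g) (a : ℝ) (b z : E d) (k : Fin d) :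
    pderiv k (fun z => g (b + a • z)) z = a * pderiv k g (b + a • z) := by
  have h2 : HasFDerivAt (fun z : E d => b + a • z) (a • ContinuousLinearMap.id ℝ (E d)) z :=
    (a • ContinuousLinearMap.id ℝ (E d)).hasFDerivAt.const_add _
  refine (pderiv_of_hasFDerivAt ((hasFDerivAt_gradCLM (hg (b + a • z))).comp z h2) k).trans ?_
  simp [gradCLM_single]

/-- Integration by parts trades each `z j` for second derivatives and a factor `√u`, which cancels
the `1/√u` from differentiating the path. Only the drift term keeps a singular coefficient, at `u =
1`. -/
lemma hasDerivAt_slepian_time (hS : S.PosSemidef) (hF : BddSmooth 2 F) {u : ℝ}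
    (hu : u ∈ Set.Ioo (0 : ℝ) 1) (x : E d) (y : L r) :
    HasDerivAt (fun u => slepian S u F x y)
      (1 / 2 * ∑ j, ∑ k, S j k * slepian S u (dX k (dX j F)) x y
        - 1 / (2 * Real.sqrt (1 - u)) * ∑ j, x j * slepian S u (dX j F) x y) u := by
  have h1 : ∀ j, BddSmooth 1 (dX j F) := hF.2.2
  have h0 : ∀ k j, BddSmooth 0 (dX k (dX j F)) := fun k j => (h1 j).2.2 k
  have hF1 : BddSmooth 1 F := ⟨hF.1, hF.2.1, fun j => (h1 j).zero⟩
  refine (hasDerivAt_slepian_time_aux hF1 hu x y).congr_deriv ?_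
  have hsu : 0 < Real.sqrt u := Real.sqrt_pos.2 hu.1
  have hi : ∀ j, Integrable (fun z : E d =>
      z j * dX j F (Real.sqrt (1 - u) • x + Real.sqrt u • z) y) (normalLaw S) := by
    intro j
    obtain ⟨C, hC⟩ := (h1 j).isBdd
    have := (integrable_coord_normalLaw (S := S) j).bdd_mul (c := C)
      (integrable_slepian (S := S) (h1 j).zero u x y).aestronglyMeasurable
      (Filter.Eventually.of_forall fun z => hC _ _)
    simpa [mul_comm] using this
  have hibp : ∀ j, ∫ z, z j * dX j F (Real.sqrt (1 - u) • x + Real.sqrt u • z) y ∂(normalLaw S)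
      = ∑ k, S j k * (Real.sqrt u * slepian S u (dX k (dX j F)) x y) := by
    intro j
    obtain ⟨C, hC0, hC⟩ := (h1 j).isBdd.exists_nonneg
    choose C' hC0' hC' using fun k => (h0 k j).isBdd.exists_nonneg
    have hd : Differentiable ℝ fun x => dX j F x y := ((h1 j).1 y).differentiable (by simp)
    have hp : ∀ k z, pderiv k (fun z => dX j F (Real.sqrt (1 - u) • x + Real.sqrt u • z) y) z
        = Real.sqrt u * dX k (dX j F) (Real.sqrt (1 - u) • x + Real.sqrt u • z) y :=
      fun k z => pderiv_affine hd _ _ _ k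
    have hle : ∀ k, Real.sqrt u * C' k ≤ ∑ k, Real.sqrt u * C' k := fun k =>
      Finset.single_le_sum (f := fun k => Real.sqrt u * C' k)
        (fun k _ => mul_nonneg hsu.le (hC0' k)) (Finset.mem_univ k)
    rw [integral_coord_mul_normalLaw hS (C := C + ∑ k, Real.sqrt u * C' k)
      (φ := fun z => dX j F (Real.sqrt (1 - u) • x + Real.sqrt u • z) y)
      (((h1 j).1 y).comp (by fun_prop))
      (fun z => (hC _ _).trans (le_add_of_nonneg_right
        (Finset.sum_nonneg fun k _ => mul_nonneg hsu.le (hC0' k)))) (fun k z => ?_)]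
    · simp_rw [hp, integral_const_mul]
      rfl
    · rw [hp, abs_mul, abs_of_pos hsu]
      exact (mul_le_mul_of_nonneg_left (hC' k _ _) hsu.le).trans
        ((hle k).trans (le_add_of_nonneg_left hC0))
  have hsplit : ∀ j z, dX j F (Real.sqrt (1 - u) • x + Real.sqrt u • z) y *
        (z j / (2 * Real.sqrt u) - x j / (2 * Real.sqrt (1 - u)))
      = 1 / (2 * Real.sqrt u) * (z j * dX j F (Real.sqrt (1 - u) • x + Real.sqrt u • z) y)
        - x j / (2 * Real.sqrt (1 - u)) * dX j F (Real.sqrt (1 - u) • x + Real.sqrt u • z) y := by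
    intro j z; ring
  simp_rw [hsplit]
  rw [integral_finsetSum]
  swap
  · exact fun j _ => ((hi j).const_mul _).sub
      ((integrable_slepian (h1 j).zero u x y).const_mul _)
  simp_rw [integral_sub ((hi _).const_mul _)
    ((integrable_slepian (h1 _).zero u x y).const_mul _), integral_const_mul, hibp]
  rw [Finset.sum_sub_distrib, Finset.mul_sum, Finset.mul_sum]
  congr 1
  · refine Finset.sum_congr rfl fun j _ => ?_
    rw [Finset.mul_sum, Finset.mul_sum]
    refine Finset.sum_congr rfl fun k _ => ?_
    field_simp
  · refine Finset.sum_congr rfl fun j _ => ?_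
    simp only [slepian]
    ring

end

/-! ### Transition probabilities of the thinned Poisson interpolation -/

/-- The one-dimensional transition probability. -/
def thin (lam s : ℝ) (y z : ℕ) : ℝ :=
  ∑ k ∈ Finset.range (min y z + 1),
    (y.choose k : ℝ) * (1 - s) ^ k * s ^ (y - k) * (lam * s) ^ (z - k)
      * (Real.exp (-(lam * s)) / ((z - k).factorial : ℝ))

/-- The shift of a sequence by one to the right. -/
def shiftN (f : ℕ → ℝ) : ℕ → ℝ
  | 0 => 0
  | z + 1 => f z

lemma shiftN_zero (f : ℕ → ℝ) : shiftN f 0 = 0 := rfl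

lemma shiftN_succ (f : ℕ → ℝ) (z : ℕ) : shiftN f (z + 1) = f z := rfl

/-- Terms with `k > y` vanish with the binomial coefficient. The summation range then no longer
depends on `y`, as needed to apply Pascal's rule. -/
lemma thin_eq_sum_range (lam s : ℝ) (y z : ℕ) :
    thin lam s y z = ∑ k ∈ Finset.range (z + 1),
      (y.choose k : ℝ) * (1 - s) ^ k * s ^ (y - k) * (lam * s) ^ (z - k)
        * (Real.exp (-(lam * s)) / ((z - k).factorial : ℝ)) := by
  refine Finset.sum_subset (fun k hk => ?_) fun k hk hk' => ?_
  · simp only [Finset.mem_range] at *; omega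
  · rw [Nat.choose_eq_zero_of_lt]
    · simp
    · simp only [Finset.mem_range] at *; omega

lemma thin_zero_left (lam s : ℝ) (z : ℕ) :
    thin lam s 0 z = (lam * s) ^ z * (Real.exp (-(lam * s)) / (z.factorial : ℝ)) := by
  simp [thin]

/-- Conditioning on one extra initial particle: it survives with probability `1 - s` and raises the
count by one, or it disappears. Analytically this is Pascal's rule. -/
lemma thin_succ (lam s : ℝ) (y z : ℕ) :
    thin lam s (y + 1) z = (1 - s) * shiftN (thin lam s y) z + s * thin lam s y z := by
  cases z with
  | zero => simp [thin, shiftN]; ring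
  | succ z =>
    simp only [shiftN_succ]
    rw [thin_eq_sum_range, thin_eq_sum_range, thin_eq_sum_range, Finset.sum_range_succ',
      Finset.sum_range_succ' _ (z + 1), mul_add, Finset.mul_sum, Finset.mul_sum, ← add_assoc,
      ← Finset.sum_add_distrib]
    congr 1
    · refine Finset.sum_congr rfl fun k _ => ?_
      rw [Nat.choose_succ_succ]
      simp only [Nat.add_sub_add_right, Nat.cast_add]
      -- For `k ≥ y` the truncated exponent `y - (k + 1)` is wrong by one, but the binomial
      -- coefficient in front of it is zero.
      rcases Nat.lt_or_ge k y with h | h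
      · have : y - k = y - (k + 1) + 1 := by omega
        rw [this]; ring
      · rw [Nat.choose_eq_zero_of_lt (show y < k + 1 by omega)]
        simp; ring
    · simp; ring

/-- Kolmogorov's equation: immigration at rate `lam` adds a particle, and each of the `y` initial
particles changes from surviving to lost. It follows by induction on `y`, with the Poisson weights
as base case. At `y = 0` the truncated `y - 1` is harmless because of the factor `y`. -/
lemma hasDerivAt_thin (lam s : ℝ) (y z : ℕ) :
    HasDerivAt (fun s => thin lam s y z)
      (lam * (shiftN (thin lam s y) z - thin lam s y z)
        - y * (shiftN (thin lam s (y - 1)) z - thin lam s (y - 1) z)) s := by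
  induction y generalizing z with
  | zero =>
    simp_rw [thin_zero_left]
    have h1 : HasDerivAt (fun s : ℝ => lam * s) lam s := by
      simpa using (hasDerivAt_id s).const_mul lam
    refine ((h1.pow z).mul (h1.neg.exp.div_const _)).congr_deriv ?_
    cases z with
    | zero => simp [shiftN, thin_zero_left]; ring
    | succ z =>
      simp only [shiftN_succ, thin_zero_left, Nat.factorial_succ, Nat.cast_mul, Nat.add_sub_cancel]
      have : ((z + 1 : ℕ) : ℝ) ≠ 0 := by positivity
      have : (z.factorial : ℝ) ≠ 0 := by positivity
      push_cast at *
      field_simp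
      simp only [Pi.neg_apply, Pi.pow_apply]
      ring
  | succ y ih =>
    have hs : HasDerivAt (fun s => shiftN (thin lam s y) z)
        (shiftN (fun z => lam * (shiftN (thin lam s y) z - thin lam s y z)
          - y * (shiftN (thin lam s (y - 1)) z - thin lam s (y - 1) z)) z) s := by
      cases z with
      | zero => simpa [shiftN] using hasDerivAt_const s (0 : ℝ)
      | succ z => exact ih z
    simp_rw [thin_succ lam]
    refine ((((hasDerivAt_id s).const_sub 1).mul hs).add
      ((hasDerivAt_id s).mul (ih z))).congr_deriv ?_
    -- The Leibniz rule leaves terms in state `y` to be matched with terms in state `y - 1`; this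
    -- identity links them, and is trivial for `y = 0`.
    have hy : ∀ z, (y : ℝ) * thin lam s y z
        = y * ((1 - s) * shiftN (thin lam s (y - 1)) z + s * thin lam s (y - 1) z) := by
      intro z
      cases y with
      | zero => simp
      | succ y => rw [thin_succ]; simp
    have hz := hy z
    cases z with
    | zero =>
      simp only [shiftN_zero, Nat.add_sub_cancel, id] at *
      push_cast
      linear_combination (-1 : ℝ) * hz
    | succ z =>
      have hz' := hy z
      simp only [shiftN_succ, Nat.add_sub_cancel, id] at *
      rw [thin_succ]
      push_cast
      linear_combination hz' - hz

/-- A summable bound for the transition probabilities, uniform in time. -/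
def thinDom (lam : ℝ) : ℕ → ℕ → ℝ
  | 0, z => lam ^ z / z.factorial
  | y + 1, z => shiftN (thinDom lam y) z + thinDom lam y z

lemma shiftN_mono {f g : ℕ → ℝ} (h : ∀ z, f z ≤ g z) (z : ℕ) : shiftN f z ≤ shiftN g z := by
  cases z with
  | zero => exact le_rfl
  | succ z => exact h z

lemma shiftN_nonneg {f : ℕ → ℝ} (h : ∀ z, 0 ≤ f z) (z : ℕ) : 0 ≤ shiftN f z := by
  cases z with
  | zero => exact le_rfl
  | succ z => exact h z

lemma hasSum_shiftN {f : ℕ → ℝ} {a : ℝ} (h : HasSum f a) : HasSum (shiftN f) a := by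
  refine (Function.Injective.hasSum_iff (g := Nat.succ) Nat.succ_injective ?_).1 h
  intro z hz
  cases z with
  | zero => rfl
  | succ z => exact absurd ⟨z, rfl⟩ hz

lemma thin_nonneg {lam s : ℝ} (hlam : 0 ≤ lam) (hs : s ∈ Set.Icc (0 : ℝ) 1) (y z : ℕ) :
    0 ≤ thin lam s y z := by
  have h1 : 0 ≤ 1 - s := by linarith [hs.2]
  have h0 := hs.1
  unfold thin
  positivity

/-- The majorant obeys the recursion `thin_succ` with both weights replaced by one, so it is free of
`s`. This is what allows sums over the lattice to be differentiated in time term by term. -/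
lemma thin_le_thinDom {lam s : ℝ} (hlam : 0 ≤ lam) (hs : s ∈ Set.Icc (0 : ℝ) 1) (y z : ℕ) :
    thin lam s y z ≤ thinDom lam y z := by
  have h1 : 0 ≤ 1 - s := by linarith [hs.2]
  have h0 := hs.1
  induction y generalizing z with
  | zero =>
    rw [thin_zero_left, thinDom]
    have e1 : (lam * s) ^ z ≤ lam ^ z := by
      gcongr
      exact mul_le_of_le_one_right hlam hs.2
    have e2 : Real.exp (-(lam * s)) ≤ 1 := by
      rw [Real.exp_le_one_iff]
      nlinarith
    calc (lam * s) ^ z * (Real.exp (-(lam * s)) / (z.factorial : ℝ))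
        ≤ lam ^ z * (1 / (z.factorial : ℝ)) := by gcongr
      _ = _ := by ring
  | succ y ih =>
    rw [thin_succ, thinDom]
    refine add_le_add ?_ ?_
    · refine (mul_le_of_le_one_left (shiftN_nonneg (thin_nonneg hlam hs y) z) (by linarith)).trans ?_
      exact shiftN_mono ih z
    · exact (mul_le_of_le_one_left (thin_nonneg hlam hs y z) hs.2).trans (ih z)

lemma thinDom_nonneg {lam : ℝ} (hlam : 0 ≤ lam) (y z : ℕ) : 0 ≤ thinDom lam y z := by
  induction y generalizing z with
  | zero => rw [thinDom]; positivity
  | succ y ih => exact add_nonneg (shiftN_nonneg ih z) (ih z)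

lemma summable_thinDom (lam : ℝ) (y : ℕ) : Summable (thinDom lam y) := by
  induction y with
  | zero => exact Real.summable_pow_div_factorial lam
  | succ y ih => exact (hasSum_shiftN ih.hasSum).summable.add ih

lemma hasSum_thin (lam s : ℝ) (y : ℕ) : HasSum (thin lam s y) 1 := by
  induction y with
  | zero =>
    have h := (NormedSpace.expSeries_div_hasSum_exp (lam * s)).mul_right (Real.exp (-(lam * s)))
    rw [← Real.exp_eq_exp_ℝ, ← Real.exp_add, add_neg_cancel, Real.exp_zero] at h
    refine h.congr_fun ?_
    intro z
    rw [thin_zero_left]; ring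
  | succ y ih =>
    have := ((hasSum_shiftN ih).mul_left (1 - s)).add (ih.mul_left s)
    simp only [mul_one, sub_add_cancel] at this
    exact this.congr_fun fun z => thin_succ lam s y z

lemma thin_one (lam : ℝ) (y z : ℕ) :
    thin lam 1 y z = lam ^ z * (Real.exp (-lam) / (z.factorial : ℝ)) := by
  induction y with
  | zero => simp [thin_zero_left]
  | succ y ih => rw [thin_succ, ih]; simp

lemma thin_zero (lam : ℝ) (y z : ℕ) : thin lam 0 y z = if z = y then 1 else 0 := by
  induction y generalizing z with
  | zero =>
    rw [thin_zero_left]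
    cases z <;> simp
  | succ y ih =>
    rw [thin_succ]
    cases z <;> simp [shiftN, ih]

/-! ### Product transition probabilities on the lattice -/

lemma hasSum_pi_prod {r : ℕ} {f : Fin r → ℕ → ℝ} {a : Fin r → ℝ} (h0 : ∀ j z, 0 ≤ f j z)
    (h : ∀ j, HasSum (f j) (a j)) :
    HasSum (fun z : L r => ∏ j, f j (z j)) (∏ j, a j) := by
  induction r with
  | zero => simp
  | succ n ih =>
    have h2 := ih (f := fun j => f j.succ) (a := fun j => a j.succ) (fun j => h0 _) (fun j => h _)
    have hs := (h 0).summable.mul_of_nonneg h2.summable (h0 0)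
      (fun z => Finset.prod_nonneg fun j _ => h0 _ _)
    have h3 := (h 0).mul h2 hs
    rw [Fin.prod_univ_succ, ← (Fin.consEquiv fun _ : Fin (n + 1) => ℕ).hasSum_iff]
    refine h3.congr_fun fun p => ?_
    simp [Fin.prod_univ_succ, Fin.consEquiv]

/-- The shift of a function on `ℤ_+^r` in the `j`-th coordinate. -/
def shift {r : ℕ} (j : Fin r) (G : L r → ℝ) (z : L r) : ℝ :=
  if z j = 0 then 0 else G (z - Pi.single j 1)

section

variable {r : ℕ} {lam : Fin r → ℝ} {s : ℝ}

lemma transProb_eq (lam : Fin r → ℝ) (s : ℝ) (y z : L r) :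
    transProb lam s y z = ∏ j, thin (lam j) s (y j) (z j) := rfl

lemma shift_mul_prod {f : Fin r → ℕ → ℝ} (j : Fin r) (z : L r) :
    shift j (fun z => ∏ i, f i (z i)) z
      = shiftN (f j) (z j) * ∏ i ∈ Finset.univ.erase j, f i (z i) := by
  unfold shift
  split_ifs with h
  · simp [h, shiftN]
  · obtain ⟨n, hn⟩ := Nat.exists_eq_succ_of_ne_zero h
    beta_reduce
    rw [← Finset.mul_prod_erase _ _ (Finset.mem_univ j)]
    simp only [Pi.sub_apply, Pi.single_eq_same, hn, Nat.succ_sub_one, shiftN]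
    congr 1
    refine Finset.prod_congr rfl fun i hi => ?_
    rw [Pi.single_eq_of_ne (Finset.ne_of_mem_erase hi)]
    simp

/-- Isolates the `j`-th factor when two starting states agree elsewhere, so that one-dimensional
identities transfer to the product. -/
lemma mul_prod_erase_update {f : Fin r → ℕ → ℕ → ℝ} (j : Fin r) (y y' z : L r)
    (hy : ∀ i, i ≠ j → y' i = y i) :
    f j (y' j) (z j) * ∏ i ∈ Finset.univ.erase j, f i (y i) (z i) = ∏ i, f i (y' i) (z i) := by
  rw [← Finset.mul_prod_erase _ _ (Finset.mem_univ j)]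
  congr 1
  refine Finset.prod_congr rfl fun i hi => ?_
  rw [hy i (Finset.ne_of_mem_erase hi)]

lemma transProb_add_single (k : Fin r) (y z : L r) :
    transProb lam s (y + Pi.single k 1) z
      = (1 - s) * shift k (transProb lam s y) z + s * transProb lam s y z := by
  have hy : ∀ i, i ≠ k → (y + Pi.single k 1 : L r) i = y i := fun i hi => by
    simp [Pi.single_eq_of_ne hi]
  have h := mul_prod_erase_update (f := fun i => thin (lam i) s) k y (y + Pi.single k 1) z hy
  have h' := mul_prod_erase_update (f := fun i => thin (lam i) s) k y y z fun _ _ => rfl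
  have h'' := shift_mul_prod (f := fun i => thin (lam i) s (y i)) k z
  simp only [Pi.add_apply, Pi.single_eq_same, thin_succ] at h
  change shift k (transProb lam s y) z = _ at h''
  rw [h'', transProb_eq lam s y, ← h', transProb_eq]
  simp only [Pi.add_apply]
  rw [← h]; ring

lemma hasDerivAt_transProb (lam : Fin r → ℝ) (s : ℝ) (y z : L r) :
    HasDerivAt (fun s => transProb lam s y z)
      (∑ j, (lam j * (shift j (transProb lam s y) z - transProb lam s y z)
        - y j * (shift j (transProb lam s (y - Pi.single j 1)) z
          - transProb lam s (y - Pi.single j 1) z))) s := by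
  have := HasDerivAt.finsetProd (u := Finset.univ)
    (f := fun j s => thin (lam j) s (y j) (z j)) (x := s)
    fun j _ => hasDerivAt_thin (lam j) s (y j) (z j)
  refine (this.congr_deriv ?_).congr_of_eventuallyEq
    (Filter.Eventually.of_forall fun s => by simp [transProb_eq])
  refine Finset.sum_congr rfl fun j _ => ?_
  have hy : ∀ i, i ≠ j → (y - Pi.single j 1 : L r) i = y i := fun i hi => by
    simp [Pi.single_eq_of_ne hi]
  have h := mul_prod_erase_update (f := fun i => thin (lam i) s) j y (y - Pi.single j 1) z hy
  have h' := mul_prod_erase_update (f := fun i => thin (lam i) s) j y y z fun _ _ => rfl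
  have h'' := shift_mul_prod (f := fun i => thin (lam i) s (y i)) j z
  have h''' := shift_mul_prod (f := fun i => thin (lam i) s ((y - Pi.single j 1 : L r) i)) j z
  have e : ∏ i ∈ Finset.univ.erase j, thin (lam i) s ((y - Pi.single j 1 : L r) i) (z i)
      = ∏ i ∈ Finset.univ.erase j, thin (lam i) s (y i) (z i) :=
    Finset.prod_congr rfl fun i hi => by rw [hy i (Finset.ne_of_mem_erase hi)]
  rw [e] at h'''
  change shift j (transProb lam s y) z = _ at h''
  change shift j (transProb lam s (y - Pi.single j 1)) z = _ at h'''
  change _ = transProb lam s (y - Pi.single j 1) z at h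
  change _ = transProb lam s y z at h'
  rw [h'', h''', ← h, ← h', smul_eq_mul]
  simp only [Pi.sub_apply, Pi.single_eq_same]
  ring

/-- A summable bound for the transition probabilities, uniform in time. -/
def transDom (lam : Fin r → ℝ) (y z : L r) : ℝ := ∏ j, thinDom (lam j) (y j) (z j)

lemma transProb_nonneg (hlam : ∀ j, 0 ≤ lam j) (hs : s ∈ Set.Icc (0 : ℝ) 1) (y z : L r) :
    0 ≤ transProb lam s y z :=
  Finset.prod_nonneg fun j _ => thin_nonneg (hlam j) hs _ _

lemma transProb_le (hlam : ∀ j, 0 ≤ lam j) (hs : s ∈ Set.Icc (0 : ℝ) 1) (y z : L r) :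
    transProb lam s y z ≤ transDom lam y z :=
  Finset.prod_le_prod (fun j _ => thin_nonneg (hlam j) hs _ _)
    fun j _ => thin_le_thinDom (hlam j) hs _ _

lemma summable_transDom (hlam : ∀ j, 0 ≤ lam j) (y : L r) : Summable (transDom lam y) :=
  (hasSum_pi_prod (fun j z => thinDom_nonneg (hlam j) (y j) z)
    fun j => (summable_thinDom (lam j) (y j)).hasSum).summable

lemma hasSum_transProb (hlam : ∀ j, 0 ≤ lam j) (hs : s ∈ Set.Icc (0 : ℝ) 1) (y : L r) :
    HasSum (transProb lam s y) 1 := by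
  have := hasSum_pi_prod (fun j z => thin_nonneg (hlam j) hs (y j) z)
    fun j => hasSum_thin (lam j) s (y j)
  rwa [Finset.prod_const_one] at this

lemma shift_add_single (j : Fin r) (G : L r → ℝ) (z : L r) :
    shift j G (z + Pi.single j 1) = G z := by
  simp [shift]

lemma mul_shift_eq_zero (j : Fin r) (G : L r → ℝ) (g : L r → ℝ) (z : L r)
    (hz : z ∉ Set.range fun z : L r => z + Pi.single j 1) : g z * shift j G z = 0 := by
  unfold shift
  split_ifs with h
  · simp
  · refine absurd ⟨z - Pi.single j 1, ?_⟩ hz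
    ext i
    rcases eq_or_ne i j with rfl | hi
    · simp; omega
    · simp [Pi.single_eq_of_ne hi]

/-- Summation by parts: `shift j` is adjoint to translation by the `j`-th unit vector, and nothing
is lost because `shift j G` vanishes off the range of that translation. -/
lemma hasSum_mul_shift_iff (j : Fin r) (G g : L r → ℝ) {a : ℝ} :
    HasSum (fun z => g (z + Pi.single j 1) * G z) a ↔ HasSum (fun z => g z * shift j G z) a := by
  rw [← Function.Injective.hasSum_iff (add_left_injective (Pi.single j 1 : L r))
    (fun z hz => mul_shift_eq_zero j G g z hz)]
  simp [Function.comp_def, shift_add_single]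

lemma summable_shift (j : Fin r) {G : L r → ℝ} (hG : Summable G) : Summable (shift j G) := by
  have := ((hasSum_mul_shift_iff j G fun _ => 1).1 (by simpa using hG.hasSum)).summable
  simpa using this

lemma shift_mono (j : Fin r) {G G' : L r → ℝ} (h : ∀ z, G z ≤ G' z) (z : L r) :
    shift j G z ≤ shift j G' z := by
  unfold shift
  split_ifs
  · exact le_rfl
  · exact h _

lemma shift_nonneg (j : Fin r) {G : L r → ℝ} (h : ∀ z, 0 ≤ G z) (z : L r) : 0 ≤ shift j G z := by
  unfold shift
  split_ifs
  · exact le_rfl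
  · exact h _

lemma transProb_zero (y z : L r) : transProb lam 0 y z = if z = y then 1 else 0 := by
  simp_rw [transProb_eq, thin_zero]
  rw [Finset.prod_boole]
  simp [funext_iff]

lemma continuous_transProb (lam : Fin r → ℝ) (y z : L r) :
    Continuous fun s => transProb lam s y z :=
  continuous_iff_continuousAt.2 fun s => (hasDerivAt_transProb lam s y z).continuousAt

instance : IsProbabilityMeasure (poissonLaw lam) := by
  unfold poissonLaw; infer_instance

/-- At time one no initial particle survives, so the starting state `y` is arbitrary. -/
lemma poissonLaw_real_singleton (hlam : ∀ j, 0 ≤ lam j) (y z : L r) :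
    (poissonLaw lam).real {z} = transProb lam 1 y z := by
  rw [poissonLaw, measureReal_def, Measure.pi_singleton, ENNReal.toReal_prod, transProb_eq]
  refine Finset.prod_congr rfl fun j _ => ?_
  rw [← measureReal_def, poissonMeasure_real_singleton, thin_one, Real.coe_toNNReal _ (hlam j)]
  ring

end

/-! ### The interpolation operator -/

section

variable {d r : ℕ} {S : Matrix (Fin d) (Fin d) ℝ} {lam : Fin r → ℝ} {F : E d → L r → ℝ}

lemma abs_mul_transProb_le (hlam : ∀ j, 0 ≤ lam j) {C : ℝ} (hC : ∀ x y, |F x y| ≤ C) {u : ℝ}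
    (hu : u ∈ Set.Icc (0 : ℝ) 1) (x : E d) (y z : L r) :
    |slepian S u F x z * transProb lam u y z| ≤ C * transProb lam u y z := by
  rw [abs_mul, abs_of_nonneg (transProb_nonneg hlam hu y z)]
  exact mul_le_mul_of_nonneg_right (abs_slepian_le hC u x z) (transProb_nonneg hlam hu y z)

lemma summable_interp (hlam : ∀ j, 0 ≤ lam j) (hF : IsBdd F) {u : ℝ}
    (hu : u ∈ Set.Icc (0 : ℝ) 1) (x : E d) (y : L r) :
    Summable fun z => slepian S u F x z * transProb lam u y z := by
  obtain ⟨C, hC⟩ := hF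
  exact Summable.of_norm_bounded ((hasSum_transProb hlam hu y).summable.mul_left C)
    fun z => abs_mul_transProb_le hlam hC hu x y z

lemma hasSum_interp (hlam : ∀ j, 0 ≤ lam j) (hF : IsBdd F) {u : ℝ}
    (hu : u ∈ Set.Icc (0 : ℝ) 1) (x : E d) (y : L r) :
    HasSum (fun z => slepian S u F x z * transProb lam u y z) (interp S lam u F x y) :=
  (summable_interp hlam hF hu x y).hasSum

lemma abs_interp_le (hlam : ∀ j, 0 ≤ lam j) {C : ℝ} (hC : ∀ x y, |F x y| ≤ C) {u : ℝ}
    (hu : u ∈ Set.Icc (0 : ℝ) 1) (x : E d) (y : L r) : |interp S lam u F x y| ≤ C := by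
  have := tsum_of_norm_bounded (f := fun z => slepian S u F x z * transProb lam u y z)
    ((hasSum_transProb hlam hu y).mul_left C) fun z => abs_mul_transProb_le (S := S) hlam hC hu x y z
  rwa [mul_one] at this

/-- Weierstrass test with the time-independent majorant `transDom`. The closed interval matters: the
values at both endpoints enter the fundamental theorem of calculus later. -/
lemma continuousOn_interp (hlam : ∀ j, 0 ≤ lam j) (hF : BddSmooth 0 F) (y : L r) :
    ContinuousOn (fun p : ℝ × E d => interp S lam p.1 F p.2 y) (Set.Icc 0 1 ×ˢ Set.univ) := by
  obtain ⟨C, hC0, hC⟩ := hF.isBdd.exists_nonneg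
  refine continuousOn_tsum (u := fun z => C * transDom lam y z) (fun z => ?_)
    ((summable_transDom hlam y).mul_left C) (fun z p hp => ?_)
  · exact ((continuous_slepian hF z).mul
      ((continuous_transProb lam y z).comp continuous_fst)).continuousOn
  · exact (abs_mul_transProb_le hlam hC hp.1 p.2 y z).trans
      (mul_le_mul_of_nonneg_left (transProb_le hlam hp.1 y z) hC0)

lemma continuousOn_interp_time (hlam : ∀ j, 0 ≤ lam j) (hF : BddSmooth 0 F) (x : E d) (y : L r) :
    ContinuousOn (fun u => interp S lam u F x y) (Set.Icc 0 1) :=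
  (continuousOn_interp hlam hF y).comp (f := fun u : ℝ => (u, x)) (by fun_prop)
    fun _ hu => ⟨hu, Set.mem_univ _⟩

lemma continuous_interp_space (hlam : ∀ j, 0 ≤ lam j) (hF : BddSmooth 0 F) {u : ℝ}
    (hu : u ∈ Set.Icc (0 : ℝ) 1) (y : L r) : Continuous fun x : E d => interp S lam u F x y :=
  (continuousOn_interp hlam hF y).comp_continuous (f := fun x : E d => (u, x)) (by fun_prop)
    fun _ => ⟨hu, Set.mem_univ _⟩

lemma interp_zero (x : E d) (y : L r) : interp S lam 0 F x y = F x y := by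
  unfold interp
  simp_rw [transProb_zero]
  rw [tsum_eq_single y (fun z hz => by simp [hz])]
  simp [slepian]

lemma interp_one (hlam : ∀ j, 0 ≤ lam j) (hF : BddSmooth 0 F) (x : E d) (y : L r) :
    interp S lam 1 F x y = limitMean S lam F := by
  obtain ⟨hc, C, hC⟩ := hF
  have hm : Measurable fun p : E d × L r => F p.1 p.2 :=
    measurable_from_prod_countable_left fun y => (hc y).measurable
  have hi : Integrable (fun p : E d × L r => F p.1 p.2) ((normalLaw S).prod (poissonLaw lam)) :=
    Integrable.of_bound hm.aestronglyMeasurable C (Filter.Eventually.of_forall fun p => hC _ _)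
  rw [limitMean, integral_prod_symm _ hi, integral_countable hi.integral_prod_right]
  refine tsum_congr fun z => ?_
  rw [poissonLaw_real_singleton hlam y z, smul_eq_mul, mul_comm]
  simp [slepian]

lemma slepian_dY (hF : BddSmooth 0 F) (u : ℝ) (k : Fin r) (x : E d) (z : L r) :
    slepian S u (dY k F) x z = slepian S u F x (z + Pi.single k 1) - slepian S u F x z :=
  integral_sub (integrable_slepian hF u x _) (integrable_slepian hF u x z)

/-- Moves a difference from the kernel to the test function. It serves both for differences in the
starting state and for the jump part of the time derivative. -/
lemma hasSum_mul_shift_sub (hlam : ∀ j, 0 ≤ lam j) (hF : BddSmooth 0 F) {u : ℝ}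
    (hu : u ∈ Set.Icc (0 : ℝ) 1) (k : Fin r) (x : E d) (y : L r) :
    HasSum (fun z => slepian S u F x z * (shift k (transProb lam u y) z - transProb lam u y z))
      (interp S lam u (dY k F) x y) := by
  have h1 := hasSum_interp (S := S) hlam hF.isBdd hu x y
  have h2 := hasSum_interp (S := S) hlam (hF.isBdd.dY k) hu x y
  simp_rw [slepian_dY hF] at h2
  have h3 := (hasSum_mul_shift_iff k (transProb lam u y) fun z => slepian S u F x z).1
    ((h2.add h1).congr_fun fun z => by ring)
  have h4 := h3.sub h1
  rw [add_sub_cancel_right] at h4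
  exact h4.congr_fun fun z => by ring

/-- An extra initial particle affects the state at time `u` only if it survives, hence the factor `1
- u`. -/
lemma dY_interp (hlam : ∀ j, 0 ≤ lam j) (hF : BddSmooth 0 F) {u : ℝ}
    (hu : u ∈ Set.Icc (0 : ℝ) 1) (k : Fin r) (x : E d) (y : L r) :
    interp S lam u F x (y + Pi.single k 1) - interp S lam u F x y
      = (1 - u) * interp S lam u (dY k F) x y := by
  have h1 := hasSum_interp (S := S) hlam hF.isBdd hu x y
  have h2 := hasSum_interp (S := S) hlam hF.isBdd hu x (y + Pi.single k 1)
  have h3 := (hasSum_mul_shift_sub (S := S) hlam hF hu k x y).mul_left (1 - u)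
  refine (h2.sub h1).unique (h3.congr_fun fun z => ?_)
  rw [transProb_add_single]; ring

/-- The factor `√(1 - u)` is the scaling of `x` in the Gaussian smoothing; the lattice kernel does
not involve `x`, so the series is differentiated termwise. -/
lemma hasFDerivAt_interp (hlam : ∀ j, 0 ≤ lam j) (hF : BddSmooth 1 F) {u : ℝ}
    (hu : u ∈ Set.Icc (0 : ℝ) 1) (x : E d) (y : L r) :
    HasFDerivAt (fun x => interp S lam u F x y)
      (gradCLM d fun j => Real.sqrt (1 - u) * interp S lam u (dX j F) x y) x := by
  have h0 : ∀ j, BddSmooth 0 (dX j F) := hF.2.2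
  choose C hC0 hC using fun j => (h0 j).isBdd.exists_nonneg
  have hs := Real.sqrt_nonneg (1 - u)
  have := hasFDerivAt_tsum (𝕜 := ℝ) (x₀ := x)
    (u := fun z => (∑ j, Real.sqrt (1 - u) * C j) * transProb lam u y z)
    (f := fun z x => slepian S u F x z * transProb lam u y z)
    (f' := fun z x => transProb lam u y z •
      gradCLM d fun j => Real.sqrt (1 - u) * slepian S u (dX j F) x z)
    ((hasSum_transProb hlam hu y).summable.mul_left _)
    (fun z x => (hasFDerivAt_slepian hF u x z).mul_const _) (fun z x => ?_)
    (summable_interp hlam hF.isBdd hu x y) x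
  · refine this.congr_fderiv (HasSum.tsum_eq ?_)
    have hsum : HasSum (fun z => fun j => transProb lam u y z *
        (Real.sqrt (1 - u) * slepian S u (dX j F) x z))
        (fun j => Real.sqrt (1 - u) * interp S lam u (dX j F) x y) := by
      refine Pi.hasSum.2 fun j => ?_
      exact ((hasSum_interp hlam (h0 j).isBdd hu x y).mul_left _).congr_fun fun z => by ring
    refine ((gradCLM d).hasSum hsum).congr_fun fun z => ?_
    rw [← map_smul]
    rfl
  · rw [norm_smul, mul_comm, Real.norm_of_nonneg (transProb_nonneg hlam hu y z)]
    refine mul_le_mul_of_nonneg_right ((norm_gradCLM_le _).trans ?_) (transProb_nonneg hlam hu y z)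
    refine Finset.sum_le_sum fun j _ => ?_
    rw [abs_mul, abs_of_nonneg hs]
    exact mul_le_mul_of_nonneg_left (abs_slepian_le (hC j) _ _ _) hs

/-- The time derivative of `u ↦ T_u F (x, y)`. -/
def interpDeriv (S : Matrix (Fin d) (Fin d) ℝ) (lam : Fin r → ℝ) (F : E d → L r → ℝ) (x : E d)
    (y : L r) (u : ℝ) : ℝ :=
  1 / 2 * ∑ j, ∑ k, S j k * interp S lam u (dX k (dX j F)) x y
    - 1 / (2 * Real.sqrt (1 - u)) * ∑ j, x j * interp S lam u (dX j F) x y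
    + ∑ j, (lam j * interp S lam u (dY j F) x y
      - y j * interp S lam u (dY j F) x (y - Pi.single j 1))

lemma hasDerivAt_interp_time (hS : S.PosSemidef) (hlam : ∀ j, 0 ≤ lam j) (hF : BddSmooth 2 F)
    {u : ℝ} (hu : u ∈ Set.Ioo (0 : ℝ) 1) (x : E d) (y : L r) :
    HasDerivAt (fun u => interp S lam u F x y) (interpDeriv S lam F x y u) u := by
  have h1 : ∀ j, BddSmooth 1 (dX j F) := hF.2.2
  have h0 : ∀ k j, BddSmooth 0 (dX k (dX j F)) := fun k j => (h1 j).2.2 k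
  obtain ⟨C, hC0, hC⟩ := hF.isBdd.exists_nonneg
  choose C1 hC10 hC1 using fun j => (h1 j).isBdd.exists_nonneg
  choose C2 hC20 hC2 using fun k j => (h0 k j).isBdd.exists_nonneg
  set t : Set ℝ := Set.Ioo (u / 2) ((1 + u) / 2) with ht
  have htI : ∀ v ∈ t, v ∈ Set.Ioo (0 : ℝ) 1 := fun v hv =>
    ⟨by linarith [hv.1, hu.1], by linarith [hv.2, hu.2]⟩
  have hut : u ∈ t := ⟨by linarith [hu.1], by linarith [hu.2]⟩
  have hs2 : 0 < Real.sqrt ((1 - u) / 2) := Real.sqrt_pos.2 (by linarith [hu.2])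
  set D : L r → ℝ → ℝ := fun z v =>
    1 / 2 * ∑ j, ∑ k, S j k * slepian S v (dX k (dX j F)) x z
      - 1 / (2 * Real.sqrt (1 - v)) * ∑ j, x j * slepian S v (dX j F) x z with hD
  set Q : L r → ℝ → ℝ := fun z v =>
    ∑ j, (lam j * (shift j (transProb lam v y) z - transProb lam v y z)
        - y j * (shift j (transProb lam v (y - Pi.single j 1)) z
          - transProb lam v (y - Pi.single j 1) z)) with hQ
  set K : ℝ := 1 / 2 * ∑ j, ∑ k, |S j k| * C2 k j
    + 1 / (2 * Real.sqrt ((1 - u) / 2)) * ∑ j, |x j| * C1 j with hK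
  set B : L r → ℝ := fun z =>
    ∑ j, (lam j * (shift j (transDom lam y) z + transDom lam y z)
        + y j * (shift j (transDom lam (y - Pi.single j 1)) z
          + transDom lam (y - Pi.single j 1) z)) with hB
  have hDK : ∀ z, ∀ v ∈ t, |D z v| ≤ K := by
    intro z v hv
    have hv' := htI v hv
    refine (abs_sub _ _).trans (add_le_add ?_ ?_)
    · rw [abs_mul, abs_of_pos (by norm_num : (0 : ℝ) < 1 / 2)]
      refine mul_le_mul_of_nonneg_left ?_ (by norm_num)
      refine (Finset.abs_sum_le_sum_abs _ _).trans (Finset.sum_le_sum fun j _ => ?_)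
      refine (Finset.abs_sum_le_sum_abs _ _).trans (Finset.sum_le_sum fun k _ => ?_)
      rw [abs_mul]
      exact mul_le_mul_of_nonneg_left (abs_slepian_le (hC2 k j) _ _ _) (abs_nonneg _)
    · rw [abs_mul, abs_of_nonneg (by positivity : 0 ≤ 1 / (2 * Real.sqrt (1 - v)))]
      have e2 : Real.sqrt ((1 - u) / 2) ≤ Real.sqrt (1 - v) :=
        Real.sqrt_le_sqrt (by linarith [hv.2])
      refine mul_le_mul (by gcongr) ?_ (abs_nonneg _) (by positivity)
      refine (Finset.abs_sum_le_sum_abs _ _).trans (Finset.sum_le_sum fun j _ => ?_)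
      rw [abs_mul]
      exact mul_le_mul_of_nonneg_left (abs_slepian_le (hC1 j) _ _ _) (abs_nonneg _)
  have hsh : ∀ y' : L r, ∀ v ∈ t, ∀ z j,
      |shift j (transProb lam v y') z - transProb lam v y' z|
        ≤ shift j (transDom lam y') z + transDom lam y' z := by
    intro y' v hv z j
    have hv' := Set.Ioo_subset_Icc_self (htI v hv)
    refine (abs_sub _ _).trans ?_
    rw [abs_of_nonneg (shift_nonneg j (transProb_nonneg hlam hv' y') z),
      abs_of_nonneg (transProb_nonneg hlam hv' y' z)]
    exact add_le_add (shift_mono j (transProb_le hlam hv' y') z) (transProb_le hlam hv' y' z)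
  have hQB : ∀ z, ∀ v ∈ t, |Q z v| ≤ B z := by
    intro z v hv
    refine (Finset.abs_sum_le_sum_abs _ _).trans (Finset.sum_le_sum fun j _ => ?_)
    refine (abs_sub _ _).trans (add_le_add ?_ ?_)
    · rw [abs_mul, abs_of_nonneg (hlam j)]
      exact mul_le_mul_of_nonneg_left (hsh y v hv z j) (hlam j)
    · rw [abs_mul, abs_of_nonneg (Nat.cast_nonneg _)]
      exact mul_le_mul_of_nonneg_left (hsh _ v hv z j) (Nat.cast_nonneg _)
  have hBs : Summable B := by
    refine summable_sum fun j _ => ?_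
    have e : ∀ y' : L r, Summable fun z => shift j (transDom lam y') z + transDom lam y' z :=
      fun y' => (summable_shift j (summable_transDom hlam y')).add (summable_transDom hlam y')
    exact ((e y).mul_left _).add ((e _).mul_left _)
  -- By the product rule each term splits into a smoothing part, `D` times the kernel, bounded by `K
  -- * transDom`, and a jump part with `Q`, bounded by `C * B`; both majorants are summable and free
  -- of `v ∈ t`.
  have hmain := hasDerivAt_tsum_of_isPreconnected (𝕜 := ℝ) (y₀ := u) (y := u) (t := t)
    (u := fun z => K * transDom lam y z + C * B z)
    (g := fun z v => slepian S v F x z * transProb lam v y z)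
    (g' := fun z v => D z v * transProb lam v y z + slepian S v F x z * Q z v)
    (((summable_transDom hlam y).mul_left K).add (hBs.mul_left C)) isOpen_Ioo isPreconnected_Ioo
    (fun z v hv => (hasDerivAt_slepian_time hS hF (htI v hv) x z).mul
      (hasDerivAt_transProb lam v y z)) (fun z v hv => ?_) hut
    (summable_interp hlam hF.isBdd (Set.Ioo_subset_Icc_self hu) x y) hut
  · refine hmain.congr_deriv (HasSum.tsum_eq ?_)
    have hu' := Set.Ioo_subset_Icc_self hu
    have e1 : HasSum (fun z => D z u * transProb lam u y z)
        (1 / 2 * ∑ j, ∑ k, S j k * interp S lam u (dX k (dX j F)) x y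
          - 1 / (2 * Real.sqrt (1 - u)) * ∑ j, x j * interp S lam u (dX j F) x y) := by
      refine (((hasSum_sum fun j _ => hasSum_sum fun k _ =>
        (hasSum_interp (S := S) hlam (h0 k j).isBdd hu' x y).mul_left (S j k)).mul_left (1 / 2)).sub
        ((hasSum_sum fun j _ => (hasSum_interp (S := S) hlam (h1 j).isBdd hu' x y).mul_left
          (x j)).mul_left (1 / (2 * Real.sqrt (1 - u))))).congr_fun fun z => ?_
      simp only [hD, sub_mul, mul_assoc, Finset.sum_mul]
    have e2 : HasSum (fun z => slepian S u F x z * Q z u)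
        (∑ j, (lam j * interp S lam u (dY j F) x y
          - y j * interp S lam u (dY j F) x (y - Pi.single j 1))) := by
      refine (hasSum_sum fun j _ =>
        ((hasSum_mul_shift_sub (S := S) hlam hF.zero hu' j x y).mul_left (lam j)).sub
        ((hasSum_mul_shift_sub (S := S) hlam hF.zero hu' j x (y - Pi.single j 1)).mul_left
          (y j : ℝ))).congr_fun fun z => ?_
      simp only [hQ, Finset.mul_sum]
      refine Finset.sum_congr rfl fun j _ => ?_
      ring
    exact e1.add e2
  · refine (abs_add_le _ _).trans (add_le_add ?_ ?_)
    · have hv' := Set.Ioo_subset_Icc_self (htI v hv)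
      rw [abs_mul, abs_of_nonneg (transProb_nonneg hlam hv' y z)]
      exact mul_le_mul (hDK z v hv) (transProb_le hlam hv' y z) (transProb_nonneg hlam hv' y z)
        ((abs_nonneg _).trans (hDK z v hv))
    · rw [abs_mul]
      exact mul_le_mul (abs_slepian_le hC _ _ _) (hQB z v hv) (abs_nonneg _) hC0

end

/-! ### Weighted time integrals of the interpolation -/

section

variable {d r : ℕ} {S : Matrix (Fin d) (Fin d) ℝ} {lam : Fin r → ℝ} {F h : E d → L r → ℝ}

/-- The integral of `T_u F` over `(0, 1)` with weight `c`. -/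
def timeInt (S : Matrix (Fin d) (Fin d) ℝ) (lam : Fin r → ℝ) (c : ℝ → ℝ) (F : E d → L r → ℝ)
    (x : E d) (y : L r) : ℝ :=
  ∫ u in Set.Ioo (0 : ℝ) 1, c u * interp S lam u F x y

lemma aestronglyMeasurable_interp (hlam : ∀ j, 0 ≤ lam j) (hF : BddSmooth 0 F) (x : E d)
    (y : L r) : AEStronglyMeasurable (fun u => interp S lam u F x y)
      (volume.restrict (Set.Ioo (0 : ℝ) 1)) :=
  ((continuousOn_interp_time hlam hF x y).mono Set.Ioo_subset_Icc_self).aestronglyMeasurable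
    measurableSet_Ioo

lemma integrableOn_mul_interp (hlam : ∀ j, 0 ≤ lam j) (hF : BddSmooth 0 F) {c : ℝ → ℝ}
    (hc : IntegrableOn c (Set.Ioo 0 1)) (x : E d) (y : L r) :
    IntegrableOn (fun u => c u * interp S lam u F x y) (Set.Ioo 0 1) := by
  obtain ⟨C, hC⟩ := hF.isBdd
  refine hc.mul_bdd (c := C) (aestronglyMeasurable_interp hlam hF x y) ?_
  filter_upwards [ae_restrict_mem measurableSet_Ioo] with u hu
  exact abs_interp_le hlam hC (Set.Ioo_subset_Icc_self hu) x y

lemma isBdd_timeInt (hlam : ∀ j, 0 ≤ lam j) (hF : BddSmooth 0 F) {c : ℝ → ℝ}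
    (hc : IntegrableOn c (Set.Ioo 0 1)) : IsBdd (timeInt S lam c F) := by
  obtain ⟨C, hC⟩ := hF.isBdd
  refine ⟨∫ u in Set.Ioo (0 : ℝ) 1, |c u| * C, fun x y => ?_⟩
  refine norm_integral_le_of_norm_le (f := fun u => c u * interp S lam u F x y)
    (Integrable.mul_const (Integrable.abs hc) C) ?_
  filter_upwards [ae_restrict_mem measurableSet_Ioo] with u hu
  rw [Real.norm_eq_abs, abs_mul]
  exact mul_le_mul_of_nonneg_left (abs_interp_le hlam hC (Set.Ioo_subset_Icc_self hu) x y)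
    (abs_nonneg _)

lemma integrableOn_mul_sqrt {c : ℝ → ℝ} (hc : IntegrableOn c (Set.Ioo 0 1)) :
    IntegrableOn (fun u => c u * Real.sqrt (1 - u)) (Set.Ioo 0 1) := by
  refine hc.mul_bdd (c := 1) (by fun_prop : Continuous fun u : ℝ =>
    Real.sqrt (1 - u)).aestronglyMeasurable ?_
  filter_upwards [ae_restrict_mem measurableSet_Ioo] with u hu
  rw [Real.norm_of_nonneg (Real.sqrt_nonneg _), Real.sqrt_le_one]
  linarith [hu.1]

/-- Differentiation under the time integral, for an arbitrary integrand whose gradient is a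
weighted interpolation of the gradient of `F`. -/
lemma hasFDerivAt_integral_time (hlam : ∀ j, 0 ≤ lam j) (hF : ∀ j, BddSmooth 0 (dX j F))
    {c : ℝ → ℝ} (hc : IntegrableOn c (Set.Ioo 0 1)) {G : E d → ℝ → ℝ} (y : L r)
    (hG : ∀ x, IntegrableOn (G x) (Set.Ioo 0 1))
    (hG' : ∀ u ∈ Set.Ioo (0 : ℝ) 1, ∀ x, HasFDerivAt (fun x => G x u)
      (gradCLM d fun j => c u * interp S lam u (dX j F) x y) x) (x : E d) :
    HasFDerivAt (fun x => ∫ u in Set.Ioo (0 : ℝ) 1, G x u)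
      (gradCLM d fun j => timeInt S lam c (dX j F) x y) x := by
  choose C hC0 hC using fun j => (hF j).isBdd.exists_nonneg
  have hint : ∀ j, IntegrableOn (fun u => c u * interp S lam u (dX j F) x y) (Set.Ioo 0 1) :=
    fun j => integrableOn_mul_interp hlam (hF j) hc x y
  have hvec : IntegrableOn (fun u => fun j => c u * interp S lam u (dX j F) x y) (Set.Ioo 0 1) :=
    Integrable.of_eval hint
  have := hasFDerivAt_integral_of_dominated_of_fderiv_le (x₀ := x)
    (μ := volume.restrict (Set.Ioo (0 : ℝ) 1)) (F := G)
    (F' := fun x u => gradCLM d fun j => c u * interp S lam u (dX j F) x y)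
    (bound := fun u => ∑ j, |c u| * C j) Filter.univ_mem
    (Filter.Eventually.of_forall fun x' => (hG x').aestronglyMeasurable) (hG x)
    ((gradCLM d).continuous.comp_aestronglyMeasurable hvec.aestronglyMeasurable) ?_
    (integrable_finsetSum _ fun j _ => hc.abs.mul_const _) ?_
  · refine this.congr_fderiv ?_
    rw [ContinuousLinearMap.integral_comp_comm _ hvec]
    congr 1
    ext j
    rw [eval_integral hint]
    rfl
  · filter_upwards [ae_restrict_mem measurableSet_Ioo] with u hu x' _
    refine (norm_gradCLM_le _).trans (Finset.sum_le_sum fun j _ => ?_)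
    rw [abs_mul]
    exact mul_le_mul_of_nonneg_left
      (abs_interp_le hlam (hC j) (Set.Ioo_subset_Icc_self hu) x' y) (abs_nonneg _)
  · filter_upwards [ae_restrict_mem measurableSet_Ioo] with u hu x' _
    exact hG' u hu x'

/-- Differentiation only multiplies the weight by `√(1 - u)`, so the gradient is again made of
weighted time integrals. This closure drives the induction in `contDiff_timeInt`. -/
lemma hasFDerivAt_timeInt (hlam : ∀ j, 0 ≤ lam j) (hF : BddSmooth 1 F) {c : ℝ → ℝ}
    (hc : IntegrableOn c (Set.Ioo 0 1)) (x : E d) (y : L r) :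
    HasFDerivAt (fun x => timeInt S lam c F x y)
      (gradCLM d fun j => timeInt S lam (fun u => c u * Real.sqrt (1 - u)) (dX j F) x y) x := by
  refine hasFDerivAt_integral_time hlam hF.2.2 (integrableOn_mul_sqrt hc) y
    (fun x => integrableOn_mul_interp hlam hF.zero hc x y) (fun u hu x => ?_) x
  refine ((hasFDerivAt_interp hlam hF (Set.Ioo_subset_Icc_self hu) x y).const_mul (c u)).congr_fderiv
    ?_
  rw [← map_smul]
  congr 1
  ext j
  simp [mul_assoc]

lemma dX_timeInt (hlam : ∀ j, 0 ≤ lam j) (hF : BddSmooth 1 F) {c : ℝ → ℝ}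
    (hc : IntegrableOn c (Set.Ioo 0 1)) (j : Fin d) :
    dX j (timeInt S lam c F) = timeInt S lam (fun u => c u * Real.sqrt (1 - u)) (dX j F) := by
  ext x y
  exact pderiv_of_gradCLM (hasFDerivAt_timeInt hlam hF hc x y) j

lemma continuous_timeInt (hlam : ∀ j, 0 ≤ lam j) (hF : BddSmooth 0 F) {c : ℝ → ℝ}
    (hc : IntegrableOn c (Set.Ioo 0 1)) (y : L r) :
    Continuous fun x => timeInt S lam c F x y := by
  obtain ⟨C, hC⟩ := hF.isBdd
  refine continuous_of_dominated (bound := fun u => |c u| * C)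
    (fun x => (integrableOn_mul_interp hlam hF hc x y).aestronglyMeasurable) (fun x => ?_)
    (hc.abs.mul_const C) ?_
  · filter_upwards [ae_restrict_mem measurableSet_Ioo] with u hu
    rw [Real.norm_eq_abs, abs_mul]
    exact mul_le_mul_of_nonneg_left (abs_interp_le hlam hC (Set.Ioo_subset_Icc_self hu) x y)
      (abs_nonneg _)
  · filter_upwards [ae_restrict_mem measurableSet_Ioo] with u hu
    exact (continuous_interp_space hlam hF (Set.Ioo_subset_Icc_self hu) y).const_mul _

lemma contDiff_timeInt (hlam : ∀ j, 0 ≤ lam j) {n : ℕ} (hF : BddSmooth n F) {c : ℝ → ℝ}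
    (hc : IntegrableOn c (Set.Ioo 0 1)) (y : L r) :
    ContDiff ℝ n fun x => timeInt S lam c F x y := by
  induction n generalizing F c with
  | zero => exact contDiff_zero.2 (continuous_timeInt hlam hF hc y)
  | succ n ih =>
    exact contDiff_succ_of_hasFDerivAt
      (fun x => hasFDerivAt_timeInt hlam ⟨hF.1, hF.2.1, fun j => (hF.2.2 j).zero⟩ hc x y)
      fun j => ih (hF.2.2 j) (integrableOn_mul_sqrt hc)

lemma timeInt_congr {c c' : ℝ → ℝ} (hcc : ∀ u ∈ Set.Ioo (0 : ℝ) 1, c u = c' u) :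
    timeInt S lam c F = timeInt S lam c' F := by
  ext x y
  exact setIntegral_congr_fun measurableSet_Ioo fun u hu => by simp [hcc u hu]

lemma integrableOn_inv_sqrt :
    IntegrableOn (fun u : ℝ => 1 / Real.sqrt (1 - u)) (Set.Ioo 0 1) := by
  have h1 := (intervalIntegral.intervalIntegrable_rpow' (a := 0) (b := 1)
    (r := -(1 / 2 : ℝ)) (by norm_num)).comp_sub_left 1
  rw [sub_zero, sub_self] at h1
  have h2 := (intervalIntegrable_iff_integrableOn_Ioo_of_le zero_le_one).1 h1.symm
  refine h2.congr_fun (fun u hu => ?_) measurableSet_Ioo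
  have : 0 ≤ 1 - u := by linarith [hu.2]
  simp only []
  rw [Real.rpow_neg this, ← Real.sqrt_eq_rpow, one_div]

/-! ### The solution of the Stein equation -/

/-- Only the drift term is singular; the others are absorbed since `1 ≤ 1 / √(1 - u)`. The constant
may depend on `(x, y)`. -/
lemma exists_interpDeriv_le (hlam : ∀ j, 0 ≤ lam j) (hF : BddSmooth 2 F) (x : E d) (y : L r) :
    ∃ K, 0 ≤ K ∧ ∀ u ∈ Set.Ioo (0 : ℝ) 1,
      |interpDeriv S lam F x y u| ≤ K * (1 / Real.sqrt (1 - u)) := by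
  have h1 : ∀ j, BddSmooth 1 (dX j F) := hF.2.2
  have h0 : ∀ k j, BddSmooth 0 (dX k (dX j F)) := fun k j => (h1 j).2.2 k
  choose C1 hC10 hC1 using fun j => (h1 j).isBdd.exists_nonneg
  choose C2 hC20 hC2 using fun k j => (h0 k j).isBdd.exists_nonneg
  choose C3 hC30 hC3 using fun j => (hF.isBdd.dY j).exists_nonneg
  set A := 1 / 2 * ∑ j, ∑ k, |S j k| * C2 k j with hA
  set B := ∑ j, |x j| * C1 j with hB
  set D := ∑ j, (lam j * C3 j + y j * C3 j) with hD
  have hA0 : 0 ≤ A := mul_nonneg (by norm_num) (Finset.sum_nonneg fun j _ =>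
    Finset.sum_nonneg fun k _ => mul_nonneg (abs_nonneg _) (hC20 k j))
  have hB0 : 0 ≤ B := Finset.sum_nonneg fun j _ => mul_nonneg (abs_nonneg _) (hC10 j)
  have hD0 : 0 ≤ D := Finset.sum_nonneg fun j _ =>
    add_nonneg (mul_nonneg (hlam j) (hC30 j)) (mul_nonneg (Nat.cast_nonneg _) (hC30 j))
  refine ⟨A + B + D, by positivity, fun u hu => ?_⟩
  have hu' := Set.Ioo_subset_Icc_self hu
  have hs : 0 < Real.sqrt (1 - u) := Real.sqrt_pos.2 (by linarith [hu.2])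
  have hs1 : Real.sqrt (1 - u) ≤ 1 := Real.sqrt_le_one.2 (by linarith [hu.1])
  have hw : 1 ≤ 1 / Real.sqrt (1 - u) := by rwa [le_div_iff₀ hs, one_mul]
  have e1 : |1 / 2 * ∑ j, ∑ k, S j k * interp S lam u (dX k (dX j F)) x y| ≤ A := by
    rw [abs_mul, abs_of_pos (by norm_num : (0 : ℝ) < 1 / 2)]
    refine mul_le_mul_of_nonneg_left ?_ (by norm_num)
    refine (Finset.abs_sum_le_sum_abs _ _).trans (Finset.sum_le_sum fun j _ => ?_)
    refine (Finset.abs_sum_le_sum_abs _ _).trans (Finset.sum_le_sum fun k _ => ?_)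
    rw [abs_mul]
    exact mul_le_mul_of_nonneg_left (abs_interp_le hlam (hC2 k j) hu' _ _) (abs_nonneg _)
  have e2 : |1 / (2 * Real.sqrt (1 - u)) * ∑ j, x j * interp S lam u (dX j F) x y|
      ≤ B * (1 / Real.sqrt (1 - u)) := by
    rw [abs_mul, abs_of_pos (by positivity : 0 < 1 / (2 * Real.sqrt (1 - u))), mul_comm]
    refine mul_le_mul ?_ (one_div_le_one_div_of_le hs (by linarith)) (by positivity) hB0
    refine (Finset.abs_sum_le_sum_abs _ _).trans (Finset.sum_le_sum fun j _ => ?_)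
    rw [abs_mul]
    exact mul_le_mul_of_nonneg_left (abs_interp_le hlam (hC1 j) hu' _ _) (abs_nonneg _)
  have e3 : |∑ j, (lam j * interp S lam u (dY j F) x y
      - y j * interp S lam u (dY j F) x (y - Pi.single j 1))| ≤ D := by
    refine (Finset.abs_sum_le_sum_abs _ _).trans (Finset.sum_le_sum fun j _ => ?_)
    refine (abs_sub _ _).trans ?_
    rw [abs_mul, abs_mul, abs_of_nonneg (hlam j), Nat.abs_cast]
    exact add_le_add (mul_le_mul_of_nonneg_left (abs_interp_le hlam (hC3 j) hu' _ _) (hlam j))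
      (mul_le_mul_of_nonneg_left (abs_interp_le hlam (hC3 j) hu' _ _) (Nat.cast_nonneg _))
  calc |interpDeriv S lam F x y u|
      ≤ A + B * (1 / Real.sqrt (1 - u)) + D :=
        (abs_add_le _ _).trans (add_le_add ((abs_sub _ _).trans (add_le_add e1 e2)) e3)
    _ ≤ A * (1 / Real.sqrt (1 - u)) + B * (1 / Real.sqrt (1 - u))
          + D * (1 / Real.sqrt (1 - u)) :=
        add_le_add (add_le_add (le_mul_of_one_le_right hA0 hw) le_rfl)
          (le_mul_of_one_le_right hD0 hw)
    _ = _ := by ring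

lemma exists_interp_sub_limitMean_le (hS : S.PosSemidef) (hlam : ∀ j, 0 ≤ lam j)
    (hF : BddSmooth 2 F) (x : E d) (y : L r) :
    ∃ K, ∀ u ∈ Set.Ioo (0 : ℝ) 1,
      |interp S lam u F x y - limitMean S lam F| ≤ 2 * K * Real.sqrt (1 - u) := by
  obtain ⟨K, hK0, hK⟩ := exists_interpDeriv_le (S := S) hlam hF x y
  refine ⟨K, fun u hu => ?_⟩
  have hsub : ∀ v ∈ Set.Ico u 1, v ∈ Set.Ioo (0 : ℝ) 1 := fun v hv =>
    ⟨hu.1.trans_le hv.1, hv.2⟩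
  -- The derivative bound is integrated from `u` to `1`, with `B` the explicit primitive vanishing
  -- at `u`. Differentiability is needed only on `[u, 1)`; at `1` continuity suffices, and there the
  -- interpolation equals the limit mean.
  have := image_norm_le_of_norm_deriv_right_le_deriv_boundary' (a := u) (b := 1)
    (f := fun v => interp S lam v F x y - interp S lam u F x y)
    (f' := fun v => interpDeriv S lam F x y v)
    (B := fun v => 2 * K * (Real.sqrt (1 - u) - Real.sqrt (1 - v)))
    (B' := fun v => K * (1 / Real.sqrt (1 - v)))
    (((continuousOn_interp_time hlam hF.zero x y).mono
      (Set.Icc_subset_Icc_left hu.1.le)).sub continuousOn_const)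
    (fun v hv => ((hasDerivAt_interp_time hS hlam hF (hsub v hv) x y).sub_const _).hasDerivWithinAt)
    (by simp) (by fun_prop)
    (fun v hv => by
      have hv1 : 1 - v ≠ 0 := by linarith [hv.2]
      have := ((((hasDerivAt_id v).const_sub 1).sqrt hv1).const_sub (Real.sqrt (1 - u))).const_mul
        (2 * K)
      refine (this.congr_deriv ?_).hasDerivWithinAt
      simp only [id]
      ring)
    (fun v hv => hK v (hsub v hv)) (Set.right_mem_Icc.2 hu.2.le)
  simp only [interp_one hlam hF.zero, sub_self, Real.sqrt_zero, sub_zero] at this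
  rw [abs_sub_comm]
  exact this

lemma integrableOn_integrand (hS : S.PosSemidef) (hlam : ∀ j, 0 ≤ lam j) (hF : BddSmooth 2 F)
    (x : E d) (y : L r) : IntegrableOn (integrand S lam F x y) (Set.Ioo 0 1) := by
  obtain ⟨K, hK⟩ := exists_interp_sub_limitMean_le hS hlam hF x y
  refine Integrable.mono' (integrableOn_inv_sqrt.const_mul K) ?_ ?_
  · refine AEStronglyMeasurable.mul ?_
      ((aestronglyMeasurable_interp hlam hF.zero x y).sub aestronglyMeasurable_const)
    exact (by fun_prop : Measurable fun u : ℝ => 1 / (2 * (1 - u))).aestronglyMeasurable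
  · filter_upwards [ae_restrict_mem measurableSet_Ioo] with u hu
    have h1 : 0 < 1 - u := by linarith [hu.2]
    have hs : 0 < Real.sqrt (1 - u) := Real.sqrt_pos.2 h1
    rw [integrand, Real.norm_eq_abs, abs_mul, abs_of_pos (by positivity : 0 < 1 / (2 * (1 - u)))]
    refine (mul_le_mul_of_nonneg_left (hK u hu) (by positivity)).trans (le_of_eq ?_)
    have h2 : 1 - u = Real.sqrt (1 - u) * Real.sqrt (1 - u) := (Real.mul_self_sqrt h1.le).symm
    rw [show 1 / (2 * (1 - u)) = 1 / (2 * (Real.sqrt (1 - u) * Real.sqrt (1 - u))) by rw [← h2]]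
    field_simp

lemma steinSol_eq (S : Matrix (Fin d) (Fin d) ℝ) (lam : Fin r → ℝ) (h : E d → L r → ℝ) (x : E d)
    (y : L r) : steinSol S lam h x y = ∫ u in Set.Ioo (0 : ℝ) 1, -integrand S lam h x y u := by
  rw [steinSol, intervalIntegral.integral_of_le zero_le_one, integral_Ioc_eq_integral_Ioo,
    integral_neg]

/-- The constant `limitMean` drops out, and `√(1 - u)` from the commutation rule turns the weight
`1/(2(1-u))` into the integrable `1/(2√(1-u))`. One further derivative makes it constant, as in
`dX_dX_steinSol`. -/
lemma hasFDerivAt_steinSol (hS : S.PosSemidef) (hlam : ∀ j, 0 ≤ lam j) (hF : BddSmooth 2 F)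
    (x : E d) (y : L r) :
    HasFDerivAt (fun x => steinSol S lam F x y)
      (gradCLM d fun j =>
        timeInt S lam (fun u => -(1 / 2) * (1 / Real.sqrt (1 - u))) (dX j F) x y) x := by
  have hF1 : BddSmooth 1 F := ⟨hF.1, hF.2.1, fun j => (hF.2.2 j).zero⟩
  simp_rw [steinSol_eq]
  refine hasFDerivAt_integral_time hlam hF1.2.2 (integrableOn_inv_sqrt.const_mul _) y
    (fun x => (integrableOn_integrand hS hlam hF x y).neg) (fun u hu x => ?_) x
  have h1 : 0 < 1 - u := by linarith [hu.2]
  have hs : 0 < Real.sqrt (1 - u) := Real.sqrt_pos.2 h1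
  have := (((hasFDerivAt_interp (S := S) hlam hF1 (Set.Ioo_subset_Icc_self hu) x y).sub_const
    (limitMean S lam F)).const_mul (1 / (2 * (1 - u)))).neg
  refine this.congr_fderiv ?_
  rw [← map_smul, ← map_neg]
  congr 1
  ext j
  have h2 : 1 - u = Real.sqrt (1 - u) * Real.sqrt (1 - u) := (Real.mul_self_sqrt h1.le).symm
  rw [show 1 / (2 * (1 - u)) = 1 / (2 * (Real.sqrt (1 - u) * Real.sqrt (1 - u))) by rw [← h2]]
  simp only [Pi.neg_apply, Pi.smul_apply, smul_eq_mul]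
  field_simp

lemma dX_steinSol (hS : S.PosSemidef) (hlam : ∀ j, 0 ≤ lam j) (hF : BddSmooth 2 F) (j : Fin d) :
    dX j (steinSol S lam F)
      = timeInt S lam (fun u => -(1 / 2) * (1 / Real.sqrt (1 - u))) (dX j F) := by
  ext x y
  exact pderiv_of_gradCLM (hasFDerivAt_steinSol hS hlam hF x y) j

lemma integrableOn_const_Ioo (c : ℝ) : IntegrableOn (fun _ : ℝ => c) (Set.Ioo 0 1) :=
  integrableOn_const (by simp)

lemma dX_dX_steinSol (hS : S.PosSemidef) (hlam : ∀ j, 0 ≤ lam j) (hF : BddSmooth 2 F)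
    (k j : Fin d) :
    dX k (dX j (steinSol S lam F)) = timeInt S lam (fun _ => -(1 / 2)) (dX k (dX j F)) := by
  rw [dX_steinSol hS hlam hF, dX_timeInt hlam (hF.2.2 j) (integrableOn_inv_sqrt.const_mul _)]
  refine timeInt_congr fun u hu => ?_
  have hs : 0 < Real.sqrt (1 - u) := Real.sqrt_pos.2 (by linarith [hu.2])
  field_simp

/-- A single difference already yields the full factor `1 - u`, which cancels the singular weight
exactly. -/
lemma dY_steinSol (hS : S.PosSemidef) (hlam : ∀ j, 0 ≤ lam j) (hF : BddSmooth 2 F) (k : Fin r) :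
    dY k (steinSol S lam F) = timeInt S lam (fun _ => -(1 / 2)) (dY k F) := by
  ext x y
  have hi : ∀ y, IntegrableOn (fun u => -integrand S lam F x y u) (Set.Ioo 0 1) := fun y =>
    (integrableOn_integrand hS hlam hF x y).neg
  rw [dY, steinSol_eq, steinSol_eq, ← integral_sub (hi _) (hi y)]
  refine setIntegral_congr_fun measurableSet_Ioo fun u hu => ?_
  have h1 : 1 - u ≠ 0 := by linarith [hu.2]
  have := dY_interp (S := S) hlam hF.zero (Set.Ioo_subset_Icc_self hu) k x y
  simp only [integrand]
  field_simp
  linear_combination -this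

lemma steinSolRegular (hS : S.PosSemidef) (hlam : ∀ j, 0 ≤ lam j) (hh : BddSmooth 3 h) :
    SteinSolRegular S lam h := by
  have h1 : ∀ j, BddSmooth 2 (dX j h) := hh.2.2
  have h2 : ∀ k j, BddSmooth 1 (dX k (dX j h)) := fun k j => (h1 j).2.2 k
  have hh2 : BddSmooth 2 h := ⟨hh.1, hh.2.1, fun j =>
    ⟨(h1 j).1, (h1 j).2.1, fun k => (h2 k j).zero⟩⟩
  have hw := integrableOn_inv_sqrt.const_mul (-(1 / 2) : ℝ)
  refine ⟨fun s hs x y => summable_interp hlam hh.isBdd hs x y, fun x y => ?_, fun y => ?_,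
    fun j k => ?_, fun j k l => ?_, fun k j => ?_, fun j k => ?_⟩
  · rw [intervalIntegrable_iff_integrableOn_Ioo_of_le zero_le_one]
    exact integrableOn_integrand hS hlam hh2 x y
  · exact contDiff_succ_of_hasFDerivAt (n := 2) (fun x => hasFDerivAt_steinSol hS hlam hh2 x y)
      fun j => contDiff_timeInt hlam (h1 j) hw y
  · rw [dX_dX_steinSol hS hlam hh2]
    exact isBdd_timeInt hlam (h2 j k).zero (integrableOn_const_Ioo _)
  · rw [dX_dX_steinSol hS hlam hh2, dX_timeInt hlam (h2 k l) (integrableOn_const_Ioo _)]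
    exact isBdd_timeInt hlam ((h2 k l).2.2 j) (integrableOn_mul_sqrt (integrableOn_const_Ioo _))
  · rw [dX_steinSol hS hlam hh2]
    exact (isBdd_timeInt hlam (h1 j).zero hw).dY k
  · rw [dY_steinSol hS hlam hh2]
    exact (isBdd_timeInt hlam (hh.dY_zero k) (integrableOn_const_Ioo _)).dY j

/-- The Stein equation for `steinSol`. -/
lemma stein_equation (hS : S.PosSemidef) (hlam : ∀ j, 0 ≤ lam j) (hF : BddSmooth 2 F)
    (x : E d) (y : L r) :
    ∑ j, ∑ k, S j k * dX k (dX j (steinSol S lam F)) x y - ∑ j, x j * dX j (steinSol S lam F) x y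
      + 2 * ∑ j, (lam j * dY j (steinSol S lam F) x y
        - y j * dY j (steinSol S lam F) x (y - Pi.single j 1))
      = F x y - limitMean S lam F := by
  have h1 : ∀ j, BddSmooth 1 (dX j F) := hF.2.2
  have h0 : ∀ k j, BddSmooth 0 (dX k (dX j F)) := fun k j => (h1 j).2.2 k
  have hw := integrableOn_inv_sqrt.const_mul (-(1 / 2) : ℝ)
  have hc := integrableOn_const_Ioo (-(1 / 2))
  -- The time derivative is rewritten with the very weights in the formulas for the derivatives and
  -- differences of `steinSol`. The `2` before the jump part compensates the `1/2` in the weight.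
  have hsplit : ∀ u, interpDeriv S lam F x y u =
      -(∑ j, ∑ k, S j k * (-(1 / 2) * interp S lam u (dX k (dX j F)) x y)
        - ∑ j, x j * (-(1 / 2) * (1 / Real.sqrt (1 - u)) * interp S lam u (dX j F) x y)
        + 2 * ∑ j, (lam j * (-(1 / 2) * interp S lam u (dY j F) x y)
        - y j * (-(1 / 2) * interp S lam u (dY j F) x (y - Pi.single j 1)))) := by
    intro u
    have a1 : ∑ j, ∑ k, S j k * (-(1 / 2) * interp S lam u (dX k (dX j F)) x y)
        = -(1 / 2) * ∑ j, ∑ k, S j k * interp S lam u (dX k (dX j F)) x y := by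
      simp_rw [Finset.mul_sum]
      exact Finset.sum_congr rfl fun j _ => Finset.sum_congr rfl fun k _ => by ring
    have a2 : ∑ j, x j * (-(1 / 2) * (1 / Real.sqrt (1 - u)) * interp S lam u (dX j F) x y)
        = -(1 / 2) * (1 / Real.sqrt (1 - u)) * ∑ j, x j * interp S lam u (dX j F) x y := by
      rw [Finset.mul_sum]
      exact Finset.sum_congr rfl fun j _ => by ring
    have a3 : ∑ j, (lam j * (-(1 / 2) * interp S lam u (dY j F) x y)
          - y j * (-(1 / 2) * interp S lam u (dY j F) x (y - Pi.single j 1)))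
        = -(1 / 2) * ∑ j, (lam j * interp S lam u (dY j F) x y
          - y j * interp S lam u (dY j F) x (y - Pi.single j 1)) := by
      rw [Finset.mul_sum]
      exact Finset.sum_congr rfl fun j _ => by ring
    rw [a1, a2, a3, interpDeriv]
    ring
  have i1 : ∀ j k, IntegrableOn (fun u => S j k * (-(1 / 2) * interp S lam u (dX k (dX j F)) x y))
      (Set.Ioo 0 1) := fun j k => (integrableOn_mul_interp hlam (h0 k j) hc x y).const_mul _
  have i2 : ∀ j, IntegrableOn (fun u =>
      x j * (-(1 / 2) * (1 / Real.sqrt (1 - u)) * interp S lam u (dX j F) x y)) (Set.Ioo 0 1) :=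
    fun j => (integrableOn_mul_interp hlam (h1 j).zero hw x y).const_mul _
  have i3 : ∀ j (c : ℝ) y', IntegrableOn (fun u =>
      c * (-(1 / 2) * interp S lam u (dY j F) x y')) (Set.Ioo 0 1) :=
    fun j c y' => (integrableOn_mul_interp hlam (hF.dY_zero j) hc x y').const_mul _
  have I1 := integrable_finsetSum Finset.univ fun j _ =>
    integrable_finsetSum Finset.univ fun k _ => i1 j k
  have I2 := integrable_finsetSum Finset.univ fun j _ => i2 j
  have J3 : ∀ j, IntegrableOn (fun u => lam j * (-(1 / 2) * interp S lam u (dY j F) x y)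
      - y j * (-(1 / 2) * interp S lam u (dY j F) x (y - Pi.single j 1))) (Set.Ioo 0 1) :=
    fun j => (i3 j (lam j) y).sub (i3 j (y j) (y - Pi.single j 1))
  have I3 := integrable_finsetSum Finset.univ fun j _ => J3 j
  have I12 : IntegrableOn (fun u =>
      ∑ j, ∑ k, S j k * (-(1 / 2) * interp S lam u (dX k (dX j F)) x y)
        - ∑ j, x j * (-(1 / 2) * (1 / Real.sqrt (1 - u)) * interp S lam u (dX j F) x y))
      (Set.Ioo 0 1) := I1.sub I2
  have hint : IntegrableOn (interpDeriv S lam F x y) (Set.Ioo 0 1) := by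
    rw [show interpDeriv S lam F x y = _ from funext hsplit]
    exact (I12.add (I3.const_mul 2)).neg
  -- The derivative is available only inside the interval and may blow up at `1`; continuity up to
  -- the endpoints and integrability suffice.
  have hftc := intervalIntegral.integral_eq_sub_of_hasDerivAt_of_le zero_le_one
    (continuousOn_interp_time (S := S) hlam hF.zero x y)
    (fun u hu => hasDerivAt_interp_time hS hlam hF hu x y)
    ((intervalIntegrable_iff_integrableOn_Ioo_of_le zero_le_one).2 hint)
  rw [interp_zero, interp_one hlam hF.zero, intervalIntegral.integral_of_le zero_le_one,
    integral_Ioc_eq_integral_Ioo] at hftc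
  simp_rw [hsplit] at hftc
  rw [integral_neg, integral_add I12 (I3.const_mul 2), integral_sub I1 I2,
    integral_const_mul, integral_finsetSum _ (fun j _ => integrable_finsetSum _ fun k _ => i1 j k),
    integral_finsetSum _ (fun j _ => i2 j),
    integral_finsetSum _ (fun j _ => J3 j)] at hftc
  simp_rw [integral_finsetSum _ (fun k _ => i1 _ k), integral_sub (i3 _ _ _) (i3 _ _ _),
    integral_const_mul] at hftc
  simp_rw [dX_dX_steinSol hS hlam hF, dX_steinSol hS hlam hF, dY_steinSol hS hlam hF, timeInt,
    integral_const_mul]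
  linarith

end

/-! ### Auxiliary bounds -/

lemma abs_sub_le_of_step {a : ℕ → ℝ} {M : ℝ} (h : ∀ n, |a (n + 1) - a n| ≤ M) (m n : ℕ) :
    |a m - a n| ≤ M * |(m : ℝ) - n| := by
  wlog hmn : n ≤ m generalizing m n
  · rw [abs_sub_comm, abs_sub_comm (m : ℝ)]
    exact this n m (le_of_not_ge hmn)
  rw [abs_of_nonneg (sub_nonneg.2 (Nat.cast_le.2 hmn))]
  induction m, hmn using Nat.le_induction with
  | base => simp
  | succ m hm ih =>
    have := abs_add_le (a (m + 1) - a m) (a m - a n)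
    rw [sub_add_sub_cancel] at this
    push_cast
    linarith [h m]

lemma abs_sub_le_of_lattice {r : ℕ} {G : L r → ℝ} {M : Fin r → ℝ}
    (h : ∀ k y, |G (y + Pi.single k 1) - G y| ≤ M k) (y y' : L r) :
    |G y - G y'| ≤ ∑ k, M k * |(y k : ℝ) - y' k| := by
  -- Coordinates are exchanged one at a time; `s` contains those in which the two points may still
  -- differ.
  suffices H : ∀ s : Finset (Fin r), ∀ y : L r, (∀ k ∉ s, y k = y' k) →
      |G y - G y'| ≤ ∑ k ∈ s, M k * |(y k : ℝ) - y' k| from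
    H Finset.univ y fun k hk => absurd (Finset.mem_univ k) hk
  intro s
  induction s using Finset.induction_on with
  | empty =>
    intro y hy
    simp [show y = y' from funext fun k => hy k (Finset.notMem_empty k)]
  | insert k s hk ih =>
    intro y hy
    have h1 := ih (Function.update y k (y' k)) fun i hi => by
      rcases eq_or_ne i k with rfl | hik
      · simp
      · rw [Function.update_of_ne hik]
        exact hy i (by simp [hik, hi])
    have h2 := abs_sub_le_of_step (a := fun n => G (Function.update y k n)) (M := M k)
      (fun n => by
        have : Function.update y k (n + 1) = Function.update y k n + Pi.single k 1 := by
          ext i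
          rcases eq_or_ne i k with rfl | hik
          · simp
          · simp [hik]
        simp only [this]
        exact h k _) (y k) (y' k)
    simp only [Function.update_eq_self] at h2
    have h3 := abs_add_le (G y - G (Function.update y k (y' k)))
      (G (Function.update y k (y' k)) - G y')
    rw [sub_add_sub_cancel] at h3
    rw [Finset.sum_insert hk]
    refine h3.trans (add_le_add h2 (h1.trans (le_of_eq ?_)))
    refine Finset.sum_congr rfl fun i hi => ?_
    rw [Function.update_of_ne (ne_of_mem_of_not_mem hi hk)]

lemma abs_integral_le_of_abs_le {Ω : Type*} [MeasurableSpace Ω] {μ : Measure Ω} {f g : Ω → ℝ}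
    (hg : Integrable g μ) (h : ∀ ω, |f ω| ≤ g ω) : |∫ ω, f ω ∂μ| ≤ ∫ ω, g ω ∂μ :=
  norm_integral_le_of_norm_le (f := f) hg (Filter.Eventually.of_forall h)

/-- The `L¹` distance of a random variable to its mean is at most its standard deviation. -/
lemma integral_abs_sub_mean_le {Ω : Type*} [MeasurableSpace Ω] {μ : Measure Ω}
    [IsProbabilityMeasure μ] {U : Ω → ℝ} (hU : MemLp U 2 μ) :
    ∫ ω, |U ω - ∫ ω', U ω' ∂μ| ∂μ ≤ Real.sqrt (variance U μ) := by
  set c := ∫ ω', U ω' ∂μ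
  have hV : MemLp (fun ω => |U ω - c|) 2 μ := (hU.sub (memLp_const c)).abs
  have h1 := variance_nonneg (fun ω => |U ω - c|) μ
  rw [variance_eq_sub hV] at h1
  rw [variance_eq_integral hU.aemeasurable]
  refine Real.le_sqrt_of_sq_le ?_
  simpa [sq_abs] using h1

/-- Since `φ` is `m`-measurable, `V` may be replaced by `U = E[V | m]`. What remains is `E φ (U - E
U)`, at most `M` times the `L¹` deviation of `U`. -/
lemma abs_integral_mul_sub_le_sqrt_variance_condExp {Ω : Type*} {m m0 : MeasurableSpace Ω}
    {μ : Measure Ω} [IsProbabilityMeasure μ] (hm : m ≤ m0) {φ V : Ω → ℝ}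
    (hφ : StronglyMeasurable[m] φ) {M : ℝ} (hM : ∀ ω, |φ ω| ≤ M) (hV : MemLp V 2 μ) :
    |(∫ ω, V ω ∂μ) * (∫ ω, φ ω ∂μ) - ∫ ω, φ ω * V ω ∂μ|
      ≤ M * Real.sqrt (variance (condExp m μ V) μ) := by
  have hVi : Integrable V μ := hV.integrable one_le_two
  have hU : MemLp (condExp m μ V) 2 μ := hV.condExp one_le_two
  have hφ' : AEStronglyMeasurable φ μ := (hφ.mono hm).aestronglyMeasurable
  have hφi : Integrable φ μ := Integrable.of_bound hφ' M (Filter.Eventually.of_forall hM)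
  have e1 : ∫ ω, φ ω * V ω ∂μ = ∫ ω, φ ω * condExp m μ V ω ∂μ := by
    rw [← integral_condExp hm (f := fun ω => φ ω * V ω)]
    exact integral_congr_ae (condExp_stronglyMeasurable_mul_of_bound hm hφ hVi M
      (Filter.Eventually.of_forall hM))
  have hUi : Integrable (condExp m μ V) μ := integrable_condExp
  have hφU : Integrable (fun ω => φ ω * condExp m μ V ω) μ :=
    hUi.bdd_mul hφ' (Filter.Eventually.of_forall hM)
  rw [e1, ← integral_condExp hm (f := V), abs_sub_comm, mul_comm, ← integral_mul_const,
    ← integral_sub hφU (hφi.mul_const _)]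
  have hM0 : 0 ≤ M := by
    obtain ⟨ω⟩ := nonempty_of_isProbabilityMeasure μ
    exact (abs_nonneg _).trans (hM ω)
  refine (abs_integral_le_of_abs_le
    (((hUi.sub (integrable_const (∫ ω, condExp m μ V ω ∂μ))).abs).const_mul M)
    fun ω => ?_).trans ?_
  · rw [← mul_sub, abs_mul]
    exact mul_le_mul_of_nonneg_right (hM ω) (abs_nonneg _)
  · rw [integral_const_mul]
    exact mul_le_mul_of_nonneg_left (integral_abs_sub_mean_le hU) hM0

/-! ### Functions of coupled indicator vectors -/

/-- `W_1` as a function of the vector of indicators. -/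
def vecW1 {Γ : Type*} [Fintype Γ] {d r : ℕ} (p : Γ → ℝ) (t : Γ → Fin d ⊕ Fin r) (s : Fin d → ℝ)
    (x : Γ → ℕ) : E d :=
  WithLp.toLp 2 fun j => 1 / s j * ∑ α ∈ block1 t j, ((x α : ℝ) - p α)

/-- `W_2` as a function of the vector of indicators. -/
def vecW2 {Γ : Type*} [Fintype Γ] {d r : ℕ} (t : Γ → Fin d ⊕ Fin r) (x : Γ → ℕ) : L r :=
  fun j => ∑ α ∈ block2 t j, x α

section

variable {Ω Γ : Type*} [MeasurableSpace Ω] [Fintype Γ] {d r : ℕ}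
  {p : Γ → ℝ} {t : Γ → Fin d ⊕ Fin r} {s : Fin d → ℝ}

lemma vecW1_sub (x x' : Γ → ℕ) (k : Fin d) :
    vecW1 p t s x k - vecW1 p t s x' k
      = 1 / s k * ∑ β ∈ block1 t k, ((x β : ℝ) - x' β) := by
  simp only [vecW1]
  rw [← mul_sub, ← Finset.sum_sub_distrib]
  congr 1
  exact Finset.sum_congr rfl fun β _ => by ring

lemma vecW2_sub (x x' : Γ → ℕ) (k : Fin r) :
    (vecW2 t x k : ℝ) - vecW2 t x' k = ∑ β ∈ block2 t k, ((x β : ℝ) - x' β) := by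
  simp only [vecW2, Nat.cast_sum]
  rw [Finset.sum_sub_distrib]

/-- First-order expansion of a function of `(W_1, W_2)` around the indicator vector `x`. -/
lemma abs_expansion_le {g : E d → L r → ℝ} (hg : ∀ y, ContDiff ℝ 2 fun x => g x y)
    {M : Fin d → Fin d → ℝ} (hM : ∀ k l x y, |dX l (dX k g) x y| ≤ M k l)
    {K : Fin r → ℝ} (hK : ∀ k x y, |dY k g x y| ≤ K k) (hs : ∀ j, 0 < s j) (x x' : Γ → ℕ) :
    |g (vecW1 p t s x) (vecW2 t x) - g (vecW1 p t s x') (vecW2 t x')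
        - ∑ k, 1 / s k * (dX k g (vecW1 p t s x) (vecW2 t x)
          * ∑ β ∈ block1 t k, ((x β : ℝ) - x' β))|
      ≤ 1 / 2 * ∑ k, ∑ l, M k l / (s k * s l) * |(∑ β ∈ block1 t k, ((x β : ℝ) - x' β))
          * ∑ β ∈ block1 t l, ((x β : ℝ) - x' β)|
        + ∑ k, K k * |∑ β ∈ block2 t k, ((x β : ℝ) - x' β)| := by
  have h1 := abs_taylor_le (hg (vecW2 t x)) (M := M) (fun k l z => hM k l z _)
    (vecW1 p t s x) (vecW1 p t s x')
  have h2 := abs_sub_le_of_lattice (G := fun y => g (vecW1 p t s x') y) (M := K)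
    (fun k y => hK k _ y) (vecW2 t x) (vecW2 t x')
  simp only [vecW2_sub] at h2
  have hd : ∀ k, vecW1 p t s x' k - vecW1 p t s x k
      = -(1 / s k * ∑ β ∈ block1 t k, ((x β : ℝ) - x' β)) := fun k => by
    rw [← vecW1_sub (p := p) (t := t)]; ring
  simp only [hd] at h1
  -- The first argument moves while the second stays at `vecW2 t x`, so that the linear coefficient
  -- is evaluated at `x` alone; the lattice argument moves afterwards.
  have hid : g (vecW1 p t s x) (vecW2 t x) - g (vecW1 p t s x') (vecW2 t x')
        - ∑ k, 1 / s k * (dX k g (vecW1 p t s x) (vecW2 t x)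
          * ∑ β ∈ block1 t k, ((x β : ℝ) - x' β))
      = -(g (vecW1 p t s x') (vecW2 t x) - g (vecW1 p t s x) (vecW2 t x)
          - ∑ k, pderiv k (fun z => g z (vecW2 t x)) (vecW1 p t s x) *
            -(1 / s k * ∑ β ∈ block1 t k, ((x β : ℝ) - x' β)))
        + (g (vecW1 p t s x') (vecW2 t x) - g (vecW1 p t s x') (vecW2 t x')) := by
    have : ∑ k, pderiv k (fun z => g z (vecW2 t x)) (vecW1 p t s x) *
            -(1 / s k * ∑ β ∈ block1 t k, ((x β : ℝ) - x' β))
        = -∑ k, 1 / s k * (dX k g (vecW1 p t s x) (vecW2 t x)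
          * ∑ β ∈ block1 t k, ((x β : ℝ) - x' β)) := by
      rw [← Finset.sum_neg_distrib]
      exact Finset.sum_congr rfl fun k _ => by rw [dX]; ring
    rw [this]; ring
  rw [hid]
  refine (abs_add_le _ _).trans (add_le_add ?_ h2)
  rw [abs_neg]
  refine h1.trans (le_of_eq ?_)
  congr 1
  refine Finset.sum_congr rfl fun k _ => Finset.sum_congr rfl fun l _ => ?_
  have hk := hs k
  have hl := hs l
  rw [abs_neg, abs_neg, abs_mul (1 / s k), abs_mul (1 / s l), abs_mul,
    abs_of_pos (by positivity : 0 < 1 / s k), abs_of_pos (by positivity : 0 < 1 / s l)]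
  field_simp

/-- Comparison of a function of `(W_1, W_2)` at a coupled vector `x'` and at `x` with one point of
block `k` removed. -/
lemma abs_removal_le [DecidableEq Γ] {g : E d → L r → ℝ}
    (hg : ∀ y, ContDiff ℝ 1 fun x => g x y) {M : Fin d → ℝ} (hM : ∀ j x y, |dX j g x y| ≤ M j)
    {K : ℝ} (hK : ∀ l x y, |dY l g x y| ≤ K) (hs : ∀ j, 0 < s j) {x x' : Γ → ℕ} {α : Γ}
    {k : Fin r} (hα : t α = Sum.inr k) (hx : x α = 1) :
    |g (vecW1 p t s x') (vecW2 t x') - g (vecW1 p t s x) (vecW2 t x - Pi.single k 1)|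
      ≤ ∑ j, M j / s j * |∑ β ∈ block1 t j, ((x β : ℝ) - x' β)|
        + K * (x' α + ∑ β ∈ (union2 t).erase α, |(x β : ℝ) - x' β|) := by
  have hαk : α ∈ block2 t k := by simp [block2, hα]
  have h1 := abs_sub_le_of_pderiv ((hg (vecW2 t x')).differentiable (by simp)) (M := M)
    (fun j z => hM j z _) (vecW1 p t s x) (vecW1 p t s x')
  have h2 := abs_sub_le_of_lattice (G := fun y => g (vecW1 p t s x) y) (M := fun _ => K)
    (fun l y => hK l _ y) (vecW2 t x') (vecW2 t x - Pi.single k 1)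
  have e1 : ∑ j, M j * |vecW1 p t s x' j - vecW1 p t s x j|
      = ∑ j, M j / s j * |∑ β ∈ block1 t j, ((x β : ℝ) - x' β)| := by
    refine Finset.sum_congr rfl fun j _ => ?_
    have hj := hs j
    rw [abs_sub_comm, vecW1_sub, abs_mul, abs_of_pos (by positivity : 0 < 1 / s j)]
    field_simp
  have hK0 : 0 ≤ K := (abs_nonneg _).trans (hK k 0 0)
  -- In coordinate `k` the removed unit cancels `x α = 1`, so `α` contributes `x' α` rather than `x
  -- α - x' α`.
  have e2 : ∀ l, |((vecW2 t x' l : ℕ) : ℝ) - ((vecW2 t x - Pi.single k 1 : L r) l : ℕ)|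
      ≤ (if l = k then (x' α : ℝ) else 0) + ∑ β ∈ (block2 t l).erase α, |(x β : ℝ) - x' β| := by
    intro l
    rcases eq_or_ne l k with rfl | hl
    · have hpos : 1 ≤ vecW2 t x l := by
        rw [← hx]
        exact Finset.single_le_sum (f := fun α => x α) (fun _ _ => Nat.zero_le _) hαk
      have : ((vecW2 t x - Pi.single l 1 : L r) l : ℝ) = (vecW2 t x l : ℝ) - 1 := by
        simp [Nat.cast_sub hpos]
      have hv := vecW2_sub (t := t) x x' l
      rw [← Finset.add_sum_erase _ _ hαk, hx] at hv
      push_cast at hv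
      rw [this, if_pos rfl, show (vecW2 t x' l : ℝ) - ((vecW2 t x l : ℝ) - 1)
        = (x' α : ℝ) - ∑ β ∈ (block2 t l).erase α, ((x β : ℝ) - x' β) by linarith]
      refine (abs_sub _ _).trans (add_le_add (le_of_eq (Nat.abs_cast _)) ?_)
      exact Finset.abs_sum_le_sum_abs _ _
    · have hαl : α ∉ block2 t l := by simp [block2, hα, Ne.symm hl]
      have : (vecW2 t x - Pi.single k 1 : L r) l = vecW2 t x l := by
        simp [Pi.single_eq_of_ne hl]
      rw [this, if_neg hl, zero_add, abs_sub_comm, vecW2_sub, Finset.erase_eq_of_notMem hαl]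
      exact Finset.abs_sum_le_sum_abs _ _
  have e3 : ∑ l, ∑ β ∈ (block2 t l).erase α, |(x β : ℝ) - x' β|
      = ∑ β ∈ (union2 t).erase α, |(x β : ℝ) - x' β| := by
    rw [← Finset.sum_biUnion]
    · congr 1
      ext β
      simp [block2, union2]
    · intro l _ l' _ hll
      refine Finset.disjoint_left.2 fun β hβ hβ' => hll ?_
      simp only [block2, Finset.mem_erase, Finset.mem_filter] at hβ hβ'
      exact Sum.inr_injective (hβ.2.2.symm.trans hβ'.2.2)
  have h3 := abs_add_le (g (vecW1 p t s x') (vecW2 t x') - g (vecW1 p t s x) (vecW2 t x'))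
    (g (vecW1 p t s x) (vecW2 t x') - g (vecW1 p t s x) (vecW2 t x - Pi.single k 1))
  rw [sub_add_sub_cancel] at h3
  refine h3.trans (add_le_add (h1.trans (le_of_eq e1)) (h2.trans ?_))
  rw [← Finset.mul_sum]
  refine mul_le_mul_of_nonneg_left ((Finset.sum_le_sum fun l _ => e2 l).trans (le_of_eq ?_)) hK0
  rw [Finset.sum_add_distrib, e3]
  simp

variable {μ : Measure Ω} [IsProbabilityMeasure μ] {X X' : Ω → Γ → ℕ}

/-- Vectors of zeros and ones form a finite set, so an arbitrary `G` is bounded on the range.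
Integrability of functions of the indicators below mostly reduces to this. -/
lemma integrable_pair (hX : Measurable X) (hX' : Measurable X') (hX1 : ∀ ω, X ω ≤ 1)
    (hX1' : ∀ ω, X' ω ≤ 1) (G : (Γ → ℕ) → (Γ → ℕ) → ℝ) :
    Integrable (fun ω => G (X ω) (X' ω)) μ := by
  classical
  have hfin : (Set.Iic (1 : Γ → ℕ) ×ˢ Set.Iic (1 : Γ → ℕ)).Finite :=
    (Set.finite_Iic _).prod (Set.finite_Iic _)
  obtain ⟨C, hC⟩ := (hfin.image fun q => |G q.1 q.2|).bddAbove
  have hm : Measurable fun q : (Γ → ℕ) × (Γ → ℕ) => G q.1 q.2 := measurable_of_countable _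
  refine Integrable.of_bound (hm.comp (hX.prodMk hX')).aestronglyMeasurable C
    (Filter.Eventually.of_forall fun ω => ?_)
  exact hC ⟨(X ω, X' ω), ⟨hX1 ω, hX1' ω⟩, rfl⟩

/-- Normal part of the coupling bound. -/
lemma abs_integral_expansion_le {g : E d → L r → ℝ} (hg : ∀ y, ContDiff ℝ 2 fun x => g x y)
    {M : Fin d → Fin d → ℝ} (hM : ∀ k l x y, |dX l (dX k g) x y| ≤ M k l)
    {K : Fin r → ℝ} (hK : ∀ k x y, |dY k g x y| ≤ K k) (hs : ∀ j, 0 < s j)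
    (hX : Measurable X) (hX' : Measurable X') (hX1 : ∀ ω, X ω ≤ 1)
    (hX1' : ∀ ω, X' ω ≤ 1) (α : Γ) :
    |(∫ ω, (X ω α : ℝ) * (g (vecW1 p t s (X ω)) (vecW2 t (X ω))
          - g (vecW1 p t s (X' ω)) (vecW2 t (X' ω))) ∂μ)
        - ∑ k, 1 / s k * ∫ ω, dX k g (vecW1 p t s (X ω)) (vecW2 t (X ω))
          * ((X ω α : ℝ) * ∑ β ∈ block1 t k, ((X ω β : ℝ) - X' ω β)) ∂μ|
      ≤ 1 / 2 * ∑ k, ∑ l, M k l / (s k * s l) *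
          ∫ ω, |(X ω α : ℝ) * (∑ β ∈ block1 t k, ((X ω β : ℝ) - X' ω β))
            * ∑ β ∈ block1 t l, ((X ω β : ℝ) - X' ω β)| ∂μ
        + ∑ k, K k * ∫ ω, |(X ω α : ℝ) * ∑ β ∈ block2 t k, ((X ω β : ℝ) - X' ω β)| ∂μ := by
  have I := integrable_pair (μ := μ) hX hX' hX1 hX1'
  have i1 := I fun x x' => (x α : ℝ) * (g (vecW1 p t s x) (vecW2 t x)
    - g (vecW1 p t s x') (vecW2 t x'))
  have i2 := fun k => I fun x x' => dX k g (vecW1 p t s x) (vecW2 t x)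
    * ((x α : ℝ) * ∑ β ∈ block1 t k, ((x β : ℝ) - x' β))
  have i3 := fun k l => I fun x x' => |(x α : ℝ) * (∑ β ∈ block1 t k, ((x β : ℝ) - x' β))
    * ∑ β ∈ block1 t l, ((x β : ℝ) - x' β)|
  have i4 := fun k => I fun x x' => |(x α : ℝ) * ∑ β ∈ block2 t k, ((x β : ℝ) - x' β)|
  have i2' := integrable_finsetSum Finset.univ fun k _ => (i2 k).const_mul (1 / s k)
  have i3' := integrable_finsetSum Finset.univ fun k _ =>
    integrable_finsetSum Finset.univ fun l _ => (i3 k l).const_mul (M k l / (s k * s l))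
  have i4' := integrable_finsetSum Finset.univ fun k _ => (i4 k).const_mul (K k)
  simp_rw [← integral_const_mul]
  rw [← integral_finsetSum _ fun k _ => (i2 k).const_mul (1 / s k), ← integral_sub i1 i2']
  have e : ∑ k, ∑ l, ∫ ω, M k l / (s k * s l) *
      |(X ω α : ℝ) * (∑ β ∈ block1 t k, ((X ω β : ℝ) - X' ω β))
        * ∑ β ∈ block1 t l, ((X ω β : ℝ) - X' ω β)| ∂μ
      = ∫ ω, ∑ k, ∑ l, M k l / (s k * s l) *
      |(X ω α : ℝ) * (∑ β ∈ block1 t k, ((X ω β : ℝ) - X' ω β))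
        * ∑ β ∈ block1 t l, ((X ω β : ℝ) - X' ω β)| ∂μ := by
    rw [integral_finsetSum _ fun k _ => integrable_finsetSum _ fun l _ => (i3 k l).const_mul _]
    refine Finset.sum_congr rfl fun k _ => ?_
    rw [integral_finsetSum _ fun l _ => (i3 k l).const_mul _]
  rw [e, ← integral_const_mul, ← integral_finsetSum _ fun k _ => (i4 k).const_mul (K k),
    ← integral_add (i3'.const_mul (1 / 2)) i4']
  refine abs_integral_le_of_abs_le ((i3'.const_mul (1 / 2)).add i4') fun ω => ?_
  have hb := abs_expansion_le (p := p) (t := t) hg hM hK hs (X ω) (X' ω)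
  have hb' := mul_le_mul_of_nonneg_left hb (Nat.cast_nonneg (α := ℝ) (X ω α))
  rw [← Nat.abs_cast (R := ℝ), ← abs_mul, Nat.abs_cast] at hb'
  refine (le_of_eq ?_).trans (hb'.trans (le_of_eq ?_))
  · congr 1
    rw [mul_sub (X ω α : ℝ) (_ - _), Finset.mul_sum]
    congr 1
    exact Finset.sum_congr rfl fun k _ => by ring
  · rw [mul_add, mul_left_comm]
    congr 1
    · congr 1
      rw [Finset.mul_sum]
      refine Finset.sum_congr rfl fun k _ => ?_
      rw [Finset.mul_sum]
      refine Finset.sum_congr rfl fun l _ => ?_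
      rw [mul_assoc (X ω α : ℝ), abs_mul (X ω α : ℝ), Nat.abs_cast]; ring
    · rw [Finset.mul_sum]
      refine Finset.sum_congr rfl fun k _ => ?_
      rw [abs_mul (X ω α : ℝ), Nat.abs_cast]; ring

/-- Poisson part of the coupling bound. -/
lemma abs_integral_removal_le [DecidableEq Γ] {g : E d → L r → ℝ}
    (hg : ∀ y, ContDiff ℝ 1 fun x => g x y) {M : Fin d → ℝ} (hM : ∀ j x y, |dX j g x y| ≤ M j)
    {K : ℝ} (hK : ∀ l x y, |dY l g x y| ≤ K) (hs : ∀ j, 0 < s j)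
    (hX : Measurable X) (hX' : Measurable X') (hX1 : ∀ ω, X ω ≤ 1)
    (hX1' : ∀ ω, X' ω ≤ 1) {α : Γ} {k : Fin r} (hα : t α = Sum.inr k) :
    |∫ ω, (X ω α : ℝ) * (g (vecW1 p t s (X' ω)) (vecW2 t (X' ω))
          - g (vecW1 p t s (X ω)) (vecW2 t (X ω) - Pi.single k 1)) ∂μ|
      ≤ ∑ j, M j / s j * ∫ ω, |(X ω α : ℝ) * ∑ β ∈ block1 t j, ((X ω β : ℝ) - X' ω β)| ∂μ
        + K * ((∫ ω, (X ω α : ℝ) * X' ω α ∂μ)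
          + ∑ β ∈ (union2 t).erase α, ∫ ω, (X ω α : ℝ) * |(X ω β : ℝ) - X' ω β| ∂μ) := by
  have I := integrable_pair (μ := μ) hX hX' hX1 hX1'
  have i1 := fun j => I fun x x' => |(x α : ℝ) * ∑ β ∈ block1 t j, ((x β : ℝ) - x' β)|
  have i2 := I fun x x' => (x α : ℝ) * x' α
  have i3 := fun β => I fun x x' => (x α : ℝ) * |(x β : ℝ) - x' β|
  have i1' := integrable_finsetSum Finset.univ fun j _ => (i1 j).const_mul (M j / s j)
  have i3' := integrable_finsetSum ((union2 t).erase α) fun β _ => i3 β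
  have i23 := I fun x x' => (x α : ℝ) * x' α
    + ∑ β ∈ (union2 t).erase α, (x α : ℝ) * |(x β : ℝ) - x' β|
  simp_rw [← integral_const_mul]
  rw [← integral_finsetSum _ fun β _ => i3 β, ← integral_add i2 i3', ← integral_const_mul,
    ← integral_finsetSum _ fun j _ => (i1 j).const_mul (M j / s j),
    ← integral_add i1' (i23.const_mul K)]
  refine abs_integral_le_of_abs_le (i1'.add (i23.const_mul K)) fun ω => ?_
  -- The factor `X ω α` kills both sides unless `α` is present, which is exactly when it can be
  -- removed.
  rcases Nat.le_one_iff_eq_zero_or_eq_one.1 (hX1 ω α) with h0 | h1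
  · simp [h0]
  · have := abs_removal_le (p := p) hg hM hK hs hα h1 (x' := X' ω)
    simpa [h1] using this

end

/-! ### Measurability and boundedness of the indicator vectors -/

lemma measurable_indicators {Ω Γ : Type*} [MeasurableSpace Ω] {I : Γ → Ω → ℕ}
    (hI : ∀ α, Measurable (I α)) : Measurable fun ω β => I β ω :=
  measurable_pi_lambda _ hI

lemma indicators_le_one {Ω Γ : Type*} {I : Γ → Ω → ℕ} (hI01 : ∀ α ω, I α ω = 0 ∨ I α ω = 1)
    (ω : Ω) : (fun β => I β ω) ≤ 1 := fun β => by
  rcases hI01 β ω with h | h <;> simp [h]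

lemma measurable_W {Ω Γ : Type*} [MeasurableSpace Ω] [Fintype Γ] {d r : ℕ} {μ : Measure Ω}
    {I : Γ → Ω → ℕ} {t : Γ → Fin d ⊕ Fin r} {s : Fin d → ℝ} (hI : ∀ α, Measurable (I α)) :
    Measurable fun ω => (W1 μ I t s ω, W2 I t ω) :=
  (measurable_of_countable fun x : Γ → ℕ =>
    ((vecW1 (prob μ I) t s x, vecW2 t x) : E d × L r)).comp (measurable_indicators hI)

section

variable {Ω Γ : Type*} [MeasurableSpace Ω] [Fintype Γ] {d r : ℕ}
  {μ : Measure Ω} [IsProbabilityMeasure μ] {I : Γ → Ω → ℕ} {J : Γ → Γ → Ω → ℕ}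
  {t : Γ → Fin d ⊕ Fin r} {s : Fin d → ℝ}

/-! ### The coupling identities -/

/-- Weighting by `I_α` restricts the measure to `{I_α = 1}`, that is, multiplies the conditional law
by `p_α`. If the event is null, both sides vanish and no coupling condition is needed. -/
lemma integral_coupling (hI : ∀ α, Measurable (I α)) (hI01 : ∀ α ω, I α ω = 0 ∨ I α ω = 1)
    (hJ : ∀ β α, Measurable (J β α)) (hIJ : IsCoupling μ I J) (α : Γ) (G : (Γ → ℕ) → ℝ) :
    prob μ I α * ∫ ω, G (fun β => I β ω) ∂μ = ∫ ω, (I α ω : ℝ) * G (fun β => J β α ω) ∂μ := by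
  set A : Set Ω := {ω | I α ω = 1} with hA
  have hAm : MeasurableSet A := hI α (measurableSet_singleton 1)
  have hind : ∀ g : Ω → ℝ, (fun ω => (I α ω : ℝ) * g ω) = A.indicator g := by
    intro g
    ext ω
    rcases hI01 α ω with h | h <;> simp [hA, h]
  have hprob : prob μ I α = μ.real A := by
    have := hind fun _ => 1
    simp only [mul_one] at this
    rw [prob, this, integral_indicator hAm]
    simp
  have hGm : Measurable G := measurable_of_countable _
  rw [hind, integral_indicator hAm, hprob]
  by_cases h0 : μ A = 0
  · simp [measureReal_def, h0, Measure.restrict_eq_zero.2 h0]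
  · have h := hIJ α h0
    have e1 : ∫ ω, G (fun β => I β ω) ∂μ = ∫ x, G x ∂(μ.map fun ω β => I β ω) :=
      (integral_map (measurable_indicators hI).aemeasurable hGm.aestronglyMeasurable).symm
    rw [e1, ← h, integral_map (measurable_pi_lambda _ fun β => hJ β α).aemeasurable
      hGm.aestronglyMeasurable, ProbabilityTheory.cond, integral_smul_measure, ENNReal.toReal_inv, smul_eq_mul,
      measureReal_def, mul_inv_cancel_left₀]
    exact (ENNReal.toReal_pos h0 (measure_ne_top _ _)).ne'

lemma integral_centered_mul (hI : ∀ α, Measurable (I α)) (hI01 : ∀ α ω, I α ω = 0 ∨ I α ω = 1)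
    (hJ : ∀ β α, Measurable (J β α)) (hJ01 : ∀ β α ω, J β α ω = 0 ∨ J β α ω = 1)
    (hIJ : IsCoupling μ I J) (α : Γ) (G : (Γ → ℕ) → ℝ) :
    ∫ ω, ((I α ω : ℝ) - prob μ I α) * G (fun β => I β ω) ∂μ
      = ∫ ω, (I α ω : ℝ) * (G (fun β => I β ω) - G (fun β => J β α ω)) ∂μ := by
  have Ip := integrable_pair (μ := μ) (measurable_indicators hI)
    (measurable_indicators fun β => hJ β α) (indicators_le_one hI01)
    (indicators_le_one fun β => hJ01 β α)
  have i1 := Ip fun x _ => (x α : ℝ) * G x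
  have i2 := Ip fun x _ => prob μ I α * G x
  have i3 := Ip fun x x' => (x α : ℝ) * G x'
  simp_rw [sub_mul, mul_sub]
  rw [integral_sub i1 i2, integral_sub i1 i3, integral_const_mul,
    integral_coupling hI hI01 hJ hIJ]

lemma integral_W1_mul (hI : ∀ α, Measurable (I α)) (hI01 : ∀ α ω, I α ω = 0 ∨ I α ω = 1)
    (hJ : ∀ β α, Measurable (J β α)) (hJ01 : ∀ β α ω, J β α ω = 0 ∨ J β α ω = 1)
    (hIJ : IsCoupling μ I J) (j : Fin d) (G : (Γ → ℕ) → ℝ) :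
    ∫ ω, W1 μ I t s ω j * G (fun β => I β ω) ∂μ
      = 1 / s j * ∑ α ∈ block1 t j,
        ∫ ω, (I α ω : ℝ) * (G (fun β => I β ω) - G (fun β => J β α ω)) ∂μ := by
  simp only [W1]
  simp_rw [mul_assoc, Finset.sum_mul]
  rw [integral_const_mul, integral_finsetSum]
  · simp_rw [integral_centered_mul hI hI01 hJ hJ01 hIJ]
  · intro α _
    exact integrable_pair (measurable_indicators hI) (measurable_indicators hI)
      (indicators_le_one hI01) (indicators_le_one hI01)
      fun x _ => ((x α : ℝ) - prob μ I α) * G x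

lemma integral_W1_eq_zero (hI : ∀ α, Measurable (I α)) (hI01 : ∀ α ω, I α ω = 0 ∨ I α ω = 1)
    (j : Fin d) : ∫ ω, W1 μ I t s ω j ∂μ = 0 := by
  have i1 : ∀ α, Integrable (fun ω => (I α ω : ℝ)) μ := fun α =>
    integrable_pair (measurable_indicators hI) (measurable_indicators hI)
      (indicators_le_one hI01) (indicators_le_one hI01) fun x _ => (x α : ℝ)
  have i2 : ∀ α, Integrable (fun ω => (I α ω : ℝ) - prob μ I α) μ := fun α =>
    (i1 α).sub (integrable_const _)
  simp only [W1]
  rw [integral_const_mul, integral_finsetSum _ fun α _ => i2 α]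
  simp_rw [integral_sub (i1 _) (integrable_const _)]
  simp [prob]

lemma covW1_apply (hI : ∀ α, Measurable (I α)) (hI01 : ∀ α ω, I α ω = 0 ∨ I α ω = 1)
    (j k : Fin d) :
    covW1 μ I t s j k = ∫ ω, W1 μ I t s ω j * W1 μ I t s ω k ∂μ := by
  simp [covW1, covariance, integral_W1_eq_zero hI hI01]

lemma posSemidef_covW1 (hI : ∀ α, Measurable (I α)) (hI01 : ∀ α ω, I α ω = 0 ∨ I α ω = 1) :
    (covW1 μ I t s).PosSemidef := by
  refine Matrix.PosSemidef.of_dotProduct_mulVec_nonneg ?_ fun v => ?_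
  · ext j k
    simp [covW1, covariance_comm]
  · have i1 : ∀ j k, Integrable
        (fun ω => v j * (W1 μ I t s ω j * W1 μ I t s ω k * v k)) μ := fun j k =>
      integrable_pair (measurable_indicators hI) (measurable_indicators hI)
        (indicators_le_one hI01) (indicators_le_one hI01) fun x _ => v j * (vecW1 (prob μ I) t s x j * vecW1 (prob μ I) t s x k * v k)
    have e : star v ⬝ᵥ (covW1 μ I t s).mulVec v
        = ∫ ω, (∑ j, v j * W1 μ I t s ω j) ^ 2 ∂μ := by
      simp only [dotProduct, Matrix.mulVec, star_trivial, covW1_apply hI hI01]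
      simp_rw [← integral_mul_const, Finset.mul_sum, ← integral_const_mul]
      rw [Finset.sum_congr rfl fun j _ => (integral_finsetSum _ fun k _ => i1 j k).symm,
        ← integral_finsetSum _ fun j _ => integrable_finsetSum _ fun k _ => i1 j k]
      congr 1
      ext ω
      rw [sq, Finset.sum_mul_sum]
      refine Finset.sum_congr rfl fun j _ => Finset.sum_congr rfl fun k _ => ?_
      ring
    rw [e]
    exact integral_nonneg fun ω => sq_nonneg _

/-- The coupling identity for the linear function `W_{1k}`. It shows that the covariance matrix
exactly centres the first-order term of the expansion. -/
lemma integral_sum_diffIJ (hI : ∀ α, Measurable (I α)) (hI01 : ∀ α ω, I α ω = 0 ∨ I α ω = 1)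
    (hJ : ∀ β α, Measurable (J β α)) (hJ01 : ∀ β α ω, J β α ω = 0 ∨ J β α ω = 1)
    (hIJ : IsCoupling μ I J) (hs : ∀ j, 0 < s j) (j k : Fin d) :
    ∫ ω, ∑ α ∈ block1 t j, (I α ω : ℝ) * ∑ β ∈ block1 t k, diffIJ I J α β ω ∂μ
      = s j * s k * covW1 μ I t s j k := by
  have h := integral_W1_mul (t := t) (s := s) hI hI01 hJ hJ01 hIJ j
    fun x => vecW1 (prob μ I) t s x k
  change ∫ ω, W1 μ I t s ω j * W1 μ I t s ω k ∂μ = _ at h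
  rw [covW1_apply hI hI01, h, integral_finsetSum]
  · simp_rw [vecW1_sub, mul_left_comm _ (1 / s k), integral_const_mul, ← Finset.mul_sum]
    have hj := hs j
    have hk := hs k
    simp only [diffIJ]
    field_simp
  · intro α _
    exact integrable_pair (measurable_indicators hI) (measurable_indicators fun β => hJ β α)
      (indicators_le_one hI01) (indicators_le_one fun β => hJ01 β α)
      fun x x' => (x α : ℝ) * ∑ β ∈ block1 t k, ((x β : ℝ) - x' β)

/-! ### The two parts of the Stein operator -/

lemma measurable_uncurry_of_continuous {g : E d → L r → ℝ}
    (hg : ∀ y, Continuous fun x => g x y) : Measurable fun q : E d × L r => g q.1 q.2 :=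
  measurable_from_prod_countable_left fun y => (hg y).measurable

/-- After the coupling identity, expansion of `g` leaves a remainder bounded by `B α` and linear
terms `E φ_k V_k`. Since the covariance is `E V_k / (s_j s_k)`, these combine to `E V_k E φ_k - E
φ_k V_k`; `φ_k` is a function of `(W_1, W_2)`, so conditioning applies. -/
lemma abs_integral_normal_part_le (hI : ∀ α, Measurable (I α))
    (hI01 : ∀ α ω, I α ω = 0 ∨ I α ω = 1)
    (hJ : ∀ β α, Measurable (J β α)) (hJ01 : ∀ β α ω, J β α ω = 0 ∨ J β α ω = 1)
    (hIJ : IsCoupling μ I J) (hs : ∀ j, 0 < s j) {g : E d → L r → ℝ}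
    (hg : ∀ y, ContDiff ℝ 2 fun x => g x y) {M1 : Fin d → ℝ} (hM1 : ∀ k x y, |dX k g x y| ≤ M1 k)
    {M : Fin d → Fin d → ℝ} (hM : ∀ k l x y, |dX l (dX k g) x y| ≤ M k l)
    {K : Fin r → ℝ} (hK : ∀ k x y, |dY k g x y| ≤ K k) (j : Fin d) :
    |∫ ω, (∑ k, covW1 μ I t s j k * dX k g (W1 μ I t s ω) (W2 I t ω)
        - W1 μ I t s ω j * g (W1 μ I t s ω) (W2 I t ω)) ∂μ|
      ≤ (∑ k, M1 k / (s j * s k) * Real.sqrt (variance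
          (condExp (sigmaW μ I t s) μ fun ω =>
            ∑ α ∈ block1 t j, (I α ω : ℝ) * ∑ β ∈ block1 t k, diffIJ I J α β ω) μ))
        + 1 / 2 * (∑ k, ∑ l, M k l / (s j * s k * s l) *
          ∑ α ∈ block1 t j, ∫ ω, |(I α ω : ℝ) * (∑ β ∈ block1 t k, diffIJ I J α β ω) *
            (∑ γ ∈ block1 t l, diffIJ I J α γ ω)| ∂μ)
        + ∑ k, K k / s j * ∑ α ∈ block1 t j,
            ∫ ω, |(I α ω : ℝ) * ∑ β ∈ block2 t k, diffIJ I J α β ω| ∂μ := by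
  have hj := hs j
  have Ip := fun α => integrable_pair (μ := μ) (measurable_indicators hI)
    (measurable_indicators fun β => hJ β α) (indicators_le_one hI01)
    (indicators_le_one fun β => hJ01 β α)
  set φ : Fin d → Ω → ℝ := fun k ω => dX k g (W1 μ I t s ω) (W2 I t ω) with hφ
  set D : Γ → Fin d → Ω → ℝ := fun α k ω => (I α ω : ℝ) * ∑ β ∈ block1 t k, diffIJ I J α β ω
    with hD
  set V : Fin d → Ω → ℝ := fun k ω => ∑ α ∈ block1 t j, D α k ω with hV
  set A : Γ → ℝ := fun α => ∫ ω, (I α ω : ℝ) *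
    (g (vecW1 (prob μ I) t s fun β => I β ω) (vecW2 t fun β => I β ω)
      - g (vecW1 (prob μ I) t s fun β => J β α ω) (vecW2 t fun β => J β α ω)) ∂μ with hA
  set B : Γ → ℝ := fun α => 1 / 2 * ∑ k, ∑ l, M k l / (s k * s l) *
      ∫ ω, |(I α ω : ℝ) * (∑ β ∈ block1 t k, diffIJ I J α β ω) *
        (∑ γ ∈ block1 t l, diffIJ I J α γ ω)| ∂μ
      + ∑ k, K k * ∫ ω, |(I α ω : ℝ) * ∑ β ∈ block2 t k, diffIJ I J α β ω| ∂μ with hB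
  have hAB : ∀ α, |A α - ∑ k, 1 / s k * ∫ ω, φ k ω * D α k ω ∂μ| ≤ B α := fun α =>
    abs_integral_expansion_le hg hM hK hs (measurable_indicators hI)
      (measurable_indicators fun β => hJ β α) (indicators_le_one hI01)
      (indicators_le_one fun β => hJ01 β α) α
  have hφD : ∀ α k, Integrable (fun ω => φ k ω * D α k ω) μ := fun α k =>
    Ip α fun x x' => dX k g (vecW1 (prob μ I) t s x) (vecW2 t x)
      * ((x α : ℝ) * ∑ β ∈ block1 t k, ((x β : ℝ) - x' β))
  have hφi : ∀ k, Integrable (φ k) μ := fun k =>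
    integrable_pair (measurable_indicators hI) (measurable_indicators hI) (indicators_le_one hI01)
      (indicators_le_one hI01) fun x _ => dX k g (vecW1 (prob μ I) t s x) (vecW2 t x)
  have hWg : Integrable (fun ω => W1 μ I t s ω j * g (W1 μ I t s ω) (W2 I t ω)) μ :=
    integrable_pair (measurable_indicators hI) (measurable_indicators hI) (indicators_le_one hI01)
      (indicators_le_one hI01) fun x _ => vecW1 (prob μ I) t s x j
        * g (vecW1 (prob μ I) t s x) (vecW2 t x)
  have hφV : ∀ k, ∫ ω, φ k ω * V k ω ∂μ = ∑ α ∈ block1 t j, ∫ ω, φ k ω * D α k ω ∂μ := by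
    intro k
    rw [← integral_finsetSum _ fun α _ => hφD α k]
    simp_rw [hV, Finset.mul_sum]
  have hcov : ∀ k, covW1 μ I t s j k = 1 / (s j * s k) * ∫ ω, V k ω ∂μ := by
    intro k
    have hk := hs k
    simp only [hV, hD]
    rw [integral_sum_diffIJ hI hI01 hJ hJ01 hIJ hs]
    field_simp
  have hVL : ∀ k, MemLp (V k) 2 μ := by
    intro k
    refine memLp_finsetSum _ fun α _ => ?_
    have hsq := Ip α fun x x' => ((x α : ℝ) * ∑ β ∈ block1 t k, ((x β : ℝ) - x' β)) ^ 2
    have hm := (Ip α fun x x' =>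
      (x α : ℝ) * ∑ β ∈ block1 t k, ((x β : ℝ) - x' β)).aestronglyMeasurable
    exact (memLp_two_iff_integrable_sq hm).2 hsq
  have hcond : ∀ k, |(∫ ω, V k ω ∂μ) * (∫ ω, φ k ω ∂μ) - ∫ ω, φ k ω * V k ω ∂μ|
      ≤ M1 k * Real.sqrt (variance (condExp (sigmaW μ I t s) μ (V k)) μ) := by
    intro k
    refine abs_integral_mul_sub_le_sqrt_variance_condExp (measurable_W hI).comap_le ?_
      (fun ω => hM1 k _ _) (hVL k)
    have hm : Measurable fun q : E d × L r => dX k g q.1 q.2 :=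
      measurable_uncurry_of_continuous fun y => (contDiff_pderiv (n := 1) (hg y) k).continuous
    exact (hm.comp (comap_measurable _)).stronglyMeasurable
  have hW1 : ∫ ω, W1 μ I t s ω j * g (W1 μ I t s ω) (W2 I t ω) ∂μ
      = 1 / s j * ∑ α ∈ block1 t j, A α :=
    integral_W1_mul hI hI01 hJ hJ01 hIJ j
      fun x => g (vecW1 (prob μ I) t s x) (vecW2 t x)
  have hmain : ∫ ω, (∑ k, covW1 μ I t s j k * φ k ω
        - W1 μ I t s ω j * g (W1 μ I t s ω) (W2 I t ω)) ∂μ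
      = ∑ k, 1 / (s j * s k) * ((∫ ω, V k ω ∂μ) * (∫ ω, φ k ω ∂μ) - ∫ ω, φ k ω * V k ω ∂μ)
        - 1 / s j * ∑ α ∈ block1 t j, (A α - ∑ k, 1 / s k * ∫ ω, φ k ω * D α k ω ∂μ) := by
    rw [integral_sub (integrable_finsetSum _ fun k _ => (hφi k).const_mul _) hWg, hW1,
      integral_finsetSum _ fun k _ => (hφi k).const_mul _]
    simp_rw [integral_const_mul, hφV, hcov, mul_sub, Finset.sum_sub_distrib, mul_sub]
    have : 1 / s j * ∑ α ∈ block1 t j, ∑ k, 1 / s k * ∫ ω, φ k ω * D α k ω ∂μ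
        = ∑ k, 1 / (s j * s k) * ∑ α ∈ block1 t j, ∫ ω, φ k ω * D α k ω ∂μ := by
      rw [Finset.sum_comm, Finset.mul_sum]
      refine Finset.sum_congr rfl fun k _ => ?_
      rw [← Finset.mul_sum, ← mul_assoc, one_div_mul_one_div]
    rw [this]
    simp_rw [mul_assoc]
    ring
  rw [hmain]
  have hb1 : |∑ k, 1 / (s j * s k) *
      ((∫ ω, V k ω ∂μ) * (∫ ω, φ k ω ∂μ) - ∫ ω, φ k ω * V k ω ∂μ)|
      ≤ ∑ k, M1 k / (s j * s k) *
        Real.sqrt (variance (condExp (sigmaW μ I t s) μ (V k)) μ) := by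
    refine (Finset.abs_sum_le_sum_abs _ _).trans (Finset.sum_le_sum fun k _ => ?_)
    have hk := hs k
    rw [abs_mul, abs_of_pos (by positivity : 0 < 1 / (s j * s k))]
    refine (mul_le_mul_of_nonneg_left (hcond k) (by positivity)).trans (le_of_eq ?_)
    ring
  have hb2 : |1 / s j * ∑ α ∈ block1 t j, (A α - ∑ k, 1 / s k * ∫ ω, φ k ω * D α k ω ∂μ)|
      ≤ 1 / s j * ∑ α ∈ block1 t j, B α := by
    rw [abs_mul, abs_of_pos (by positivity : 0 < 1 / s j)]
    refine mul_le_mul_of_nonneg_left ?_ (by positivity)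
    exact (Finset.abs_sum_le_sum_abs _ _).trans (Finset.sum_le_sum fun α _ => hAB α)
  refine (abs_sub _ _).trans ((add_le_add hb1 hb2).trans (le_of_eq ?_))
  rw [add_assoc]
  congr 1
  simp only [hB]
  rw [Finset.sum_add_distrib, mul_add]
  congr 1
  · rw [← Finset.mul_sum, mul_left_comm]
    congr 1
    rw [Finset.sum_comm, Finset.mul_sum]
    refine Finset.sum_congr rfl fun k _ => ?_
    rw [Finset.sum_comm, Finset.mul_sum]
    refine Finset.sum_congr rfl fun l _ => ?_
    rw [← Finset.mul_sum, ← mul_assoc]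
    have hk := hs k
    have hl := hs l
    congr 1
    field_simp
  · rw [Finset.sum_comm, Finset.mul_sum]
    refine Finset.sum_congr rfl fun k _ => ?_
    rw [← Finset.mul_sum, ← mul_assoc]
    congr 1
    field_simp

/-- Both `λ_k` and `W_{2k}` are sums over the block. The coupling turns `p_α E g(W)` into an
expectation at the coupled vector, to be compared for each `α` with the original vector lacking `α`.
-/
lemma abs_integral_poisson_part_le [DecidableEq Γ] (hI : ∀ α, Measurable (I α))
    (hI01 : ∀ α ω, I α ω = 0 ∨ I α ω = 1)
    (hJ : ∀ β α, Measurable (J β α)) (hJ01 : ∀ β α ω, J β α ω = 0 ∨ J β α ω = 1)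
    (hIJ : IsCoupling μ I J) (hs : ∀ j, 0 < s j) {g : E d → L r → ℝ}
    (hg : ∀ y, ContDiff ℝ 1 fun x => g x y) {M : Fin d → ℝ} (hM : ∀ j x y, |dX j g x y| ≤ M j)
    {K : ℝ} (hK : ∀ l x y, |dY l g x y| ≤ K) (k : Fin r) :
    |∫ ω, (meanW2 μ I t k * g (W1 μ I t s ω) (W2 I t ω)
        - (W2 I t ω k : ℝ) * g (W1 μ I t s ω) (W2 I t ω - Pi.single k 1)) ∂μ|
      ≤ (∑ j, M j / s j * ∑ α ∈ block2 t k,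
          ∫ ω, |(I α ω : ℝ) * ∑ β ∈ block1 t j, diffIJ I J α β ω| ∂μ)
        + K * ∑ α ∈ block2 t k, (prob μ I α ^ 2 + ∑ β ∈ (union2 t).erase α,
            ∫ ω, (I α ω : ℝ) * |diffIJ I J α β ω| ∂μ) := by
  have Ip := fun α => integrable_pair (μ := μ) (measurable_indicators hI)
    (measurable_indicators fun β => hJ β α) (indicators_le_one hI01)
    (indicators_le_one fun β => hJ01 β α)
  have hIα : ∀ α, Integrable (fun ω => (I α ω : ℝ)) μ := fun α => Ip α fun x _ => (x α : ℝ)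
  set G : (Γ → ℕ) → ℝ := fun x => g (vecW1 (prob μ I) t s x) (vecW2 t x) with hG
  set G' : (Γ → ℕ) → ℝ := fun x =>
    g (vecW1 (prob μ I) t s x) (vecW2 t x - Pi.single k 1) with hG'
  have hGi : Integrable (fun ω => G fun β => I β ω) μ :=
    integrable_pair (measurable_indicators hI) (measurable_indicators hI) (indicators_le_one hI01)
      (indicators_le_one hI01) fun x _ => G x
  have i1 : ∀ α, Integrable (fun ω => (I α ω : ℝ) * G' fun β => I β ω) μ := fun α =>
    Ip α fun x _ => (x α : ℝ) * G' x
  have i2 : ∀ α, Integrable (fun ω => (I α ω : ℝ) * G fun β => J β α ω) μ := fun α =>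
    Ip α fun x x' => (x α : ℝ) * G x'
  have hmean : meanW2 μ I t k = ∑ α ∈ block2 t k, prob μ I α := by
    simp only [meanW2, W2, Nat.cast_sum, prob]
    rw [integral_finsetSum _ fun α _ => hIα α]
  have hmain : ∫ ω, (meanW2 μ I t k * g (W1 μ I t s ω) (W2 I t ω)
        - (W2 I t ω k : ℝ) * g (W1 μ I t s ω) (W2 I t ω - Pi.single k 1)) ∂μ
      = ∑ α ∈ block2 t k, ∫ ω, (I α ω : ℝ) *
        ((G fun β => J β α ω) - G' fun β => I β ω) ∂μ := by
    have e : ∀ ω, meanW2 μ I t k * g (W1 μ I t s ω) (W2 I t ω)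
        - (W2 I t ω k : ℝ) * g (W1 μ I t s ω) (W2 I t ω - Pi.single k 1)
        = meanW2 μ I t k * (G fun β => I β ω)
          - ∑ α ∈ block2 t k, (I α ω : ℝ) * G' fun β => I β ω := by
      intro ω
      rw [← Finset.sum_mul, ← Nat.cast_sum]
      rfl
    simp_rw [e]
    rw [integral_sub (hGi.const_mul _) (integrable_finsetSum _ fun α _ => i1 α),
      integral_const_mul, integral_finsetSum _ fun α _ => i1 α, hmean, Finset.sum_mul,
      ← Finset.sum_sub_distrib]
    refine Finset.sum_congr rfl fun α _ => ?_
    simp_rw [mul_sub]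
    rw [integral_sub (i2 α) (i1 α), integral_coupling hI hI01 hJ hIJ]
  rw [hmain]
  have hb : ∀ α ∈ block2 t k, |∫ ω, (I α ω : ℝ) *
      ((G fun β => J β α ω) - G' fun β => I β ω) ∂μ|
      ≤ ∑ j, M j / s j * ∫ ω, |(I α ω : ℝ) * ∑ β ∈ block1 t j, diffIJ I J α β ω| ∂μ
        + K * (prob μ I α ^ 2 + ∑ β ∈ (union2 t).erase α,
            ∫ ω, (I α ω : ℝ) * |diffIJ I J α β ω| ∂μ) := by
    intro α hα
    -- The term `x' α` left by the removal has mean `p_α²`: the coupling identity applied to the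
    -- coordinate `α` itself.
    have hsq : prob μ I α ^ 2 = ∫ ω, (I α ω : ℝ) * (J α α ω : ℝ) ∂μ := by
      rw [sq]
      exact integral_coupling hI hI01 hJ hIJ α fun x => (x α : ℝ)
    rw [hsq]
    exact abs_integral_removal_le hg hM hK hs (measurable_indicators hI)
      (measurable_indicators fun β => hJ β α) (indicators_le_one hI01)
      (indicators_le_one fun β => hJ01 β α) (by simpa [block2] using hα)
  refine (Finset.abs_sum_le_sum_abs _ _).trans ((Finset.sum_le_sum hb).trans (le_of_eq ?_))
  rw [Finset.sum_add_distrib, Finset.sum_comm, ← Finset.mul_sum]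
  simp_rw [Finset.mul_sum]

/-! ### Assembling the bound from the two parts -/

lemma sum_block2 (φ : Γ → ℝ) :
    ∑ k, ∑ α ∈ block2 t k, φ α = ∑ α ∈ union2 t, φ α := by
  classical
  rw [← Finset.sum_biUnion]
  · congr 1
    ext β
    simp [block2, union2]
  · intro l _ l' _ hll
    refine Finset.disjoint_left.2 fun β hβ hβ' => hll ?_
    simp only [block2, Finset.mem_filter] at hβ hβ'
    exact Sum.inr_injective (hβ.2.symm.trans hβ'.2)

lemma dX_comm {F : E d → L r → ℝ} (hF : ∀ y, ContDiff ℝ 2 fun x => F x y) (j k : Fin d) :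
    dX j (dX k F) = dX k (dX j F) := by
  ext x y
  exact congrFun (pderiv_comm (hF y) j k) x

lemma dX_dY_comm {F : E d → L r → ℝ} (hF : ∀ y, ContDiff ℝ 1 fun x => F x y) (j : Fin d)
    (k : Fin r) : dX j (dY k F) = dY k (dX j F) := by
  ext x y
  have hd : ∀ y, DifferentiableAt ℝ (fun x => F x y) x := fun y =>
    (hF y).differentiable (by simp) x
  have h := (hd (y + Pi.single k 1)).hasFDerivAt.sub (hd y).hasFDerivAt
  simp only [dX, dY]
  rw [pderiv_of_hasFDerivAt (hd (y + Pi.single k 1)).hasFDerivAt,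
    pderiv_of_hasFDerivAt (hd y).hasFDerivAt]
  exact pderiv_of_hasFDerivAt h j

lemma integral_limit {Ω' : Type*} [MeasurableSpace Ω'] {P : Measure Ω'} [IsProbabilityMeasure P]
    {S : Matrix (Fin d) (Fin d) ℝ} {lam : Fin r → ℝ} {Z : Ω' → E d} {N : Ω' → L r}
    (hZ : HasLaw Z (normalLaw S) P) (hN : HasLaw N (poissonLaw lam) P) (hZN : IndepFun Z N P)
    {h : E d → L r → ℝ} (hh : ∀ y, Continuous fun x => h x y) :
    ∫ ω, h (Z ω) (N ω) ∂P = limitMean S lam h := by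
  have hm := measurable_uncurry_of_continuous hh
  rw [limitMean, ← hZ.map_eq, ← hN.map_eq,
    ← hZN.map_prod_eq_prod_map_map hZ.aemeasurable hN.aemeasurable,
    integral_map (hZ.aemeasurable.prodMk hN.aemeasurable) hm.aestronglyMeasurable]

lemma abs_sum_integral_stein_operator_le [DecidableEq Γ] (hI : ∀ α, Measurable (I α))
    (hI01 : ∀ α ω, I α ω = 0 ∨ I α ω = 1)
    (hJ : ∀ β α, Measurable (J β α)) (hJ01 : ∀ β α ω, J β α ω = 0 ∨ J β α ω = 1)
    (hIJ : IsCoupling μ I J) (hs : ∀ j, 0 < s j) {f : E d → L r → ℝ}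
    (hfc : ∀ y, ContDiff ℝ 3 fun x => f x y)
    (hB2 : ∀ j k, IsBdd (dX j (dX k f))) (hB3 : ∀ j k l, IsBdd (dX j (dX k (dX l f))))
    (hBc : ∀ k j, IsBdd (dY k (dX j f))) (hBd : ∀ j k, IsBdd (dY j (dY k f))) :
    |∑ j, ∫ ω, (∑ k, covW1 μ I t s j k * dX k (dX j f) (W1 μ I t s ω) (W2 I t ω)
      - W1 μ I t s ω j * dX j f (W1 μ I t s ω) (W2 I t ω)) ∂μ
      + 2 * ∑ k, ∫ ω, (meanW2 μ I t k * dY k f (W1 μ I t s ω) (W2 I t ω)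
      - (W2 I t ω k : ℝ) * dY k f (W1 μ I t s ω) (W2 I t ω - Pi.single k 1)) ∂μ| ≤
      (∑ j, ∑ k, supNorm (dX j (dX k f)) / (s j * s k) *
        Real.sqrt (variance
          (condExp (sigmaW μ I t s) μ fun ω =>
            ∑ α ∈ block1 t j, (I α ω : ℝ) * ∑ β ∈ block1 t k, diffIJ I J α β ω) μ))
      + 1 / 2 * (∑ j, ∑ k, ∑ l, supNorm (dX j (dX k (dX l f))) / (s j * s k * s l) *
        ∑ α ∈ block1 t j, ∫ ω, |(I α ω : ℝ) * (∑ β ∈ block1 t k, diffIJ I J α β ω) *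
          (∑ γ ∈ block1 t l, diffIJ I J α γ ω)| ∂μ)
      + (∑ j, ∑ k, supNorm (dY k (dX j f)) / s j *
        ∑ α ∈ block1 t j, ∫ ω, |(I α ω : ℝ) * ∑ β ∈ block2 t k, diffIJ I J α β ω| ∂μ)
      + 2 * (∑ k, ∑ j, supNorm (dY k (dX j f)) / s j *
        ∑ α ∈ block2 t k, ∫ ω, |(I α ω : ℝ) * ∑ β ∈ block1 t j, diffIJ I J α β ω| ∂μ)
      + 2 * (⨆ j, ⨆ k, supNorm (dY j (dY k f))) *
        ((∑ α ∈ union2 t, prob μ I α ^ 2)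
          + ∑ α ∈ union2 t, ∑ β ∈ (union2 t).erase α,
              ∫ ω, (I α ω : ℝ) * |diffIJ I J α β ω| ∂μ) := by
  have hfc2 : ∀ y, ContDiff ℝ 2 fun x => f x y := fun y => (hfc y).of_le (by norm_num)
  have hgc2 : ∀ j y, ContDiff ℝ 2 fun x => dX j f x y := fun j y =>
    contDiff_pderiv (n := 2) (hfc y) j
  -- The expansion of `dX j f` yields derivatives in the reverse of the order used in the bound;
  -- symmetry for `C^3` functions reconciles them.
  have c3 : ∀ j k l, dX l (dX k (dX j f)) = dX j (dX k (dX l f)) := fun j k l => by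
    rw [dX_comm hfc2 k j, dX_comm (hgc2 k) l j, dX_comm hfc2 l k]
  have hnormal := fun j => abs_integral_normal_part_le (t := t) hI hI01 hJ hJ01 hIJ hs (hgc2 j)
    (M1 := fun k => supNorm (dX j (dX k f)))
    (fun k x y => by rw [dX_comm hfc2 k j]; exact abs_le_supNorm (hB2 j k) x y)
    (M := fun k l => supNorm (dX j (dX k (dX l f))))
    (fun k l x y => by rw [c3]; exact abs_le_supNorm (hB3 j k l) x y)
    (K := fun k => supNorm (dY k (dX j f)))
    (fun k x y => abs_le_supNorm (hBc k j) x y) j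
  have hpoisson := fun k => abs_integral_poisson_part_le (t := t) hI hI01 hJ hJ01 hIJ hs
    (g := dY k f) (fun y => ((hfc _).sub (hfc y)).of_le (by norm_num))
    (M := fun j => supNorm (dY k (dX j f)))
    (fun j x y => by
      rw [dX_dY_comm (fun y => (hfc y).of_le (by norm_num))]
      exact abs_le_supNorm (hBc k j) x y)
    -- One constant for all pairs allows the sums over the blocks to merge into a sum over `union2
    -- t`. The suprema are over finite types, hence bounded above.
    (K := ⨆ j, ⨆ k, supNorm (dY j (dY k f)))
    (fun l x y => (abs_le_supNorm (hBd l k) x y).trans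
      ((le_ciSup (Finite.bddAbove_range fun k => supNorm (dY l (dY k f))) k).trans
        (le_ciSup (Finite.bddAbove_range fun j => ⨆ k, supNorm (dY j (dY k f))) l))) k
  refine (abs_add_le _ _).trans ((add_le_add (Finset.abs_sum_le_sum_abs _ _) (le_of_eq (abs_mul _ _))
    ).trans ?_)
  rw [abs_of_pos (by norm_num : (0 : ℝ) < 2)]
  refine (add_le_add (Finset.sum_le_sum fun j _ => hnormal j) (mul_le_mul_of_nonneg_left
    ((Finset.abs_sum_le_sum_abs _ _).trans (Finset.sum_le_sum fun k _ => hpoisson k))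
    (by norm_num))).trans (le_of_eq ?_)
  rw [Finset.sum_add_distrib, Finset.sum_add_distrib, Finset.sum_add_distrib, ← Finset.mul_sum,
    ← Finset.mul_sum, sum_block2, Finset.sum_add_distrib]
  ring

lemma integral_sub_eq_stein_operator (hI : ∀ α, Measurable (I α))
    (hI01 : ∀ α ω, I α ω = 0 ∨ I α ω = 1) {f h : E d → L r → ℝ} {c : ℝ}
    (hstein : ∀ x y, ∑ j, ∑ k, covW1 μ I t s j k * dX k (dX j f) x y - ∑ j, x j * dX j f x y
      + 2 * ∑ k, (meanW2 μ I t k * dY k f x y - y k * dY k f x (y - Pi.single k 1))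
      = h x y - c) :
    ∫ ω, h (W1 μ I t s ω) (W2 I t ω) ∂μ - c
      = ∑ j, ∫ ω, (∑ k, covW1 μ I t s j k * dX k (dX j f) (W1 μ I t s ω) (W2 I t ω)
        - W1 μ I t s ω j * dX j f (W1 μ I t s ω) (W2 I t ω)) ∂μ
      + 2 * ∑ k, ∫ ω, (meanW2 μ I t k * dY k f (W1 μ I t s ω) (W2 I t ω)
        - (W2 I t ω k : ℝ) * dY k f (W1 μ I t s ω) (W2 I t ω - Pi.single k 1)) ∂μ := by
  have Ip : ∀ G : E d → L r → ℝ, Integrable (fun ω => G (W1 μ I t s ω) (W2 I t ω)) μ := fun G =>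
    integrable_pair (measurable_indicators hI) (measurable_indicators hI)
      (indicators_le_one hI01) (indicators_le_one hI01)
      fun x _ => G (vecW1 (prob μ I) t s x) (vecW2 t x)
  have i1 := fun j => Ip fun x y => ∑ k, covW1 μ I t s j k * dX k (dX j f) x y - x j * dX j f x y
  have i2 := fun k => Ip fun x y =>
    meanW2 μ I t k * dY k f x y - (y k : ℝ) * dY k f x (y - Pi.single k 1)
  have hc : c = ∫ _, c ∂μ := by simp
  rw [← integral_finsetSum _ fun j _ => i1 j, ← integral_finsetSum _ fun k _ => i2 k,
    ← integral_const_mul, ← integral_add (integrable_finsetSum _ fun j _ => i1 j)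
      ((integrable_finsetSum _ fun k _ => i2 k).const_mul 2)]
  conv_lhs => rw [hc]
  rw [← integral_sub (Ip h) (integrable_const _)]
  refine integral_congr_ae (.of_forall fun ω => ?_)
  simp only [Finset.sum_sub_distrib, ← hstein]

end

end NormalPoisson

end

open NormalPoisson in
theorem theorem3p1
    {Ω Ω' Γ : Type*} [MeasurableSpace Ω] [MeasurableSpace Ω'] [Fintype Γ] [DecidableEq Γ]
    (μ : Measure Ω) [IsProbabilityMeasure μ] (P : Measure Ω') [IsProbabilityMeasure P]
    {d r : ℕ}
    -- the indicators `I α = I_α` and the coupled indicators `J β α = J_{βα}`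
    (I : Γ → Ω → ℕ) (hI : ∀ α, Measurable (I α)) (hI01 : ∀ α ω, I α ω = 0 ∨ I α ω = 1)
    (J : Γ → Γ → Ω → ℕ) (hJ : ∀ β α, Measurable (J β α))
    (hJ01 : ∀ β α ω, J β α ω = 0 ∨ J β α ω = 1)
    (hIJ : IsCoupling μ I J)
    -- the partition of the index set and the positive scaling constants
    (t : Γ → Fin d ⊕ Fin r) (s : Fin d → ℝ) (hs : ∀ j, 0 < s j)
    (hlam : ∀ j, 0 < meanW2 μ I t j)
    -- the limit vectors
    (Z : Ω' → E d) (N : Ω' → L r)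
    (hZ : HasLaw Z (normalLaw (covW1 μ I t s)) P)
    (hN : HasLaw N (poissonLaw (meanW2 μ I t)) P)
    (hZN : IndepFun Z N P)
    (h : E d → L r → ℝ) (hh : MemH3 h)
    (f : E d → L r → ℝ) (hf : f = steinSol (covW1 μ I t s) (meanW2 μ I t) h) :
    SteinSolRegular (covW1 μ I t s) (meanW2 μ I t) h ∧
    |∫ ω, h (W1 μ I t s ω) (W2 I t ω) ∂μ - ∫ ω, h (Z ω) (N ω) ∂P| ≤
      (∑ j, ∑ k, supNorm (dX j (dX k f)) / (s j * s k) *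
        Real.sqrt (variance
          (condExp (sigmaW μ I t s) μ fun ω =>
            ∑ α ∈ block1 t j, (I α ω : ℝ) * ∑ β ∈ block1 t k, diffIJ I J α β ω) μ))
      + 1 / 2 * (∑ j, ∑ k, ∑ l, supNorm (dX j (dX k (dX l f))) / (s j * s k * s l) *
        ∑ α ∈ block1 t j, ∫ ω, |(I α ω : ℝ) * (∑ β ∈ block1 t k, diffIJ I J α β ω) *
          (∑ γ ∈ block1 t l, diffIJ I J α γ ω)| ∂μ)
      + (∑ j, ∑ k, supNorm (dY k (dX j f)) / s j *
        ∑ α ∈ block1 t j, ∫ ω, |(I α ω : ℝ) * ∑ β ∈ block2 t k, diffIJ I J α β ω| ∂μ)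
      + 2 * (∑ k, ∑ j, supNorm (dY k (dX j f)) / s j *
        ∑ α ∈ block2 t k, ∫ ω, |(I α ω : ℝ) * ∑ β ∈ block1 t j, diffIJ I J α β ω| ∂μ)
      + 2 * (⨆ j, ⨆ k, supNorm (dY j (dY k f))) *
        ((∑ α ∈ union2 t, prob μ I α ^ 2)
          + ∑ α ∈ union2 t, ∑ β ∈ (union2 t).erase α,
              ∫ ω, (I α ω : ℝ) * |diffIJ I J α β ω| ∂μ) := by
  subst hf
  have hS := posSemidef_covW1 (t := t) (s := s) hI hI01 (μ := μ)
  have hlam0 : ∀ j, 0 ≤ meanW2 μ I t j := fun j => (hlam j).le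
  have hb3 := hh.bddSmooth
  have hb2 : BddSmooth 2 h := ⟨hb3.1, hb3.2.1, fun j => ⟨(hb3.2.2 j).1, (hb3.2.2 j).2.1,
    fun k => ((hb3.2.2 j).2.2 k).zero⟩⟩
  have hreg := steinSolRegular hS hlam0 hb3
  refine ⟨hreg, ?_⟩
  have hstein := stein_equation hS hlam0 hb2
  rw [integral_limit hZ hN hZN hb3.continuous]
  have hfc := hreg.contDiff
  obtain ⟨-, -, -, hB2, hB3, hBc, hBd⟩ := hreg
  rw [integral_sub_eq_stein_operator hI hI01 hstein]
  exact abs_sum_integral_stein_operator_le hI hI01 hJ hJ01 hIJ hs hfc hB2 hB3 hBc hBd
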